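/- **Notation.** Write $e(z)=\exp(2\pi i z)$, let $\overline{\Omega}$ be the entrywise complex conjugate of a matrix $\Omega$, and write $f(c)\big|_{c=c_1}^{c_2}=f(c_2)-f(c_1)$. Let $\Omega$ be a complex symmetric $g\times g$ matrix such that $M=\operatorname{Im}(\Omega)$ has signature $(g-1,1)$, let $p,q\in\mathbb R^g$, and let $c_1,c_2\in R_M:=\{c\in\mathbb C^g:\overline{c}^{\top}Mc<0\}$. On $R_M$ the function $c\mapsto -c^\top Mc$ has exactly two continuous square roots, which differ by sign. Fix either one, denote it by $\sqrt{-c^\top Mc}$, and put $\sqrt{-\tfrac12c^\top Mc}=\tfrac1{\sqrt2}\sqrt{-c^\top Mc}$ and $\sqrt{-c^\top (tM)c}=\sqrt t\,\sqrt{-c^\top Mc}$ for $t>0$. If $\Omega$ is invertible, put $M'=\operatorname{Im}(-\Omega^{-1})$, which again has signature $(g-1,1)$, and fix in the same way either square root $\sqrt{-c^\top M'c}$ on $R_{M'}$; then $\overline\Omega c\in R_{M'}$ for $c\in R_M$. With $\mathcal E(\alpha)=\int_0^\alpha e^{-\pi u^2}\,du$ define, for $z\in\mathbb C^g$, $$\Theta^{c_1,c_2}(z;\Omega)=\sum_{n\in\mathbb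 Z^g}\mathcal E\!\left(\frac{c^\top\operatorname{Im}(\Omega n+z)}{\sqrt{-\frac12c^\top Mc}}\right)\Bigg|_{c=c_1}^{c_2}e\!\left(\tfrac12n^\top\Omega n+n^\top z\right),$$ $$\Theta^{c_1,c_2}_{p,q}(\Omega)=e\!\left(\tfrac12q^\top\Omega q+p^\top q\right)\Theta^{c_1,c_2}(p+\Omega q;\Omega),\qquad \widehat\zeta^{\,c_1,c_2}_{p,q}(\Omega,s)=\int_0^\infty\Theta^{c_1,c_2}_{p,q}(t\Omega)\,t^s\,\frac{dt}{t}.$$ For $\Omega$ invertible and $c\in R_M$ put $\Omega_c=\Omega-\frac{2i}{c^\top Mc}Mcc^\top M$, whose imaginary part is positive definite, and $$\sqrt{\det(-i\Omega)}=\frac{\sqrt{-c^\top Mc}}{\sqrt{-(\overline\Omega c)^\top M'(\overline\Omega c)}}\left(\int_{\mathbb R^g}e\!\left(\tfrac12x^\top\Omega_cx\right)dx\right)^{-1}.$$ This is a square root of $\det(-i\Omega)$ and does not depend on $c$. **Theorem.** The theta series of $\Theta^{c_1,c_2}_{p,q}(t\Omega)$ converges absolutely for every $t>0$; the integral defining $\widehat\zeta^{\,c_1,c_2}_{p,q}(\Omega,s)$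 converges absolutely for every $s\in\mathbb C$ and is an entire function of $s$. If $\Omega$ is invertible, then for all $c\in R_M$ (in the definition of the square root) and all $s\in\mathbb C$, $$\widehat\zeta^{\,c_1,c_2}_{p,q}\!\left(\Omega,\tfrac g2-s\right)=-\,\frac{e(p^\top q)}{\sqrt{\det(-i\Omega)}}\;\widehat\zeta^{\,\overline\Omega c_1,\overline\Omega c_2}_{-q,p}\!\left(-\Omega^{-1},s\right).$$ -/

import Mathlib

open scoped Matrix

noncomputable section

namespace IndefZeta

/-- `e(z) = exp(2πiz)`. -/
def e (z : ℂ) : ℂ := Complex.exp (2 * Real.pi * Complex.I * z)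

/-- Entrywise imaginary part of a complex matrix. -/
def imMat {g : ℕ} (Ω : Matrix (Fin g) (Fin g) ℂ) : Matrix (Fin g) (Fin g) ℝ := Ω.map Complex.im

/-- Entrywise complex conjugate of a matrix (no transposition). -/
def conjMat {g : ℕ} (Ω : Matrix (Fin g) (Fin g) ℂ) : Matrix (Fin g) (Fin g) ℂ :=
  Ω.map (starRingEnd ℂ)

/-- A real matrix regarded as a complex matrix. -/
def toC {g : ℕ} (M : Matrix (Fin g) (Fin g) ℝ) : Matrix (Fin g) (Fin g) ℂ := M.map Complex.ofReal

/-- The real matrix `M` is symmetric with `j` positive and `k` negative eigenvalues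
(with multiplicity), and no others. -/
def HasSignature {g : ℕ} (M : Matrix (Fin g) (Fin g) ℝ) (j k : ℕ) : Prop :=
  j + k = g ∧ ∃ h : M.IsHermitian,
    (Finset.univ.filter fun i => 0 < h.eigenvalues i).card = j ∧
    (Finset.univ.filter fun i => h.eigenvalues i < 0).card = k

/-- The Siegel intermediate half-space of genus `g` and index `k`. -/
def siegelHalfSpace (g k : ℕ) : Set (Matrix (Fin g) (Fin g) ℂ) :=
  {Ω | Ωᵀ = Ω ∧ HasSignature (imMat Ω) (g - k) k}

/-- The region `{z ∈ ℂ^g : z̄ᵀ M z < 0}`. For symmetric real `M` the quantity `z̄ᵀ M z` is real. -/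
def negCone {g : ℕ} (M : Matrix (Fin g) (Fin g) ℝ) : Set (Fin g → ℂ) :=
  {z | (star z ⬝ᵥ (toC M *ᵥ z)).re < 0}

/-- `ρ` is a continuous (hence holomorphic) branch of `z ↦ √(-zᵀ M z)` on the region
`z̄ᵀ M z < 0`. When `M` has signature `(g-1,1)` there are exactly two, and they differ by sign. -/
def IsSqrtBranch {g : ℕ} (M : Matrix (Fin g) (Fin g) ℝ) (ρ : (Fin g → ℂ) → ℂ) : Prop :=
  ContinuousOn ρ (negCone M) ∧ ∀ z ∈ negCone M, ρ z ^ 2 = -(z ⬝ᵥ (toC M *ᵥ z))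

/-- The square root of `det(-iΩ)` for `Ω` with positive definite imaginary part:
`(∫_{ℝ^g} e(½ xᵀ Ω x) dx)⁻¹`. -/
def sqrtDetDefinite {g : ℕ} (Ω : Matrix (Fin g) (Fin g) ℂ) : ℂ :=
  (∫ x : Fin g → ℝ, e (1 / 2 * ((fun j => (x j : ℂ)) ⬝ᵥ (Ω *ᵥ fun j => (x j : ℂ)))))⁻¹

/-- The matrix `Ω - (2i / (cᵀ M c)) M c cᵀ M` with `M = Im Ω`; its imaginary part is positive
definite when `c` lies in the region `c̄ᵀ M c < 0`. -/
def omegaC {g : ℕ} (Ω : Matrix (Fin g) (Fin g) ℂ) (c : Fin g → ℂ) :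
    Matrix (Fin g) (Fin g) ℂ :=
  Ω - (2 * Complex.I / (c ⬝ᵥ (toC (imMat Ω) *ᵥ c))) •
    (toC (imMat Ω) * Matrix.vecMulVec c c * toC (imMat Ω))

/-- The square root of `det(-iΩ)` for `Ω` of index one. Here `ρ` and `ρ'` are the branches of
`√(-zᵀ M z)` for `M = Im Ω` and `M = Im (-Ω⁻¹)`. The value is independent of the
choice of `c` in the region `c̄ᵀ (Im Ω) c < 0`. -/
def sqrtDet {g : ℕ} (ρ ρ' : (Fin g → ℂ) → ℂ) (c : Fin g → ℂ) (Ω : Matrix (Fin g) (Fin g) ℂ) : ℂ :=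
  ρ c * sqrtDetDefinite (omegaC Ω c) / ρ' (conjMat Ω *ᵥ c)

/-- The incomplete Gaussian transform `∫_0^α exp(-πu²) du`, along the segment from `0` to `α`
(the integrand is entire, so the contour does not matter). -/
def incGauss (α : ℂ) : ℂ :=
  α * ∫ x in (0 : ℝ)..1, Complex.exp (-Real.pi * (α * x) ^ 2)

/-- The `n`-th term of the indefinite theta series, where `ρ` is the branch
of `√(-cᵀ (Im Ω) c)` in use and `√(-½ cᵀ (Im Ω) c)` means `ρ c / √2`. -/
def thetaTerm {g : ℕ} (ρ : (Fin g → ℂ) → ℂ) (c₁ c₂ z : Fin g → ℂ)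
    (Ω : Matrix (Fin g) (Fin g) ℂ) (n : Fin g → ℤ) : ℂ :=
  let ν : Fin g → ℂ := fun j => (n j : ℂ)
  let y : Fin g → ℂ := fun j => (((Ω *ᵥ ν + z) j).im : ℂ)
  (incGauss ((c₂ ⬝ᵥ y) / (ρ c₂ / (Real.sqrt 2 : ℂ)))
    - incGauss ((c₁ ⬝ᵥ y) / (ρ c₁ / (Real.sqrt 2 : ℂ)))) *
    e (1 / 2 * (ν ⬝ᵥ (Ω *ᵥ ν)) + ν ⬝ᵥ z)

/-- The indefinite theta function `Θ^{c₁,c₂}(z; Ω)`. -/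
def indefTheta {g : ℕ} (ρ : (Fin g → ℂ) → ℂ) (c₁ c₂ z : Fin g → ℂ)
    (Ω : Matrix (Fin g) (Fin g) ℂ) : ℂ :=
  ∑' n : Fin g → ℤ, thetaTerm ρ c₁ c₂ z Ω n

/-- The point `p + Ω q` of `ℂ^g` with real characteristics `p, q`. -/
def charPoint {g : ℕ} (p q : Fin g → ℝ) (Ω : Matrix (Fin g) (Fin g) ℂ) : Fin g → ℂ :=
  (fun j => (p j : ℂ)) + Ω *ᵥ fun j => (q j : ℂ)

/-- The indefinite theta null with characteristics `Θ^{c₁,c₂}_{p,q}(Ω)`. -/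
def thetaNull {g : ℕ} (ρ : (Fin g → ℂ) → ℂ) (c₁ c₂ : Fin g → ℂ) (p q : Fin g → ℝ)
    (Ω : Matrix (Fin g) (Fin g) ℂ) : ℂ :=
  e (1 / 2 * ((fun j => (q j : ℂ)) ⬝ᵥ (Ω *ᵥ fun j => (q j : ℂ))) + ((p ⬝ᵥ q : ℝ) : ℂ)) *
    indefTheta ρ c₁ c₂ (charPoint p q Ω) Ω

/-- For `t > 0`, a branch `ρ` of `√(-zᵀ M z)` gives the branch `√t · ρ` of `√(-zᵀ (tM) z)`. -/
def scaleBranch {g : ℕ} (t : ℝ) (ρ : (Fin g → ℂ) → ℂ) : (Fin g → ℂ) → ℂ :=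
  fun z => (Real.sqrt t : ℂ) * ρ z

/-- The function `t ↦ Θ^{c₁,c₂}_{p,q}(tΩ)` of `t > 0`; `ρ` is the branch belonging to `Im Ω`. -/
def thetaRay {g : ℕ} (ρ : (Fin g → ℂ) → ℂ) (c₁ c₂ : Fin g → ℂ) (p q : Fin g → ℝ)
    (Ω : Matrix (Fin g) (Fin g) ℂ) (t : ℝ) : ℂ :=
  thetaNull (scaleBranch t ρ) c₁ c₂ p q ((t : ℂ) • Ω)

/-- The completed indefinite zeta function, the Mellin transform
`∫_0^∞ Θ^{c₁,c₂}_{p,q}(tΩ) t^s dt/t`. -/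
def zetaHat {g : ℕ} (ρ : (Fin g → ℂ) → ℂ) (c₁ c₂ : Fin g → ℂ) (p q : Fin g → ℝ)
    (Ω : Matrix (Fin g) (Fin g) ℂ) (s : ℂ) : ℂ :=
  mellin (thetaRay ρ c₁ c₂ p q Ω) s

/-- Branches exist for every matrix of signature `(g-1,1)`. -/
theorem exists_isSqrtBranch {g : ℕ} {M : Matrix (Fin g) (Fin g) ℝ}
    (hM : HasSignature M (g - 1) 1) : ∃ ρ, IsSqrtBranch M ρ := by
  obtain ⟨hg, h, hp, hn⟩ := hM
  set l := h.eigenvalues with hl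
  obtain ⟨i₀, hi₀⟩ := Finset.card_eq_one.1 hn
  have hneg : l i₀ < 0 := by
    have : i₀ ∈ (Finset.univ.filter fun i => l i < 0) := by rw [hi₀]; simp
    simpa using this
  have hpos : ∀ i, i ≠ i₀ → 0 < l i := by
    intro i hi
    have hsub : (Finset.univ.filter fun i => 0 < l i) ⊆ Finset.univ.erase i₀ := by
      intro j hj
      have hj' : 0 < l j := by simpa using hj
      refine Finset.mem_erase.2 ⟨?_, Finset.mem_univ _⟩
      rintro rfl
      linarith
    have heq := Finset.eq_of_subset_of_card_le hsub (by simp [hp])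
    have : i ∈ (Finset.univ.filter fun i => 0 < l i) := by rw [heq]; simp [hi]
    simpa using this
  set U : Matrix (Fin g) (Fin g) ℝ := (h.eigenvectorUnitary : Matrix (Fin g) (Fin g) ℝ) with hU
  have hspec : M = U * Matrix.diagonal l * Uᵀ := by
    have := h.spectral_theorem
    rw [Unitary.conjStarAlgAut_apply] at this
    simpa [Matrix.star_eq_conjTranspose, Matrix.conjTranspose_eq_transpose_of_trivial] using this
  let w : (Fin g → ℂ) → Fin g → ℂ := fun z => z ᵥ* toC U
  have hw : Continuous w := by
    refine continuous_pi fun i => ?_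
    simp only [w, Matrix.vecMul, dotProduct]
    fun_prop
  have hbil : ∀ x z : Fin g → ℂ, x ⬝ᵥ (toC M *ᵥ z) = ∑ i, (l i : ℂ) * (w x i * w z i) := by
    intro x z
    have hMc : toC M = toC U * Matrix.diagonal (fun i => (l i : ℂ)) * (toC U)ᵀ := by
      ext a b
      conv_lhs => rw [hspec]
      simp [toC, Matrix.mul_apply, Matrix.diagonal_apply]
    rw [hMc, ← Matrix.mulVec_mulVec, ← Matrix.mulVec_mulVec, Matrix.dotProduct_mulVec,
      Matrix.mulVec_transpose]
    simp only [dotProduct, Matrix.mulVec_diagonal]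
    exact Finset.sum_congr rfl fun i _ => by simp only [w]; ring
  have hstar : ∀ z i, w (star z) i = star (w z i) := by
    intro z i
    simp [w, Matrix.vecMul, dotProduct, toC]
  have hherm : ∀ z, (star z ⬝ᵥ (toC M *ᵥ z)).re = ∑ i, l i * ‖w z i‖ ^ 2 := by
    intro z
    rw [hbil, Complex.re_sum]
    refine Finset.sum_congr rfl fun i _ => ?_
    rw [hstar, Complex.star_def, Complex.conj_mul', ← Complex.ofReal_pow, ← Complex.ofReal_mul,
      Complex.ofReal_re]
  let S := Finset.univ.erase i₀
  have hlt : ∀ z ∈ negCone M, ∑ i ∈ S, l i * ‖w z i‖ ^ 2 < (-l i₀) * ‖w z i₀‖ ^ 2 := by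
    intro z hz
    have hz' : (star z ⬝ᵥ (toC M *ᵥ z)).re < 0 := hz
    rw [hherm, ← Finset.add_sum_erase _ _ (Finset.mem_univ i₀)] at hz'
    linarith
  have hSnn : ∀ z, 0 ≤ ∑ i ∈ S, l i * ‖w z i‖ ^ 2 := fun z =>
    Finset.sum_nonneg fun i hi => mul_nonneg (hpos i (Finset.ne_of_mem_erase hi)).le (sq_nonneg _)
  have hw0 : ∀ z ∈ negCone M, w z i₀ ≠ 0 := by
    intro z hz h0
    have h1 := hlt z hz
    rw [h0] at h1
    have h2 := hSnn z
    simp at h1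
    linarith
  let B : (Fin g → ℂ) → ℂ := fun z =>
    1 - (∑ i ∈ S, (l i : ℂ) * w z i ^ 2) / ((-l i₀ : ℝ) * w z i₀ ^ 2)
  have hB : ∀ z ∈ negCone M, 0 < (B z).re := by
    intro z hz
    have hden : 0 < (-l i₀) * ‖w z i₀‖ ^ 2 :=
      mul_pos (by linarith) (pow_pos (norm_pos_iff.2 (hw0 z hz)) 2)
    have hnorm : ‖(∑ i ∈ S, (l i : ℂ) * w z i ^ 2) / (((-l i₀ : ℝ) : ℂ) * w z i₀ ^ 2)‖ < 1 := by
      rw [norm_div, norm_mul, norm_pow, Complex.norm_real, Real.norm_of_nonneg (by linarith),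
        div_lt_one hden]
      refine lt_of_le_of_lt (norm_sum_le _ _) (lt_of_le_of_lt (le_of_eq ?_) (hlt z hz))
      refine Finset.sum_congr rfl fun i hi => ?_
      rw [norm_mul, norm_pow, Complex.norm_real,
        Real.norm_of_nonneg (hpos i (Finset.ne_of_mem_erase hi)).le]
    have := (Complex.re_le_norm _).trans_lt hnorm
    simp only [B, Complex.sub_re, Complex.one_re]
    linarith
  have hwi : ∀ i, Continuous fun z => w z i := fun i => (continuous_apply i).comp hw
  refine ⟨fun z => (Real.sqrt (-l i₀) : ℂ) * w z i₀ * B z ^ (1 / 2 : ℂ), ?_, ?_⟩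
  · have hBc : ContinuousOn B (negCone M) := by
      refine continuousOn_const.sub (ContinuousOn.div ?_ ?_ ?_)
      · exact (continuous_finsetSum _ fun i _ =>
          continuous_const.mul ((hwi i).pow 2)).continuousOn
      · exact (continuous_const.mul ((hwi i₀).pow 2)).continuousOn
      · intro z hz
        exact mul_ne_zero (Complex.ofReal_ne_zero.2 (by linarith)) (pow_ne_zero _ (hw0 z hz))
    refine ((continuous_const.mul (hwi i₀)).continuousOn).mul ?_
    exact hBc.cpow continuousOn_const fun z hz => Or.inl (hB z hz)
  · intro z hz
    have hsq : (B z ^ (1 / 2 : ℂ)) ^ 2 = B z := by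
      rw [← Complex.cpow_nat_mul]
      norm_num
    have hsr : ((Real.sqrt (-l i₀) : ℝ) : ℂ) ^ 2 = ((-l i₀ : ℝ) : ℂ) := by
      rw [← Complex.ofReal_pow, Real.sq_sqrt (by linarith)]
    have hl0 : ((-l i₀ : ℝ) : ℂ) ≠ 0 := Complex.ofReal_ne_zero.2 (by linarith)
    rw [mul_pow, mul_pow, hsq, hsr, hbil, ← Finset.add_sum_erase _ _ (Finset.mem_univ i₀)]
    simp only [B]
    have h0 := hw0 z hz
    have hS : ∑ i ∈ Finset.univ.erase i₀, (l i : ℂ) * (w z i * w z i)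
        = ∑ i ∈ S, (l i : ℂ) * w z i ^ 2 :=
      Finset.sum_congr rfl fun i _ => by ring
    rw [hS, mul_sub, mul_div_cancel₀ _ (mul_ne_zero hl0 (pow_ne_zero 2 h0))]
    push_cast
    ring

end IndefZeta

end

open IndefZeta

/-!
The difference of the two incomplete Gaussians, times the quadratic exponential, extends to a
function `F` on `ℝ^g` (`thetaKernel`), and `Θ_{p,q}(tΩ)` is the theta series
`∑ F(√t (n + q)) e(p·(n + q))` over `n ∈ ℤ^g` (`thetaRay_eq`). Everything follows from Poisson
summation once `F` and its Fourier transform are understood.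

The kernel at `c` does not change when `c` is rescaled, and any two points of the region
`c̄ᵀ M c < 0` are joined there, up to rescaling, by a path (`HasSignature.exists_path`).
Differentiating the kernel along the path turns the incomplete Gaussian into a Gaussian, which
completes `Ω` to `Ω_c`. Hence `F` is an integral over the path of functions
`(l_c · x) e(½ xᵀ Ω_c x)` (`thetaKernel_sub_eq_gaussAverage`). Since `Im Ω_c` is positive definite
(`isPosImag_omegaC`), uniformly on the path, `F` decreases rapidly. Being of this shape, it also
vanishes at `0`, and so does its Fourier transform, which is an average of the same kind
(`fourierPi_gaussAverage`). Decay and vanishing at the origin, where one of the lattice points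
`n + q` may lie, make the theta series converge and decay rapidly as `t → ∞`; Poisson summation
gives the same as `t → 0`. So the Mellin transform converges everywhere and is entire
(`mellin_latticeTheta`).

When `Ω` is invertible, `-Ω_c⁻¹ = (-Ω⁻¹)_{Ω̄c}` (`neg_omegaC_inv`), and `Ω_c⁻¹` carries the linear
form `l_c` to a multiple of the one belonging to `-Ω⁻¹` and the path `Ω̄ c`
(`omegaC_inv_mulVec_slopeForm`). The scalars that arise combine to the inverse of the square root
of `det(-iΩ)`. That root does not depend on `c`, because it is continuous, its square is constant
along the path (`sqrtDet_sq`, `sqrtDet_path_const`), and it does not change when `c` is rescaled.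
So the Fourier transform of `F` is the kernel of the dual data divided by `√det(-iΩ)`
(`exists_gaussAverage_eq`), and the Mellin transform of the inversion formula is the functional
equation. The minus sign appears because `F` is odd while the inversion formula exchanges the
characteristics `(p, q)` for `(q, -p)` instead of `(-q, p)`.
-/

noncomputable section

namespace IndefZeta

open MeasureTheory Set Filter Asymptotics Topology

/-! ### Lattice sums and Poisson summation on `ℝ^ι` -/

section Poisson

variable {ι : Type*} [Fintype ι]

theorem summable_norm_intCast_add_inv_pow {N : ℕ} (hN : Fintype.card ι < N) (a : ι → ℝ) :
    Summable fun n : ι → ℤ => (‖(fun i => (n i : ℝ)) + a‖ ^ N)⁻¹ := by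
  let L := Submodule.span ℤ (Set.range (Pi.basisFun ℝ ι))
  have hfin : Module.finrank ℤ L < N := by
    rw [ZLattice.rank ℝ L]; simpa using hN
  have h := ZLattice.summable_norm_sub_inv_pow L N hfin (-a)
  have hmem : ∀ n : ι → ℤ, (fun i => (n i : ℝ)) ∈ L := by
    classical
    intro n
    have : (fun i => (n i : ℝ)) = ∑ i, n i • Pi.basisFun ℝ ι i := by
      ext j; simp [Finset.sum_apply, Pi.single_apply]
    rw [this]
    exact Submodule.sum_mem _ fun i _ => Submodule.smul_mem _ _
      (Submodule.subset_span ⟨i, rfl⟩)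
  have hinj : Function.Injective fun n : ι → ℤ => (⟨fun i => (n i : ℝ), hmem n⟩ : L) := by
    intro m n hmn
    have := congrArg Subtype.val hmn
    ext i
    have h2 : (m i : ℝ) = n i := congrFun this i
    exact_mod_cast h2
  simpa [Function.comp_def] using h.comp_injective hinj

theorem summable_one_add_norm_intCast_inv_pow {N : ℕ} (hN : Fintype.card ι < N) :
    Summable fun n : ι → ℤ => ((1 + ‖fun i => (n i : ℝ)‖) ^ N)⁻¹ := by
  refine Summable.of_norm_bounded_eventually (summable_norm_intCast_add_inv_pow hN 0) ?_
  refine (Set.finite_singleton (0 : ι → ℤ)).subset fun n hn => ?_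
  by_contra h0
  refine hn ?_
  have hpos : 0 < ‖fun i => (n i : ℝ)‖ := by
    rw [norm_pos_iff]
    intro h
    refine h0 (funext fun i => ?_)
    have h2 : (n i : ℝ) = 0 := congrFun h i
    exact_mod_cast h2
  simp only [mem_ofPred_eq]
  rw [add_zero, Real.norm_of_nonneg (by positivity)]
  gcongr
  linarith

/-- The weighted bound for `f` gives a locally uniform bound for its lattice translates. -/
theorem norm_translate_le {f : (ι → ℝ) → ℂ} {N : ℕ} {C : ℝ}
    (hC : ∀ x, (1 + ‖x‖) ^ N * ‖f x‖ ≤ C) (x y : ι → ℝ) :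
    ‖f (x + y)‖ ≤ C * (1 + ‖x‖) ^ N * ((1 + ‖y‖) ^ N)⁻¹ := by
  have h1 : 1 + ‖y‖ ≤ (1 + ‖x‖) * (1 + ‖x + y‖) := by
    have : ‖y‖ ≤ ‖x‖ + ‖x + y‖ := by
      have := norm_sub_le (x + y) x
      rw [add_sub_cancel_left] at this
      linarith
    nlinarith [norm_nonneg x, norm_nonneg (x + y)]
  rw [← div_eq_mul_inv, le_div_iff₀ (by positivity)]
  calc ‖f (x + y)‖ * (1 + ‖y‖) ^ N ≤ ‖f (x + y)‖ * ((1 + ‖x‖) * (1 + ‖x + y‖)) ^ N := by gcongr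
    _ = ((1 + ‖x + y‖) ^ N * ‖f (x + y)‖) * (1 + ‖x‖) ^ N := by rw [mul_pow]; ring
    _ ≤ C * (1 + ‖x‖) ^ N := by gcongr; exact hC _

theorem continuous_tsum_translate {f : (ι → ℝ) → ℂ} (hf : Continuous f) {N : ℕ} {C : ℝ}
    (hN : Fintype.card ι < N) (hC : ∀ x, (1 + ‖x‖) ^ N * ‖f x‖ ≤ C) :
    Continuous fun x => ∑' n : ι → ℤ, f (x + fun i => (n i : ℝ)) := by
  have hC0 : 0 ≤ C := le_trans (by positivity) (hC 0)
  have key : ∀ R : ℝ, ContinuousOn (fun x => ∑' n : ι → ℤ, f (x + fun i => (n i : ℝ)))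
      (Metric.ball 0 R) := by
    intro R
    refine continuousOn_tsum (fun n => by fun_prop)
      ((summable_one_add_norm_intCast_inv_pow hN).mul_left (C * (1 + R) ^ N)) fun n x hx => ?_
    refine (norm_translate_le hC x _).trans ?_
    have : ‖x‖ < R := by simpa using hx
    gcongr
  rw [continuous_iff_continuousAt]
  intro x
  exact (key (‖x‖ + 1)).continuousAt (Metric.isOpen_ball.mem_nhds (by simp))

theorem integrable_of_one_add_norm_pow_mul_le {f : (ι → ℝ) → ℂ} (hf : Continuous f) {N : ℕ} {C : ℝ}
    (hN : Fintype.card ι < N) (hC : ∀ x, (1 + ‖x‖) ^ N * ‖f x‖ ≤ C) : Integrable f := by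
  have h := integrable_one_add_norm (E := ι → ℝ) (μ := volume) (r := (N : ℝ)) (by simpa using hN)
  refine (h.const_mul C).mono' hf.aestronglyMeasurable (.of_forall fun x => ?_)
  rw [Real.rpow_neg (by positivity), Real.rpow_natCast, ← div_eq_mul_inv,
    le_div_iff₀ (by positivity), mul_comm]
  exact hC x

theorem norm_e_ofReal (x : ℝ) : ‖e (x : ℂ)‖ = 1 := by
  have : (2 * Real.pi * Complex.I * x : ℂ) = ((2 * Real.pi * x : ℝ) : ℂ) * Complex.I := by
    push_cast; ring
  rw [e, this, Complex.norm_exp_ofReal_mul_I]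

theorem e_add (z w : ℂ) : e (z + w) = e z * e w := by
  simp only [e, mul_add, Complex.exp_add]

theorem e_intCast (n : ℤ) : e (n : ℂ) = 1 := by
  rw [e, show (2 * Real.pi * Complex.I * n : ℂ) = n * (2 * Real.pi * Complex.I) by ring]
  exact Complex.exp_int_mul_two_pi_mul_I n

theorem continuous_e : Continuous e := by unfold e; fun_prop

/-- The Fourier transform `∫ f(x) e(-ξ·x) dx` on `ℝ^ι`. -/
def fourierPi (f : (ι → ℝ) → ℂ) (ξ : ι → ℝ) : ℂ :=
  ∫ x, e (((-(ξ ⬝ᵥ x) : ℝ)) : ℂ) * f x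

theorem mFourier_coe (n : ι → ℤ) (x : ι → ℝ) :
    UnitAddTorus.mFourier n (fun i => (x i : UnitAddCircle)) =
      e ((((fun i => (n i : ℝ)) ⬝ᵥ x : ℝ)) : ℂ) := by
  simp only [UnitAddTorus.mFourier, ContinuousMap.coe_mk, fourier_coe_apply, e,
    ← Complex.exp_sum, dotProduct]
  congr 1
  push_cast
  rw [Finset.mul_sum]
  exact Finset.sum_congr rfl fun i _ => by ring

/-- The integral over `ℝ^ι` is the sum over `ℤ^ι` of the integrals over the translated unit
cubes. -/
theorem hasSum_integral_unit_cube {f : (ι → ℝ) → ℂ} (hf : Integrable f) :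
    HasSum (fun n : ι → ℤ => ∫ x in {x : ι → ℝ | ∀ i, x i ∈ Ioc (0 : ℝ) (0 + 1)},
      f (x + fun i => (n i : ℝ))) (∫ x, f x) := by
  set Q : Set (ι → ℝ) := {x | ∀ i, x i ∈ Ioc (0 : ℝ) (0 + 1)} with hQ
  have hQm : MeasurableSet Q := MeasurableSet.univ_pi' fun i => measurableSet_Ioc
  let S : (ι → ℤ) → Set (ι → ℝ) := fun n => (fun x => x + fun i => -(n i : ℝ)) ⁻¹' Q
  have hSm : ∀ n, MeasurableSet (S n) := fun n => (measurable_add_const _) hQm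
  have hmem : ∀ n x, x ∈ S n ↔ ∀ i, n i = ⌈x i⌉ - 1 := by
    intro n x
    refine forall_congr' fun i => ?_
    simp only [Pi.add_apply, mem_Ioc, eq_sub_iff_add_eq, eq_comm (b := ⌈x i⌉), Int.ceil_eq_iff]
    push_cast
    constructor <;> rintro ⟨h1, h2⟩ <;> constructor <;> linarith
  have hdisj : Pairwise (Function.onFun Disjoint S) := by
    intro m n hmn
    rw [Function.onFun, Set.disjoint_left]
    intro x hx hx'
    exact hmn (funext fun i => ((hmem m x).1 hx i).trans ((hmem n x).1 hx' i).symm)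
  have hun : ⋃ n, S n = univ := eq_univ_of_forall fun x =>
    mem_iUnion.2 ⟨fun i => ⌈x i⌉ - 1, (hmem _ x).2 fun i => rfl⟩
  have h := hasSum_integral_iUnion hSm hdisj (f := f) (μ := volume) hf.integrableOn
  rw [hun, setIntegral_univ] at h
  refine (funext fun n => ?_ : (fun n : ι → ℤ => ∫ x in Q, f (x + fun i => (n i : ℝ))) =
    fun n => ∫ x in S n, f x) ▸ h
  have := (measurePreserving_add_right (volume : Measure (ι → ℝ))
    (fun i => -(n i : ℝ))).setIntegral_preimage_emb (measurableEmbedding_addRight _)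
      (fun x => f (x + fun i => (n i : ℝ))) Q
  rw [← this]
  refine setIntegral_congr_fun (hSm n) fun x _ => ?_
  congr 1
  ext i; simp

/-- **Poisson summation** on `ℝ^ι`: the periodization of `f` descends to a continuous function on
the torus whose Fourier coefficients are the values of the Fourier transform of `f` on `ℤ^ι`. -/
theorem tsum_intCast_translate_eq_tsum_fourierPi
    {f : (ι → ℝ) → ℂ} (hf : Continuous f) {N : ℕ} {C : ℝ}
    (hN : Fintype.card ι < N) (hC : ∀ x, (1 + ‖x‖) ^ N * ‖f x‖ ≤ C)
    (hsum : Summable fun m : ι → ℤ => fourierPi f fun i => (m i : ℝ)) (x : ι → ℝ) :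
    ∑' n : ι → ℤ, f (x + fun i => (n i : ℝ)) =
      ∑' m : ι → ℤ, (fourierPi f fun i => (m i : ℝ)) *
        e ((((fun i => (m i : ℝ)) ⬝ᵥ x : ℝ)) : ℂ) := by
  let π : C(ι → ℝ, UnitAddTorus ι) :=
    ⟨fun x i => (x i : UnitAddCircle), by
      exact continuous_pi fun i => (AddCircle.continuous_mk' 1).comp (continuous_apply i)⟩
  have hπ : Topology.IsQuotientMap π :=
    (IsOpenQuotientMap.piMap (fun _ : ι => QuotientAddGroup.isOpenQuotientMap_mk
      (N := AddSubgroup.zmultiples (1 : ℝ)))).isQuotientMap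
  let P : C(ι → ℝ, ℂ) := ⟨_, continuous_tsum_translate hf hN hC⟩
  have hfac : Function.FactorsThrough P π := by
    intro a b hab
    have hk : ∀ i, ∃ k : ℤ, b i = a i + k := by
      intro i
      have : ((a i : ℝ) : UnitAddCircle) = (b i : ℝ) := congrFun hab i
      obtain ⟨k, hk⟩ := AddSubgroup.mem_zmultiples_iff.1 (QuotientAddGroup.eq.1 this)
      exact ⟨k, by rw [zsmul_one] at hk; linarith⟩
    choose k hk using hk
    change ∑' n : ι → ℤ, f (a + fun i => (n i : ℝ)) = ∑' n : ι → ℤ, f (b + fun i => (n i : ℝ))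
    rw [← (Equiv.addRight k).tsum_eq]
    refine tsum_congr fun n => ?_
    congr 1
    ext i
    simp [hk i]; ring
  let T : C(UnitAddTorus ι, ℂ) := hπ.lift P hfac
  have hT : ∀ x, T (π x) = ∑' n : ι → ℤ, f (x + fun i => (n i : ℝ)) := fun x =>
    ContinuousMap.congr_fun (hπ.lift_comp P hfac) x
  have hcoef : ∀ m, UnitAddTorus.mFourierCoeff T m = fourierPi f fun i => (m i : ℝ) := by
    intro m
    set h : (ι → ℝ) → ℂ := fun x => e (((-((fun i => (m i : ℝ)) ⬝ᵥ x) : ℝ)) : ℂ) * f x with hh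
    have hhc : Continuous h := by
      have : Continuous fun x : ι → ℝ => (fun i => (m i : ℝ)) ⬝ᵥ x := by
        simp only [dotProduct]; fun_prop
      exact (continuous_e.comp (Complex.continuous_ofReal.comp this.neg)).mul hf
    have hhC : ∀ x, (1 + ‖x‖) ^ N * ‖h x‖ ≤ C := fun x => by
      rw [hh]; simp only [norm_mul, norm_e_ofReal, one_mul]; exact hC x
    have hint := integrable_of_one_add_norm_pow_mul_le hhc hN hhC
    rw [UnitAddTorus.mFourierCoeff_eq_integral _ _ 0]
    refine Eq.trans ?_ (hasSum_integral_unit_cube hint).tsum_eq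
    have hsw := hasSum_integral_of_summable_integral_norm (ι := ι → ℤ)
      (μ := volume.restrict {x : ι → ℝ | ∀ i, x i ∈ Ioc (0 : ℝ) (0 + 1)})
      (F := fun n x => h (x + fun i => (n i : ℝ)))
      (fun n => (hint.comp_add_right _).integrableOn) ?_
    · rw [hsw.tsum_eq]
      refine integral_congr_ae (.of_forall fun x => ?_)
      have h1 := mFourier_coe (-m) x
      change UnitAddTorus.mFourier (-m) (fun i => (x i : UnitAddCircle)) • T (π x) = _
      rw [h1, hT, smul_eq_mul, ← tsum_mul_left]
      refine tsum_congr fun n => ?_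
      simp only [hh]
      congr 1
      rw [dotProduct_add, neg_add]
      push_cast
      rw [e_add]
      have : e (-(((fun i => (m i : ℝ)) ⬝ᵥ (fun i => (n i : ℝ)) : ℝ) : ℂ)) = 1 := by
        have h2 : (-(((fun i => (m i : ℝ)) ⬝ᵥ (fun i => (n i : ℝ)) : ℝ) : ℂ))
            = ((-(m ⬝ᵥ n) : ℤ) : ℂ) := by
          simp [dotProduct]
        rw [h2, e_intCast]
      rw [this, mul_one]
      congr 1
      simp [dotProduct]
    · have hn : Integrable (fun x => ((‖h x‖ : ℝ) : ℂ)) := hint.norm.ofReal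
      have := (hasSum_integral_unit_cube hn).summable
      exact Complex.summable_ofReal.1 (this.congr fun n => integral_ofReal)
  have hs : Summable (UnitAddTorus.mFourierCoeff T) := by
    simpa only [funext hcoef] using hsum
  have := (UnitAddTorus.hasSum_mFourier_series_apply_of_summable hs (π x)).tsum_eq
  rw [← hT, ← this]
  refine tsum_congr fun m => ?_
  rw [hcoef, smul_eq_mul]
  congr 1
  exact mFourier_coe m x

end Poisson

/-! ### Theta series of rapidly decreasing functions and their Mellin transforms -/

section LatticeTheta

variable {ι : Type*} [Fintype ι]

/-- `f` decays faster than every power of `‖x‖` (sup norm) at infinity; the case `N = 0` says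
that `f` is bounded. -/
def RapidlyDecreasing (f : (ι → ℝ) → ℂ) : Prop :=
  ∀ N : ℕ, ∃ C : ℝ, ∀ x, ‖x‖ ^ N * ‖f x‖ ≤ C

/-- The theta series `t ↦ ∑ f(√t (n + q)) e(p·(n + q))` over `n ∈ ℤ^ι`. -/
def latticeTheta (f : (ι → ℝ) → ℂ) (p q : ι → ℝ) (t : ℝ) : ℂ :=
  ∑' n : ι → ℤ, f (Real.sqrt t • ((fun i => (n i : ℝ)) + q)) *
    e (((p ⬝ᵥ ((fun i => (n i : ℝ)) + q) : ℝ)) : ℂ)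

variable {f : (ι → ℝ) → ℂ}

/-- For a function vanishing at the origin the bound also holds there, with `0⁻¹ = 0`. -/
theorem RapidlyDecreasing.norm_le (hf : RapidlyDecreasing f) (h0 : f 0 = 0) (N : ℕ) :
    ∃ C : ℝ, 0 ≤ C ∧ ∀ x, ‖f x‖ ≤ C * (‖x‖ ^ N)⁻¹ := by
  obtain ⟨C, hC⟩ := hf N
  refine ⟨C, le_trans (by positivity) (hC 0), fun x => ?_⟩
  have hC0 : 0 ≤ C := le_trans (by positivity) (hC 0)
  rcases eq_or_ne x 0 with rfl | hx
  · rw [h0, norm_zero]; positivity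
  · have : 0 < ‖x‖ := norm_pos_iff.2 hx
    rw [← div_eq_mul_inv, le_div_iff₀ (by positivity), mul_comm]
    exact hC x

theorem RapidlyDecreasing.one_add_norm_pow_mul_le (hf : RapidlyDecreasing f) (N : ℕ) :
    ∃ C : ℝ, ∀ x, (1 + ‖x‖) ^ N * ‖f x‖ ≤ C := by
  obtain ⟨C, hC⟩ := hf N
  obtain ⟨D, hD⟩ := hf 0
  refine ⟨2 ^ (N - 1) * (D + C), fun x => ?_⟩
  have h1 := add_pow_le (zero_le_one' ℝ) (norm_nonneg x) N
  have h2 := hC x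
  have h3 := hD x
  rw [pow_zero, one_mul] at h3
  calc (1 + ‖x‖) ^ N * ‖f x‖ ≤ (2 ^ (N - 1) * (1 ^ N + ‖x‖ ^ N)) * ‖f x‖ := by gcongr
    _ = 2 ^ (N - 1) * (‖f x‖ + ‖x‖ ^ N * ‖f x‖) := by rw [one_pow]; ring
    _ ≤ _ := by gcongr

/-- The common bound behind summability, continuity and decay of the theta series. -/
theorem norm_latticeTheta_term_le {N : ℕ} {C : ℝ} (hC : ∀ x, ‖f x‖ ≤ C * (‖x‖ ^ N)⁻¹)
    (p q : ι → ℝ) (t : ℝ) (n : ι → ℤ) :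
    ‖f (Real.sqrt t • ((fun i => (n i : ℝ)) + q)) * e (((p ⬝ᵥ ((fun i => (n i : ℝ)) + q) : ℝ)) : ℂ)‖
      ≤ C * (Real.sqrt t ^ N)⁻¹ * (‖(fun i => (n i : ℝ)) + q‖ ^ N)⁻¹ := by
  rw [norm_mul, norm_e_ofReal, mul_one]
  refine (hC _).trans (le_of_eq ?_)
  rw [norm_smul, Real.norm_of_nonneg (Real.sqrt_nonneg t), mul_pow, mul_inv, mul_assoc]

theorem summable_latticeTheta (hf : RapidlyDecreasing f) (h0 : f 0 = 0) (p q : ι → ℝ) (t : ℝ) :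
    Summable fun n : ι → ℤ => f (Real.sqrt t • ((fun i => (n i : ℝ)) + q)) *
      e (((p ⬝ᵥ ((fun i => (n i : ℝ)) + q) : ℝ)) : ℂ) := by
  obtain ⟨C, -, hC⟩ := hf.norm_le h0 (Fintype.card ι + 1)
  exact Summable.of_norm_bounded
    ((summable_norm_intCast_add_inv_pow (Nat.lt_succ_self _) q).mul_left _)
    (norm_latticeTheta_term_le hC p q t)

theorem norm_latticeTheta_le (hf : RapidlyDecreasing f) (h0 : f 0 = 0) (p q : ι → ℝ) {N : ℕ}
    (hN : Fintype.card ι < N) :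
    ∃ C, 0 ≤ C ∧ ∀ t, ‖latticeTheta f p q t‖ ≤ C * (Real.sqrt t ^ N)⁻¹ := by
  obtain ⟨C, hC0, hC⟩ := hf.norm_le h0 N
  have hs := summable_norm_intCast_add_inv_pow hN q
  refine ⟨C * ∑' n : ι → ℤ, (‖(fun i => (n i : ℝ)) + q‖ ^ N)⁻¹,
    mul_nonneg hC0 (tsum_nonneg fun n => by positivity), fun t => ?_⟩
  refine (tsum_of_norm_bounded (hs.hasSum.mul_left _)
    (norm_latticeTheta_term_le hC p q t)).trans (le_of_eq (by ring))

theorem continuousOn_latticeTheta (hfc : Continuous f) (hf : RapidlyDecreasing f) (h0 : f 0 = 0)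
    (p q : ι → ℝ) : ContinuousOn (latticeTheta f p q) (Ioi 0) := by
  obtain ⟨C, hC0, hC⟩ := hf.norm_le h0 (Fintype.card ι + 1)
  have key : ∀ a : ℝ, 0 < a → ContinuousOn (latticeTheta f p q) (Ioi a) := by
    intro a ha
    refine continuousOn_tsum (fun n => ?_) ((summable_norm_intCast_add_inv_pow
      (Nat.lt_succ_self _) q).mul_left (C * (Real.sqrt a ^ (Fintype.card ι + 1))⁻¹))
      fun n t ht => (norm_latticeTheta_term_le hC p q t n).trans ?_
    · exact (Continuous.mul (by fun_prop) continuous_const).continuousOn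
    · have h1 : Real.sqrt a ≤ Real.sqrt t := Real.sqrt_le_sqrt (le_of_lt ht)
      have h2 : 0 < Real.sqrt a := Real.sqrt_pos.2 ha
      gcongr
  intro t ht
  have ht' : 0 < t := ht
  exact ((key (t / 2) (by linarith)).continuousAt
    (Ioi_mem_nhds (by linarith))).continuousWithinAt

theorem latticeTheta_neg (hodd : ∀ x, f (-x) = -f x) (p q : ι → ℝ) (t : ℝ) :
    latticeTheta f (-p) (-q) t = -latticeTheta f p q t := by
  rw [latticeTheta, latticeTheta, ← tsum_neg, ← (Equiv.neg (ι → ℤ)).tsum_eq]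
  refine tsum_congr fun n => ?_
  have : (fun i => (((Equiv.neg (ι → ℤ)) n i : ℤ) : ℝ)) + -q = -((fun i => (n i : ℝ)) + q) := by
    ext i; simp; ring
  rw [this, smul_neg, hodd, neg_dotProduct_neg, neg_mul]

/-- Poisson summation for theta series: inversion `t ↦ t⁻¹` replaces `f` by its Fourier
transform. -/
theorem latticeTheta_eq_fourierPi (hfc : Continuous f) (hf : RapidlyDecreasing f)
    (hf' : RapidlyDecreasing (fourierPi f)) (h0' : fourierPi f 0 = 0) (p q : ι → ℝ) {t : ℝ}
    (ht : 0 < t) :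
    latticeTheta f p q t = (Real.sqrt t ^ Fintype.card ι)⁻¹ * e ((p ⬝ᵥ q : ℝ) : ℂ) *
      latticeTheta (fourierPi f) q (-p) t⁻¹ := by
  set r := Real.sqrt t with hr
  have hr0 : 0 < r := Real.sqrt_pos.2 ht
  let h : (ι → ℝ) → ℂ := fun x => f (r • x) * e ((p ⬝ᵥ x : ℝ) : ℂ)
  have hdot : Continuous fun x : ι → ℝ => p ⬝ᵥ x := by simp only [dotProduct]; fun_prop
  have hhc : Continuous h := Continuous.mul (by fun_prop)
    (continuous_e.comp (Complex.continuous_ofReal.comp hdot))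
  have hh : RapidlyDecreasing h := by
    intro N
    obtain ⟨C, hC⟩ := hf N
    refine ⟨(r ^ N)⁻¹ * C, fun x => ?_⟩
    have := hC (r • x)
    rw [norm_smul, Real.norm_of_nonneg hr0.le, mul_pow] at this
    simp only [h, norm_mul, norm_e_ofReal, mul_one]
    rw [le_inv_mul_iff₀ (by positivity)]
    linarith
  have hF : ∀ ξ, fourierPi h ξ = ((r ^ Fintype.card ι)⁻¹ : ℝ) * fourierPi f (r⁻¹ • (ξ - p)) := by
    intro ξ
    have := Measure.integral_comp_smul (volume : Measure (ι → ℝ))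
      (fun x => e (((-((r⁻¹ • (ξ - p)) ⬝ᵥ x) : ℝ)) : ℂ) * f x) r
    rw [Module.finrank_fintype_fun_eq_card, abs_of_nonneg (by positivity),
      Complex.real_smul] at this
    rw [fourierPi, fourierPi, ← this]
    refine integral_congr_ae (.of_forall fun x => ?_)
    have h1 : -((r⁻¹ • (ξ - p)) ⬝ᵥ (r • x)) = -(ξ ⬝ᵥ x) + p ⬝ᵥ x := by
      rw [smul_dotProduct, dotProduct_smul, smul_smul, inv_mul_cancel₀ hr0.ne', one_smul,
        sub_dotProduct]
      ring
    simp only [h, h1]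
    push_cast
    rw [e_add]
    ring
  have hterm : ∀ m : ι → ℤ,
      fourierPi h (fun i => (m i : ℝ)) * e ((((fun i => (m i : ℝ)) ⬝ᵥ q : ℝ)) : ℂ)
      = ((r ^ Fintype.card ι)⁻¹ * e ((p ⬝ᵥ q : ℝ) : ℂ)) *
        (fourierPi f (Real.sqrt t⁻¹ • ((fun i => (m i : ℝ)) + -p)) *
          e (((q ⬝ᵥ ((fun i => (m i : ℝ)) + -p) : ℝ)) : ℂ)) := by
    intro m
    have h1 : (((fun i => (m i : ℝ)) ⬝ᵥ q : ℝ) : ℂ) =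
        ((p ⬝ᵥ q : ℝ) : ℂ) + ((q ⬝ᵥ ((fun i => (m i : ℝ)) + -p) : ℝ) : ℂ) := by
      rw [← Complex.ofReal_add]
      congr 1
      rw [dotProduct_add, dotProduct_neg, dotProduct_comm q p, dotProduct_comm q]
      ring
    rw [hF, h1, e_add, Real.sqrt_inv, ← hr, ← sub_eq_add_neg]
    push_cast
    ring
  have hsum : Summable fun m : ι → ℤ => fourierPi h fun i => (m i : ℝ) := by
    obtain ⟨C, -, hC⟩ := hf'.norm_le h0' (Fintype.card ι + 1)
    have hb := norm_latticeTheta_term_le hC q (-p) t⁻¹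
    refine Summable.of_norm_bounded (((summable_norm_intCast_add_inv_pow (Nat.lt_succ_self _)
      (-p)).mul_left (C * (Real.sqrt t⁻¹ ^ (Fintype.card ι + 1))⁻¹)).mul_left
      ‖(((r ^ Fintype.card ι)⁻¹ : ℝ) : ℂ) * e ((p ⬝ᵥ q : ℝ) : ℂ)‖) fun m => ?_
    have := congrArg norm (hterm m)
    rw [norm_mul, norm_e_ofReal, mul_one, norm_mul] at this
    rw [this]
    exact mul_le_mul_of_nonneg_left (hb m) (norm_nonneg _)
  obtain ⟨C, hC⟩ := hh.one_add_norm_pow_mul_le (Fintype.card ι + 1)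
  have hP := tsum_intCast_translate_eq_tsum_fourierPi hhc (Nat.lt_succ_self _) hC hsum q
  rw [latticeTheta, latticeTheta, ← tsum_mul_left, ← tsum_congr hterm, ← hP]
  refine tsum_congr fun n => ?_
  rw [add_comm q]

/-- Both decay estimates in the form used for the Mellin transform: the theta series is bounded
by every sufficiently negative power of `√t` at infinity and, through Poisson summation, by every
sufficiently large power of `√t` at `0`. -/
theorem mellin_latticeTheta (hfc : Continuous f) (hf : RapidlyDecreasing f) (h0 : f 0 = 0)
    (hf' : RapidlyDecreasing (fourierPi f)) (h0' : fourierPi f 0 = 0) (p q : ι → ℝ) (s : ℂ) :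
    MellinConvergent (latticeTheta f p q) s ∧
      DifferentiableAt ℂ (mellin (latticeTheta f p q)) s := by
  have hloc : LocallyIntegrableOn (latticeTheta f p q) (Ioi 0) :=
    (continuousOn_latticeTheta hfc hf h0 p q).locallyIntegrableOn measurableSet_Ioi
  have hpow : ∀ (N : ℕ) (t : ℝ), 0 < t → (Real.sqrt t ^ N)⁻¹ = t ^ (-(N / 2 : ℝ)) := by
    intro N t ht
    rw [Real.rpow_neg ht.le, Real.sqrt_eq_rpow, ← Real.rpow_natCast, ← Real.rpow_mul ht.le]
    congr 2; ring
  obtain ⟨N, hN, hNs⟩ : ∃ N : ℕ, Fintype.card ι < N ∧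
      2 * |s.re| + Fintype.card ι < N := by
    obtain ⟨N, hN⟩ := exists_nat_gt (2 * |s.re| + Fintype.card ι)
    refine ⟨N, ?_, hN⟩
    have : (Fintype.card ι : ℝ) < N := by linarith [abs_nonneg s.re]
    exact_mod_cast this
  have htop : latticeTheta f p q =O[atTop] fun t : ℝ => t ^ (-(N / 2 : ℝ)) := by
    obtain ⟨C, -, hC⟩ := norm_latticeTheta_le hf h0 p q hN
    refine IsBigO.of_bound C ?_
    filter_upwards [eventually_gt_atTop 0] with t ht
    rw [Real.norm_of_nonneg (by positivity), ← hpow N t ht]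
    exact hC t
  have hbot : latticeTheta f p q =O[𝓝[>] 0] fun t : ℝ => t ^ (-((Fintype.card ι - N) / 2 : ℝ)) := by
    obtain ⟨C, -, hC⟩ := norm_latticeTheta_le hf' h0' q (-p) hN
    refine IsBigO.of_bound C ?_
    filter_upwards [self_mem_nhdsWithin] with t ht
    have ht' : 0 < t := ht
    rw [latticeTheta_eq_fourierPi hfc hf hf' h0' p q ht', Real.norm_of_nonneg (by positivity)]
    have h1 : t ^ (-((Fintype.card ι - N) / 2 : ℝ)) =
        (Real.sqrt t ^ Fintype.card ι)⁻¹ * (Real.sqrt t⁻¹ ^ N)⁻¹ := by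
      rw [hpow _ t ht', Real.sqrt_inv, inv_pow, inv_inv, ← inv_inv (Real.sqrt t ^ N), hpow _ t ht',
        ← Real.rpow_neg ht'.le, ← Real.rpow_add ht']
      congr 1; ring
    rw [h1, norm_mul, norm_mul, norm_e_ofReal, mul_one, Complex.norm_real,
      Real.norm_of_nonneg (by positivity)]
    have := mul_le_mul_of_nonneg_left (hC t⁻¹)
      (show 0 ≤ (Real.sqrt t ^ Fintype.card ι)⁻¹ by positivity)
    linarith
  have hs1 : s.re < (N / 2 : ℝ) := by
    have : (0 : ℝ) ≤ Fintype.card ι := Nat.cast_nonneg _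
    linarith [le_abs_self s.re, abs_nonneg s.re]
  have hs2 : ((Fintype.card ι - N) / 2 : ℝ) < s.re := by
    linarith [neg_abs_le s.re]
  exact ⟨mellinConvergent_of_isBigO_rpow hloc htop hs1 hbot hs2,
    mellin_differentiableAt_of_isBigO_rpow hloc htop hs1 hbot hs2⟩

end LatticeTheta

/-! ### Gaussian integrals and Fourier transforms for complex symmetric quadratic forms -/

section Gaussian

variable {g : ℕ}

/-- A real vector regarded as a complex vector. -/
abbrev vecC (x : Fin g → ℝ) : Fin g → ℂ := fun j => (x j : ℂ)

/-- `A` is symmetric with positive definite imaginary part: a point of the Siegel upper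
half-space. -/
def IsPosImag (A : Matrix (Fin g) (Fin g) ℂ) : Prop :=
  Aᵀ = A ∧ ∀ x : Fin g → ℝ, x ≠ 0 → 0 < (vecC x ⬝ᵥ (A *ᵥ vecC x)).im

/-- The Gaussian `x ↦ e(½ xᵀ A x)` on `ℝ^g`. -/
def gauss (A : Matrix (Fin g) (Fin g) ℂ) (x : Fin g → ℝ) : ℂ :=
  e (1 / 2 * (vecC x ⬝ᵥ (A *ᵥ vecC x)))

theorem sqrtDetDefinite_eq (A : Matrix (Fin g) (Fin g) ℂ) :
    sqrtDetDefinite A = (∫ x, gauss A x)⁻¹ := rfl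

theorem im_quadratic (A : Matrix (Fin g) (Fin g) ℂ) (x : Fin g → ℝ) :
    (vecC x ⬝ᵥ (A *ᵥ vecC x)).im = x ⬝ᵥ (imMat A *ᵥ x) := by
  simp [dotProduct, Matrix.mulVec, imMat, Complex.im_sum]

theorem dotProduct_mulVec_comm {R : Type*} [CommRing R] {A : Matrix (Fin g) (Fin g) R}
    (hA : Aᵀ = A) (x y : Fin g → R) : x ⬝ᵥ (A *ᵥ y) = y ⬝ᵥ (A *ᵥ x) := by
  rw [Matrix.dotProduct_mulVec, ← Matrix.mulVec_transpose, hA, dotProduct_comm]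

theorem continuous_vecC : Continuous (vecC : (Fin g → ℝ) → Fin g → ℂ) := by
  unfold vecC; fun_prop

theorem norm_e (z : ℂ) : ‖e z‖ = Real.exp (-(2 * Real.pi * z.im)) := by
  rw [e, Complex.norm_exp]; simp

theorem continuous_gauss (A : Matrix (Fin g) (Fin g) ℂ) : Continuous (gauss A) := by
  have : Continuous fun x : Fin g → ℝ => vecC x ⬝ᵥ (A *ᵥ vecC x) :=
    continuous_vecC.dotProduct (continuous_const.matrix_mulVec continuous_vecC)
  exact continuous_e.comp (continuous_const.mul this)

theorem norm_gauss (A : Matrix (Fin g) (Fin g) ℂ) (x : Fin g → ℝ) :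
    ‖gauss A x‖ = Real.exp (-(Real.pi * (vecC x ⬝ᵥ (A *ᵥ vecC x)).im)) := by
  rw [gauss, norm_e]
  congr 1
  rw [show (1 / 2 : ℂ) = ((1 / 2 : ℝ) : ℂ) by norm_num, Complex.im_ofReal_mul]
  ring

/-- A compact family of positive definite imaginary parts is uniformly positive definite. -/
theorem exists_uniform_lower_bound {A : ℝ → Matrix (Fin g) (Fin g) ℂ} (hA : Continuous A)
    (hpos : ∀ s, IsPosImag (A s)) {K : Set ℝ} (hK : IsCompact K) :
    ∃ ε : ℝ, 0 < ε ∧ ∀ s ∈ K, ∀ x : Fin g → ℝ,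
      ε * ‖x‖ ^ 2 ≤ (vecC x ⬝ᵥ (A s *ᵥ vecC x)).im := by
  let Q : ℝ × (Fin g → ℝ) → ℝ := fun y => (vecC y.2 ⬝ᵥ (A y.1 *ᵥ vecC y.2)).im
  have hQ : Continuous Q := by
    have h1 : Continuous fun y : ℝ × (Fin g → ℝ) => vecC y.2 := continuous_vecC.comp continuous_snd
    exact Complex.continuous_im.comp
      (h1.dotProduct ((hA.comp continuous_fst).matrix_mulVec h1))
  have hK' : IsCompact (K ×ˢ Metric.sphere (0 : Fin g → ℝ) 1) :=
    hK.prod (isCompact_sphere _ _)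
  obtain ⟨ε, hε, hle⟩ : ∃ ε : ℝ, 0 < ε ∧
      ∀ y ∈ K ×ˢ Metric.sphere (0 : Fin g → ℝ) 1, ε ≤ Q y := by
    refine hK'.exists_forall_le' hQ.continuousOn fun y hy => (hpos _).2 _ ?_
    have : ‖y.2‖ = 1 := by simpa using hy.2
    intro h0
    rw [h0, norm_zero] at this
    exact zero_ne_one this
  refine ⟨ε, hε, fun s hs x => ?_⟩
  rcases eq_or_ne x 0 with rfl | hx
  · have : vecC (0 : Fin g → ℝ) = 0 := by ext; simp
    simp [this]
  · have hn : 0 < ‖x‖ := norm_pos_iff.2 hx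
    have h1 := hle (s, ‖x‖⁻¹ • x) ⟨hs, by simp [norm_smul, hn.ne']⟩
    have h2 : vecC (‖x‖⁻¹ • x) = ((‖x‖⁻¹ : ℝ) : ℂ) • vecC x := by ext; simp [vecC]
    simp only [Q, h2, Matrix.mulVec_smul, dotProduct_smul, smul_dotProduct, smul_eq_mul,
      Complex.im_ofReal_mul] at h1
    have h3 := mul_le_mul_of_nonneg_right h1 (sq_nonneg ‖x‖)
    have h4 : ‖x‖⁻¹ * (‖x‖⁻¹ * (vecC x ⬝ᵥ (A s *ᵥ vecC x)).im) * ‖x‖ ^ 2 =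
        (vecC x ⬝ᵥ (A s *ᵥ vecC x)).im := by field_simp
    linarith

theorem pow_mul_exp_neg_sq_le {a : ℝ} (ha : 0 < a) (N : ℕ) :
    ∃ C : ℝ, ∀ r : ℝ, 0 ≤ r → r ^ N * Real.exp (-(a * r ^ 2)) ≤ C := by
  refine ⟨1 + N.factorial / a ^ N, fun r hr => ?_⟩
  have h1 : r ^ N ≤ 1 + (r ^ 2) ^ N := by
    rcases le_total r 1 with h | h
    · have := pow_le_one₀ hr h (n := N)
      nlinarith [pow_nonneg (sq_nonneg r) N]
    · have : r ^ N ≤ (r ^ 2) ^ N := by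
        gcongr; nlinarith
      linarith
  have h2 := Real.pow_div_factorial_le_exp (a * r ^ 2) (by positivity) N
  have hfac : (0 : ℝ) < N.factorial := by positivity
  have h3 : (r ^ 2) ^ N ≤ N.factorial / a ^ N * Real.exp (a * r ^ 2) := by
    rw [div_le_iff₀ hfac, mul_pow] at h2
    rw [div_mul_eq_mul_div, le_div_iff₀ (by positivity)]
    linarith
  have h4 : 1 ≤ Real.exp (a * r ^ 2) := Real.one_le_exp (by positivity)
  rw [Real.exp_neg, ← div_eq_mul_inv, div_le_iff₀ (Real.exp_pos _)]
  nlinarith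

/-- The form of decay used throughout: a linear factor times a Gaussian. -/
theorem rapidlyDecreasing_of_norm_le {f : (Fin g → ℝ) → ℂ} {a C : ℝ} (ha : 0 < a)
    (h : ∀ x, ‖f x‖ ≤ C * ‖x‖ * Real.exp (-(a * ‖x‖ ^ 2))) : RapidlyDecreasing f := by
  intro N
  obtain ⟨D, hD⟩ := pow_mul_exp_neg_sq_le ha (N + 1)
  refine ⟨|C| * D, fun x => ?_⟩
  calc ‖x‖ ^ N * ‖f x‖ ≤ ‖x‖ ^ N * (|C| * ‖x‖ * Real.exp (-(a * ‖x‖ ^ 2))) := by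
        gcongr
        refine (h x).trans ?_
        gcongr
        exact le_abs_self C
    _ = |C| * (‖x‖ ^ (N + 1) * Real.exp (-(a * ‖x‖ ^ 2))) := by ring
    _ ≤ _ := by gcongr; exact hD _ (norm_nonneg x)

theorem RapidlyDecreasing.integrable {f : (Fin g → ℝ) → ℂ} (hfc : Continuous f)
    (hf : RapidlyDecreasing f) : Integrable f := by
  obtain ⟨C, hC⟩ := hf.one_add_norm_pow_mul_le (g + 1)
  exact integrable_of_one_add_norm_pow_mul_le hfc (by simp) hC

theorem RapidlyDecreasing.mul_of_norm_eq_one {f h : (Fin g → ℝ) → ℂ} (hf : RapidlyDecreasing f)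
    (hh : ∀ x, ‖h x‖ = 1) : RapidlyDecreasing fun x => h x * f x := by
  intro N
  obtain ⟨C, hC⟩ := hf N
  exact ⟨C, fun x => by rw [norm_mul, hh, one_mul]; exact hC x⟩

theorem norm_dotProduct_vecC_le (l : Fin g → ℂ) (x : Fin g → ℝ) :
    ‖l ⬝ᵥ vecC x‖ ≤ (∑ i, ‖l i‖) * ‖x‖ := by
  rw [Finset.sum_mul]
  refine (norm_sum_le _ _).trans (Finset.sum_le_sum fun i _ => ?_)
  rw [norm_mul, Complex.norm_real]
  gcongr
  exact norm_le_pi_norm x i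

theorem IsPosImag.exists_norm_gauss_le {A : Matrix (Fin g) (Fin g) ℂ} (hA : IsPosImag A) :
    ∃ a : ℝ, 0 < a ∧ ∀ x, ‖gauss A x‖ ≤ Real.exp (-(a * ‖x‖ ^ 2)) := by
  obtain ⟨ε, hε, h⟩ := exists_uniform_lower_bound (A := fun _ => A) continuous_const (fun _ => hA)
    (isCompact_singleton (x := 0))
  refine ⟨Real.pi * ε, by positivity, fun x => ?_⟩
  rw [norm_gauss, mul_assoc]
  exact Real.exp_le_exp.2 (neg_le_neg (mul_le_mul_of_nonneg_left (h 0 (by simp) x) Real.pi_pos.le))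

theorem IsPosImag.rapidlyDecreasing_gauss {A : Matrix (Fin g) (Fin g) ℂ} (hA : IsPosImag A) :
    RapidlyDecreasing (gauss A) := by
  obtain ⟨a, ha, h⟩ := hA.exists_norm_gauss_le
  intro N
  obtain ⟨D, hD⟩ := pow_mul_exp_neg_sq_le ha N
  exact ⟨D, fun x => le_trans (by gcongr; exact h x) (hD _ (norm_nonneg x))⟩

theorem IsPosImag.rapidlyDecreasing_linear_mul_gauss {A : Matrix (Fin g) (Fin g) ℂ}
    (hA : IsPosImag A) (l : Fin g → ℂ) :
    RapidlyDecreasing fun x => (l ⬝ᵥ vecC x) * gauss A x := by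
  obtain ⟨a, ha, h⟩ := hA.exists_norm_gauss_le
  refine rapidlyDecreasing_of_norm_le (C := ∑ i, ‖l i‖) ha fun x => ?_
  rw [norm_mul]
  gcongr
  · exact norm_dotProduct_vecC_le l x
  · exact h x

theorem exists_orthogonal_diagonalization {M : Matrix (Fin g) (Fin g) ℝ} (h : M.IsHermitian) :
    ∃ U : Matrix (Fin g) (Fin g) ℝ, Uᵀ * U = 1 ∧ U * Uᵀ = 1 ∧
      M = U * Matrix.diagonal h.eigenvalues * Uᵀ := by
  refine ⟨(h.eigenvectorUnitary : Matrix (Fin g) (Fin g) ℝ), ?_, ?_, ?_⟩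
  · have := Unitary.coe_star_mul_self h.eigenvectorUnitary
    simpa [Matrix.star_eq_conjTranspose, Matrix.conjTranspose_eq_transpose_of_trivial] using this
  · have := Unitary.coe_mul_star_self h.eigenvectorUnitary
    simpa [Matrix.star_eq_conjTranspose, Matrix.conjTranspose_eq_transpose_of_trivial] using this
  · have := h.spectral_theorem
    rw [Unitary.conjStarAlgAut_apply] at this
    simpa [Matrix.star_eq_conjTranspose, Matrix.conjTranspose_eq_transpose_of_trivial] using this

theorem toC_mul (A B : Matrix (Fin g) (Fin g) ℝ) : toC (A * B) = toC A * toC B :=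
  Matrix.map_mul (f := Complex.ofRealHom)

theorem toC_transpose (A : Matrix (Fin g) (Fin g) ℝ) : toC Aᵀ = (toC A)ᵀ := rfl

theorem toC_one : toC (1 : Matrix (Fin g) (Fin g) ℝ) = 1 := by
  unfold toC; exact Matrix.map_one _ (by simp) (by simp)

theorem toC_diagonal (d : Fin g → ℝ) : toC (Matrix.diagonal d) = Matrix.diagonal (vecC d) := by
  unfold toC; rw [Matrix.diagonal_map (by simp)]

theorem toC_mulVec (A : Matrix (Fin g) (Fin g) ℝ) (x : Fin g → ℝ) :
    toC A *ᵥ vecC x = vecC (A *ᵥ x) := by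
  ext i; simp [Matrix.mulVec, dotProduct, toC, vecC]

theorem det_toC (A : Matrix (Fin g) (Fin g) ℝ) : (toC A).det = (A.det : ℂ) := by
  unfold toC
  exact (RingHom.map_det Complex.ofRealHom A).symm

/-- Simultaneous diagonalization of the real and imaginary parts. -/
theorem IsPosImag.exists_diagonalization {A : Matrix (Fin g) (Fin g) ℂ} (hA : IsPosImag A) :
    ∃ (P : Matrix (Fin g) (Fin g) ℝ) (d : Fin g → ℝ), P.det ≠ 0 ∧
      A = (toC P)ᵀ * Matrix.diagonal (fun i => (d i : ℂ) + Complex.I) * toC P := by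
  have hsym : ∀ i j, A i j = A j i := fun i j => congrFun (congrFun hA.1 j) i
  have hM : (imMat A).IsHermitian := by
    ext i j; simp [imMat, hsym i j]
  obtain ⟨U, hU1, hU2, hU⟩ := exists_orthogonal_diagonalization hM
  set l := hM.eigenvalues with hl
  have hlpos : ∀ i, 0 < l i := by
    have hpd : (imMat A).PosDef := by
      refine Matrix.PosDef.of_dotProduct_mulVec_pos hM fun x hx => ?_
      have := hA.2 x hx
      rw [im_quadratic] at this
      simpa using this
    exact hpd.eigenvalues_pos
  -- `Im A = Rᵀ R`, and `S = R⁻¹` reduces the real part to the symmetric matrix `Sᵀ (Re A) S`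
  set R : Matrix (Fin g) (Fin g) ℝ := Matrix.diagonal (fun i => Real.sqrt (l i)) * Uᵀ with hR
  set S : Matrix (Fin g) (Fin g) ℝ := U * Matrix.diagonal (fun i => (Real.sqrt (l i))⁻¹) with hS
  have hSR : S * R = 1 := by
    rw [hS, hR, Matrix.mul_assoc, ← Matrix.mul_assoc (Matrix.diagonal _),
      Matrix.diagonal_mul_diagonal]
    have : (fun i => (Real.sqrt (l i))⁻¹ * Real.sqrt (l i)) = 1 := by
      ext i; exact inv_mul_cancel₀ (Real.sqrt_pos.2 (hlpos i)).ne'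
    rw [this, Matrix.diagonal_one', Matrix.one_mul, hU2]
  have hRR : imMat A = Rᵀ * R := by
    rw [hR, Matrix.transpose_mul, Matrix.transpose_transpose, Matrix.diagonal_transpose,
      Matrix.mul_assoc, ← Matrix.mul_assoc (Matrix.diagonal _), Matrix.diagonal_mul_diagonal]
    have : (fun i => Real.sqrt (l i) * Real.sqrt (l i)) = l := by
      ext i; exact Real.mul_self_sqrt (hlpos i).le
    rw [this, ← Matrix.mul_assoc]
    exact hU
  set X : Matrix (Fin g) (Fin g) ℝ := A.map Complex.re with hX
  have hN : (Sᵀ * X * S).IsHermitian := by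
    have : Xᵀ = X := by ext i j; simp [hX, hsym i j]
    rw [Matrix.IsHermitian, Matrix.conjTranspose_eq_transpose_of_trivial]
    simp [Matrix.transpose_mul, this, Matrix.mul_assoc]
  obtain ⟨V, hV1, hV2, hV⟩ := exists_orthogonal_diagonalization hN
  refine ⟨Vᵀ * R, hN.eigenvalues, ?_, ?_⟩
  · have h1 : S * V * (Vᵀ * R) = 1 := by
      rw [Matrix.mul_assoc, ← Matrix.mul_assoc V, hV2, Matrix.one_mul, hSR]
    intro h0
    have := congrArg Matrix.det h1
    rw [Matrix.det_mul, h0, mul_zero, Matrix.det_one] at this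
    exact zero_ne_one this
  · have hre : X = (Vᵀ * R)ᵀ * Matrix.diagonal hN.eigenvalues * (Vᵀ * R) := by
      have : (Vᵀ * R)ᵀ * Matrix.diagonal hN.eigenvalues * (Vᵀ * R) =
          Rᵀ * (V * Matrix.diagonal hN.eigenvalues * Vᵀ) * R := by
        simp [Matrix.transpose_mul, Matrix.mul_assoc]
      rw [this, ← hV]
      have h2 : Rᵀ * Sᵀ = 1 := by rw [← Matrix.transpose_mul, hSR, Matrix.transpose_one]
      calc X = (Rᵀ * Sᵀ) * X * (S * R) := by rw [h2, hSR, Matrix.one_mul, Matrix.mul_one]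
        _ = _ := by simp only [Matrix.mul_assoc]
    have him : imMat A = (Vᵀ * R)ᵀ * (Vᵀ * R) := by
      rw [hRR, Matrix.transpose_mul Vᵀ R, Matrix.transpose_transpose, Matrix.mul_assoc,
        ← Matrix.mul_assoc V, hV2, Matrix.one_mul]
    have hsplit : A = toC X + Complex.I • toC (imMat A) := by
      ext i j
      simp only [toC, hX, imMat, Matrix.add_apply, Matrix.map_apply, Matrix.smul_apply,
        smul_eq_mul]
      rw [mul_comm]; exact (Complex.re_add_im _).symm
    have hdiag : Matrix.diagonal (fun i => (hN.eigenvalues i : ℂ) + Complex.I) =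
        toC (Matrix.diagonal hN.eigenvalues) + Complex.I • 1 := by
      rw [toC_diagonal, ← Matrix.diagonal_one, ← Matrix.diagonal_smul, Matrix.diagonal_add]
      congr 1; ext i; simp
    rw [hdiag, Matrix.mul_add, Matrix.add_mul, Matrix.mul_smul, Matrix.mul_one, Matrix.smul_mul,
      ← toC_transpose, ← toC_mul, ← toC_mul, ← toC_mul, ← hre, ← him]
    exact hsplit

theorem integral_comp_mulVec {P : Matrix (Fin g) (Fin g) ℝ} (hP : P.det ≠ 0)
    {f : (Fin g → ℝ) → ℂ} (hf : Continuous f) :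
    ∫ x, f (P *ᵥ x) = ((|P.det|⁻¹ : ℝ) : ℂ) * ∫ x, f x := by
  have h := Real.map_matrix_volume_pi_eq_smul_volume_pi hP
  have hm : Continuous (Matrix.toLin' P) := LinearMap.continuous_of_finiteDimensional _
  have h2 := integral_map (μ := volume) hm.measurable.aemeasurable (f := f)
    hf.aestronglyMeasurable
  rw [h, integral_smul_measure, ENNReal.toReal_ofReal (abs_nonneg _), abs_inv,
    Complex.real_smul] at h2
  rw [h2]
  simp

theorem I_add_ne_zero (d : ℝ) : (d : ℂ) + Complex.I ≠ 0 := by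
  intro h
  have := congrArg Complex.im h
  simp at this

theorem IsPosImag.det_ne_zero {A : Matrix (Fin g) (Fin g) ℂ} (hA : IsPosImag A) : A.det ≠ 0 := by
  obtain ⟨P, d, hP, rfl⟩ := hA.exists_diagonalization
  rw [Matrix.det_mul, Matrix.det_mul, Matrix.det_transpose, det_toC, Matrix.det_diagonal]
  have : (P.det : ℂ) ≠ 0 := by exact_mod_cast hP
  exact mul_ne_zero (mul_ne_zero this (Finset.prod_ne_zero_iff.2 fun i _ => I_add_ne_zero _)) this

theorem quadratic_conj_diagonal (B : Matrix (Fin g) (Fin g) ℝ) (D : Fin g → ℂ) (x : Fin g → ℝ) :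
    vecC x ⬝ᵥ (((toC B)ᵀ * Matrix.diagonal D * toC B) *ᵥ vecC x) =
      ∑ i, D i * (((B *ᵥ x) i : ℝ) : ℂ) ^ 2 := by
  rw [← Matrix.mulVec_mulVec, ← Matrix.mulVec_mulVec, Matrix.dotProduct_mulVec,
    Matrix.vecMul_transpose, toC_mulVec]
  simp only [dotProduct, Matrix.mulVec_diagonal]
  exact Finset.sum_congr rfl fun i _ => by simp only [vecC]; ring

theorem inv_conj_diagonal {P : Matrix (Fin g) (Fin g) ℝ} (hP : P.det ≠ 0) {D : Fin g → ℂ}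
    (hD : ∀ i, D i ≠ 0) :
    ((toC P)ᵀ * Matrix.diagonal D * toC P)⁻¹ =
      (toC (P⁻¹)ᵀ)ᵀ * Matrix.diagonal (fun i => (D i)⁻¹) * toC (P⁻¹)ᵀ := by
  refine Matrix.inv_eq_left_inv ?_
  have hu : IsUnit P.det := isUnit_iff_ne_zero.2 hP
  have h1 : toC (P⁻¹) * toC P = 1 := by rw [← toC_mul, Matrix.nonsing_inv_mul _ hu, toC_one]
  have h2 : toC (P⁻¹)ᵀ * (toC P)ᵀ = 1 := by
    rw [← toC_transpose, ← toC_mul, ← Matrix.transpose_mul, Matrix.mul_nonsing_inv _ hu,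
      Matrix.transpose_one, toC_one]
  have h3 : Matrix.diagonal (fun i => (D i)⁻¹) * Matrix.diagonal D = 1 := by
    rw [Matrix.diagonal_mul_diagonal, ← Matrix.diagonal_one]
    congr 1; ext i; exact inv_mul_cancel₀ (hD i)
  rw [toC_transpose, Matrix.transpose_transpose]
  calc _ = toC P⁻¹ * Matrix.diagonal (fun i => (D i)⁻¹) * ((toC P⁻¹)ᵀ * (toC P)ᵀ) *
        Matrix.diagonal D * toC P := by simp only [Matrix.mul_assoc]
    _ = 1 := by
      rw [← toC_transpose P⁻¹, h2, Matrix.mul_one, Matrix.mul_assoc (toC P⁻¹), h3, Matrix.mul_one,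
        h1]

theorem IsPosImag.neg_inv {A : Matrix (Fin g) (Fin g) ℂ} (hA : IsPosImag A) : IsPosImag (-A⁻¹) := by
  refine ⟨by rw [Matrix.transpose_neg, Matrix.transpose_nonsing_inv, hA.1], fun x hx => ?_⟩
  obtain ⟨P, d, hP, rfl⟩ := hA.exists_diagonalization
  rw [inv_conj_diagonal hP fun i => I_add_ne_zero _, Matrix.neg_mulVec, dotProduct_neg,
    quadratic_conj_diagonal, Complex.neg_im, Complex.im_sum, ← Finset.sum_neg_distrib]
  have him : ∀ i, -((((d i : ℂ) + Complex.I)⁻¹) * ((((P⁻¹)ᵀ *ᵥ x) i : ℝ) : ℂ) ^ 2).im =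
      (d i ^ 2 + 1)⁻¹ * (((P⁻¹)ᵀ *ᵥ x) i) ^ 2 := by
    intro i
    rw [← Complex.ofReal_pow, Complex.im_mul_ofReal, Complex.inv_im]
    simp [Complex.normSq_apply, sq, div_eq_mul_inv]
  have hx' : (P⁻¹)ᵀ *ᵥ x ≠ 0 := by
    intro h0
    have h1 := congrArg (fun v => Pᵀ *ᵥ v) h0
    simp only [Matrix.mulVec_mulVec, Matrix.mulVec_zero] at h1
    rw [← Matrix.transpose_mul, Matrix.nonsing_inv_mul _ (isUnit_iff_ne_zero.2 hP),
      Matrix.transpose_one, Matrix.one_mulVec] at h1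
    exact hx h1
  obtain ⟨i, hi⟩ := Function.ne_iff.1 hx'
  simp only [him]
  refine Finset.sum_pos' (fun i _ => by positivity) ⟨i, Finset.mem_univ i, ?_⟩
  have : 0 < ((P⁻¹)ᵀ *ᵥ x) i ^ 2 := by
    have hi' : ((P⁻¹)ᵀ *ᵥ x) i ≠ 0 := hi
    positivity
  positivity

/-- In simultaneously diagonalizing coordinates `y = P x` the Gaussian is a product of
one-variable Gaussians. -/
theorem gauss_conj_diagonal (P : Matrix (Fin g) (Fin g) ℝ) (d : Fin g → ℝ) (x : Fin g → ℝ) :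
    gauss ((toC P)ᵀ * Matrix.diagonal (fun i => (d i : ℂ) + Complex.I) * toC P) x =
      Complex.exp (-∑ i, (Real.pi * (1 - Complex.I * d i)) * (((P *ᵥ x) i : ℝ) : ℂ) ^ 2) := by
  rw [gauss, e, quadratic_conj_diagonal, Finset.mul_sum, Finset.mul_sum, ← Finset.sum_neg_distrib]
  congr 1
  refine Finset.sum_congr rfl fun i _ => ?_
  linear_combination (Real.pi * (((P *ᵥ x) i : ℝ) : ℂ) ^ 2) * Complex.I_mul_I

theorem integral_gauss_conj_diagonal {P : Matrix (Fin g) (Fin g) ℝ} (hP : P.det ≠ 0)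
    (d : Fin g → ℝ) (c : Fin g → ℂ) :
    ∫ x : Fin g → ℝ, gauss ((toC P)ᵀ * Matrix.diagonal (fun i => (d i : ℂ) + Complex.I) * toC P) x *
        Complex.exp (∑ i, c i * (((P *ᵥ x) i : ℝ) : ℂ)) =
      ((|P.det|⁻¹ : ℝ) : ℂ) * ∏ i, (Real.pi / (Real.pi * (1 - Complex.I * d i))) ^ (1 / 2 : ℂ) *
        Complex.exp (c i ^ 2 / (4 * (Real.pi * (1 - Complex.I * d i)))) := by
  have hb : ∀ i, 0 < ((Real.pi : ℂ) * (1 - Complex.I * d i)).re := fun i => by simp [Real.pi_pos]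
  rw [← GaussianFourier.integral_cexp_neg_sum_mul_add hb c]
  simp only [gauss_conj_diagonal, ← Complex.exp_add]
  exact integral_comp_mulVec hP (f := fun y => Complex.exp
    (-∑ i, (Real.pi * (1 - Complex.I * d i)) * (y i : ℂ) ^ 2 + ∑ i, c i * (y i : ℂ))) (by fun_prop)

theorem one_sub_I_mul_ne_zero (d : ℝ) : (1 - Complex.I * d : ℂ) ≠ 0 := by
  intro h
  have := congrArg Complex.re h
  simp at this

/-- The Fourier transform of a complex Gaussian, with the constant left as its value at `0`. -/
theorem IsPosImag.fourierPi_gauss {A : Matrix (Fin g) (Fin g) ℂ} (hA : IsPosImag A)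
    (ξ : Fin g → ℝ) : fourierPi (gauss A) ξ = (∫ x, gauss A x) * gauss (-A⁻¹) ξ := by
  obtain ⟨P, d, hP, rfl⟩ := hA.exists_diagonalization
  -- `w` is the frequency dual to the coordinates `y = P x`
  set w : Fin g → ℝ := (P⁻¹)ᵀ *ᵥ ξ with hw
  have hI2 : Complex.I * Complex.I = -1 := Complex.I_mul_I
  have hξ : ∀ x, ξ ⬝ᵥ x = w ⬝ᵥ (P *ᵥ x) := by
    intro x
    rw [hw, Matrix.mulVec_transpose, Matrix.dotProduct_mulVec, Matrix.vecMul_vecMul,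
      Matrix.nonsing_inv_mul _ (isUnit_iff_ne_zero.2 hP), Matrix.vecMul_one]
  have h0 := integral_gauss_conj_diagonal hP d 0
  simp only [Pi.zero_apply, zero_mul, Finset.sum_const_zero, ne_eq, OfNat.ofNat_ne_zero,
    not_false_eq_true, zero_pow, zero_div, Complex.exp_zero, mul_one] at h0
  have h1 := integral_gauss_conj_diagonal hP d fun i => -(2 * Real.pi * Complex.I * (w i : ℂ))
  rw [Finset.prod_mul_distrib, ← mul_assoc, ← h0, ← Complex.exp_sum] at h1
  rw [fourierPi]
  refine Eq.trans (integral_congr_ae (.of_forall fun x => ?_)) (h1.trans ?_)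
  · simp only
    rw [mul_comm, e, hξ]
    congr 2
    simp only [dotProduct]
    push_cast
    rw [mul_neg, Finset.mul_sum, ← Finset.sum_neg_distrib]
    exact Finset.sum_congr rfl fun i _ => by ring
  · congr 1
    rw [inv_conj_diagonal hP fun i => I_add_ne_zero _, gauss, e, Matrix.neg_mulVec, dotProduct_neg,
      quadratic_conj_diagonal]
    congr 1
    rw [mul_neg, mul_neg, Finset.mul_sum, Finset.mul_sum, ← Finset.sum_neg_distrib]
    refine Finset.sum_congr rfl fun i _ => ?_
    have hd' := one_sub_I_mul_ne_zero (d i)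
    have hpi : (Real.pi : ℂ) ≠ 0 := by exact_mod_cast Real.pi_ne_zero
    have hrel : (d i : ℂ) + Complex.I = Complex.I * (1 - Complex.I * d i) := by
      linear_combination (d i : ℂ) * hI2
    rw [hrel]
    have hI := Complex.I_ne_zero
    field_simp
    linear_combination (4 * (w i : ℂ) ^ 2) * hI2

/-- The integral of the Gaussian is an inverse square root of `det(-iA)`. -/
theorem IsPosImag.det_mul_integral_gauss_sq {A : Matrix (Fin g) (Fin g) ℂ} (hA : IsPosImag A) :
    (-Complex.I • A).det * (∫ x, gauss A x) ^ 2 = 1 := by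
  obtain ⟨P, d, hP, rfl⟩ := hA.exists_diagonalization
  have h0 := integral_gauss_conj_diagonal hP d 0
  simp only [Pi.zero_apply, zero_mul, Finset.sum_const_zero, ne_eq, OfNat.ofNat_ne_zero,
    not_false_eq_true, zero_pow, zero_div, Complex.exp_zero, mul_one] at h0
  have hP' : (P.det : ℂ) ≠ 0 := by exact_mod_cast hP
  have habs : ((|P.det|⁻¹ : ℝ) : ℂ) ^ 2 = ((P.det : ℂ) ^ 2)⁻¹ := by
    rw [← Complex.ofReal_pow, inv_pow, sq_abs]; push_cast; rfl
  have hpi : (Real.pi : ℂ) ≠ 0 := by exact_mod_cast Real.pi_ne_zero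
  have hdet : (-Complex.I) ^ g * ∏ i, ((d i : ℂ) + Complex.I) = ∏ i, (1 - Complex.I * d i) := by
    have : (-Complex.I) ^ g = ∏ _i : Fin g, (-Complex.I) := by simp
    rw [this, ← Finset.prod_mul_distrib]
    exact Finset.prod_congr rfl fun i _ => by linear_combination -Complex.I_mul_I
  have hprod : (∏ i, (Real.pi / (Real.pi * (1 - Complex.I * d i)) : ℂ) ^ (1 / 2 : ℂ)) ^ 2 =
      (∏ i, (1 - Complex.I * d i))⁻¹ := by
    rw [← Finset.prod_pow, ← Finset.prod_inv_distrib]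
    refine Finset.prod_congr rfl fun i _ => ?_
    rw [← Complex.cpow_nat_mul, div_mul_cancel_left₀ hpi]
    norm_num
  have hne : ∏ i, (1 - Complex.I * d i : ℂ) ≠ 0 :=
    Finset.prod_ne_zero_iff.2 fun i _ => one_sub_I_mul_ne_zero _
  rw [h0, mul_pow, habs, hprod, Matrix.det_smul, Matrix.det_mul, Matrix.det_mul,
    Matrix.det_transpose, det_toC, Matrix.det_diagonal, Fintype.card_fin]
  rw [show (-Complex.I) ^ g * ((P.det : ℂ) * (∏ i, ((d i : ℂ) + Complex.I)) * P.det) =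
    (P.det : ℂ) ^ 2 * ((-Complex.I) ^ g * ∏ i, ((d i : ℂ) + Complex.I)) by ring, hdet]
  field_simp

theorem IsPosImag.integral_gauss_ne_zero {A : Matrix (Fin g) (Fin g) ℂ} (hA : IsPosImag A) :
    ∫ x, gauss A x ≠ 0 := by
  intro h
  have := hA.det_mul_integral_gauss_sq
  rw [h] at this
  simp at this

theorem continuous_e_neg_dotProduct (ξ : Fin g → ℝ) :
    Continuous fun x : Fin g → ℝ => e (((-(ξ ⬝ᵥ x) : ℝ)) : ℂ) := by
  have : Continuous fun x : Fin g → ℝ => ξ ⬝ᵥ x := by simp only [dotProduct]; fun_prop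
  exact continuous_e.comp (Complex.continuous_ofReal.comp this.neg)

theorem continuous_dotProduct_vecC (l : Fin g → ℂ) :
    Continuous fun x : Fin g → ℝ => l ⬝ᵥ vecC x := by
  simp only [dotProduct, vecC]; fun_prop

/-- Integration by parts: the derivative of `e(½ xᵀ A x - ξ·x)` in the direction `v` has integral
zero. Both factors in the product rule are taken to be `e(½(½ xᵀ A x - ξ·x))`. -/
theorem IsPosImag.integral_deriv_gauss {A : Matrix (Fin g) (Fin g) ℂ} (hA : IsPosImag A)
    (ξ v : Fin g → ℝ) :
    ∫ x, ((A *ᵥ vecC v) ⬝ᵥ vecC x - vecC ξ ⬝ᵥ vecC v) *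
      (e (((-(ξ ⬝ᵥ x) : ℝ)) : ℂ) * gauss A x) = 0 := by
  let φ : (Fin g → ℝ) → ℂ := fun x =>
    1 / 2 * (1 / 2 * (vecC x ⬝ᵥ (A *ᵥ vecC x)) - vecC ξ ⬝ᵥ vecC x)
  let ψ : (Fin g → ℝ) → ℂ := fun x =>
    Real.pi * Complex.I * ((A *ᵥ vecC v) ⬝ᵥ vecC x - vecC ξ ⬝ᵥ vecC v)
  let f : (Fin g → ℝ) → ℂ := fun x => e (φ x)
  have hff : ∀ x, f x * f x = e (((-(ξ ⬝ᵥ x) : ℝ)) : ℂ) * gauss A x := by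
    intro x
    simp only [f, φ]
    rw [gauss, ← e_add, ← e_add]
    congr 1
    have : ((ξ ⬝ᵥ x : ℝ) : ℂ) = vecC ξ ⬝ᵥ vecC x := by simp [dotProduct]
    push_cast
    rw [this]
    ring
  have hderiv : ∀ x, HasLineDerivAt ℝ f (ψ x * f x) x v := by
    intro x
    have hexp : ∀ t : ℝ, φ (x + t • v) = φ x +
        (1 / 2 * ((A *ᵥ vecC v) ⬝ᵥ vecC x - vecC ξ ⬝ᵥ vecC v)) * t +
        (1 / 4 * (vecC v ⬝ᵥ (A *ᵥ vecC v))) * t ^ 2 := by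
      intro t
      have h1 : vecC (x + t • v) = vecC x + (t : ℂ) • vecC v := by ext i; simp [vecC]
      have h2 := dotProduct_mulVec_comm hA.1 (vecC v) (vecC x)
      have h3 := dotProduct_comm (A *ᵥ vecC v) (vecC x)
      simp only [φ, h1, Matrix.mulVec_add, Matrix.mulVec_smul, dotProduct_add, add_dotProduct,
        smul_dotProduct, dotProduct_smul, smul_eq_mul, h2, h3]
      ring
    have hd : HasDerivAt (fun t : ℝ => φ (x + t • v))
        (1 / 2 * ((A *ᵥ vecC v) ⬝ᵥ vecC x - vecC ξ ⬝ᵥ vecC v)) 0 := by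
      have ht : HasDerivAt (fun t : ℝ => (t : ℂ)) 1 0 := Complex.ofRealCLM.hasDerivAt
      have := ((ht.const_mul (1 / 2 * ((A *ᵥ vecC v) ⬝ᵥ vecC x - vecC ξ ⬝ᵥ vecC v))).const_add
        (φ x)).add ((ht.pow 2).const_mul (1 / 4 * (vecC v ⬝ᵥ (A *ᵥ vecC v))))
      rw [funext hexp]
      exact this.congr_deriv (by simp)
    have := (hd.const_mul (2 * Real.pi * Complex.I)).cexp
    refine this.congr_deriv ?_
    simp only [f, ψ, e, zero_smul, add_zero]
    ring
  have hunit : ∀ x : Fin g → ℝ, ‖e (((-(ξ ⬝ᵥ x) : ℝ)) : ℂ)‖ = 1 := fun x => norm_e_ofReal _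
  have hint0 : Integrable fun x => f x * f x := by
    simp only [hff]
    exact (hA.rapidlyDecreasing_gauss.mul_of_norm_eq_one hunit).integrable
      ((continuous_e_neg_dotProduct ξ).mul (continuous_gauss A))
  have hint1 : Integrable fun x => ψ x * (f x * f x) := by
    have h1 := ((hA.rapidlyDecreasing_linear_mul_gauss (A *ᵥ vecC v)).mul_of_norm_eq_one
      hunit).integrable ((continuous_e_neg_dotProduct ξ).mul
        ((continuous_dotProduct_vecC _).mul (continuous_gauss A)))
    have h2 := (h1.sub (hint0.const_mul (vecC ξ ⬝ᵥ vecC v))).const_mul (Real.pi * Complex.I)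
    refine h2.congr (.of_forall fun x => ?_)
    simp only [Pi.sub_apply, Pi.mul_apply, hff, ψ]
    ring
  have hparts := integral_bilinear_hasLineDerivAt_right_eq_neg_left_of_integrable
    (μ := volume) (f := f) (f' := fun x => ψ x * f x) (g := f) (g' := fun x => ψ x * f x) (v := v)
    (B := ContinuousLinearMap.mul ℝ ℂ)
    (hint1.congr (.of_forall fun x => by simp only [ContinuousLinearMap.mul_apply']; ring))
    (hint1.congr (.of_forall fun x => by simp only [ContinuousLinearMap.mul_apply']; ring))
    (hint0.congr (.of_forall fun x => by simp only [ContinuousLinearMap.mul_apply']))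
    (fun x _ => hderiv x) (fun x _ => hderiv x)
  simp only [ContinuousLinearMap.mul_apply'] at hparts
  have hzero : ∫ x, ψ x * (f x * f x) = 0 := by
    have e1 : ∫ x, ψ x * (f x * f x) = ∫ x, f x * (ψ x * f x) :=
      integral_congr_ae (.of_forall fun x => by ring)
    have e2 : ∫ x, ψ x * f x * f x = ∫ x, f x * (ψ x * f x) :=
      integral_congr_ae (.of_forall fun x => by ring)
    rw [e2] at hparts
    rw [e1]
    exact self_eq_neg.1 hparts
  simp only [hff, ψ, mul_assoc] at hzero
  rw [integral_const_mul, integral_const_mul] at hzero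
  exact (mul_eq_zero.1 ((mul_eq_zero.1 hzero).resolve_left
    (by exact_mod_cast Real.pi_ne_zero))).resolve_left Complex.I_ne_zero

/-- The Fourier transform of a linear form times a Gaussian. -/
theorem IsPosImag.fourierPi_linear_mul_gauss {A : Matrix (Fin g) (Fin g) ℂ} (hA : IsPosImag A)
    (l : Fin g → ℂ) (ξ : Fin g → ℝ) :
    fourierPi (fun x => (l ⬝ᵥ vecC x) * gauss A x) ξ =
      (((∫ x, gauss A x) • (A⁻¹ *ᵥ l)) ⬝ᵥ vecC ξ) * gauss (-A⁻¹) ξ := by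
  set E : (Fin g → ℝ) → ℂ := fun x => e (((-(ξ ⬝ᵥ x) : ℝ)) : ℂ) * gauss A x with hE
  have hunit : ∀ x : Fin g → ℝ, ‖e (((-(ξ ⬝ᵥ x) : ℝ)) : ℂ)‖ = 1 := fun x => norm_e_ofReal _
  have hint0 : Integrable E :=
    (hA.rapidlyDecreasing_gauss.mul_of_norm_eq_one hunit).integrable
      ((continuous_e_neg_dotProduct ξ).mul (continuous_gauss A))
  have hint : ∀ m : Fin g → ℂ, Integrable fun x => (m ⬝ᵥ vecC x) * E x := fun m =>
    (((hA.rapidlyDecreasing_linear_mul_gauss m).mul_of_norm_eq_one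
      hunit).integrable ((continuous_e_neg_dotProduct ξ).mul
        ((continuous_dotProduct_vecC _).mul (continuous_gauss A)))).congr
      (.of_forall fun x => by simp only [Pi.mul_apply, hE]; ring)
  have hsingle : ∀ i : Fin g, vecC (Pi.single i 1) = Pi.single i 1 := by
    intro i; ext j
    by_cases h : j = i
    · subst h; simp [vecC]
    · simp [vecC, h]
  have hcoord : ∀ i, ∫ x, ((A *ᵥ vecC (Pi.single i 1)) ⬝ᵥ vecC x) * E x = ξ i * ∫ x, E x := by
    intro i
    have h := hA.integral_deriv_gauss ξ (Pi.single i 1)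
    simp only [sub_mul] at h
    rw [integral_sub (hint _) (hint0.const_mul _), integral_const_mul, sub_eq_zero] at h
    rw [h, hsingle, dotProduct_single, mul_one]
  -- write `l` in terms of the columns of `A`, to which integration by parts applies
  set m := A⁻¹ *ᵥ l with hm
  have hl : l = A *ᵥ m := by
    rw [hm, Matrix.mulVec_mulVec, Matrix.mul_nonsing_inv _ (isUnit_iff_ne_zero.2 hA.det_ne_zero),
      Matrix.one_mulVec]
  have hlin : ∀ x, (l ⬝ᵥ vecC x) * E x =
      ∑ i, m i * (((A *ᵥ vecC (Pi.single i 1)) ⬝ᵥ vecC x) * E x) := by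
    intro x
    have : l = ∑ i, m i • (A *ᵥ vecC (Pi.single i 1)) := by
      simp only [hsingle, ← Matrix.mulVec_smul, ← Matrix.mulVec_sum]
      rw [hl]
      congr 1
      ext j
      simp [Finset.sum_apply, Pi.single_apply]
    conv_lhs => rw [this]
    rw [sum_dotProduct, Finset.sum_mul]
    exact Finset.sum_congr rfl fun i _ => by rw [smul_dotProduct, smul_eq_mul, mul_assoc]
  have h1 : fourierPi (fun x => (l ⬝ᵥ vecC x) * gauss A x) ξ = ∫ x, (l ⬝ᵥ vecC x) * E x :=
    integral_congr_ae (.of_forall fun x => by simp only [hE]; ring)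
  have h2 : ∫ x, E x = (∫ x, gauss A x) * gauss (-A⁻¹) ξ := hA.fourierPi_gauss ξ
  rw [h1]
  simp only [hlin]
  rw [integral_finsetSum _ fun i _ => (hint _).const_mul _]
  simp only [integral_const_mul, hcoord, h2, smul_dotProduct, smul_eq_mul]
  simp only [dotProduct, Finset.mul_sum, Finset.sum_mul]
  exact Finset.sum_congr rfl fun i _ => by simp only [vecC]; ring

end Gaussian

/-! ### One-parameter averages of Gaussians with a linear factor -/

section GaussAverage

variable {g : ℕ} {A : ℝ → Matrix (Fin g) (Fin g) ℂ} {l : ℝ → Fin g → ℂ}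

/-- The average over `s ∈ [0, 1]` of the Gaussians `e(½ xᵀ A(s) x)` with linear factors
`l(s)·x`. -/
def gaussAverage (A : ℝ → Matrix (Fin g) (Fin g) ℂ) (l : ℝ → Fin g → ℂ) (x : Fin g → ℝ) : ℂ :=
  ∫ s in (0 : ℝ)..1, (l s ⬝ᵥ vecC x) * gauss (A s) x

theorem continuous_gauss_uncurry (hA : Continuous A) :
    Continuous fun y : ℝ × (Fin g → ℝ) => gauss (A y.1) y.2 := by
  have h1 : Continuous fun y : ℝ × (Fin g → ℝ) => vecC y.2 := continuous_vecC.comp continuous_snd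
  exact continuous_e.comp (continuous_const.mul
    (h1.dotProduct ((hA.comp continuous_fst).matrix_mulVec h1)))

theorem continuous_gaussAverage_integrand (hA : Continuous A) (hl : Continuous l) :
    Continuous fun y : ℝ × (Fin g → ℝ) => (l y.1 ⬝ᵥ vecC y.2) * gauss (A y.1) y.2 :=
  ((hl.comp continuous_fst).dotProduct (continuous_vecC.comp continuous_snd)).mul
    (continuous_gauss_uncurry hA)

theorem norm_gaussAverage_integrand_le (hA : Continuous A) (hpos : ∀ s, IsPosImag (A s))
    (hl : Continuous l) : ∃ a C : ℝ, 0 < a ∧ 0 ≤ C ∧ ∀ s ∈ Icc (0 : ℝ) 1, ∀ x,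
      ‖(l s ⬝ᵥ vecC x) * gauss (A s) x‖ ≤ C * ‖x‖ * Real.exp (-(a * ‖x‖ ^ 2)) := by
  obtain ⟨ε, hε, h⟩ := exists_uniform_lower_bound hA hpos (isCompact_Icc (a := (0 : ℝ)) (b := 1))
  have hc : Continuous fun s => ∑ i, ‖l s i‖ := by fun_prop
  obtain ⟨C, hC⟩ := (isCompact_Icc (a := (0 : ℝ)) (b := 1)).bddAbove_image hc.continuousOn
  have hC' : ∀ s ∈ Icc (0 : ℝ) 1, ∑ i, ‖l s i‖ ≤ C := fun s hs => hC (mem_image_of_mem _ hs)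
  have hC0 : 0 ≤ C := le_trans (Finset.sum_nonneg fun i _ => norm_nonneg _) (hC' 0 (by simp))
  refine ⟨Real.pi * ε, C, by positivity, hC0, fun s hs x => ?_⟩
  rw [norm_mul, norm_gauss, mul_assoc Real.pi]
  refine mul_le_mul ((norm_dotProduct_vecC_le _ _).trans ?_) (Real.exp_le_exp.2 (neg_le_neg
    (mul_le_mul_of_nonneg_left (h s hs x) Real.pi_pos.le))) (Real.exp_nonneg _) (by positivity)
  gcongr
  exact hC' s hs

theorem continuous_gaussAverage (hA : Continuous A) (hl : Continuous l) :
    Continuous (gaussAverage A l) :=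
  intervalIntegral.continuous_parametric_intervalIntegral_of_continuous'
    (f := fun x s => (l s ⬝ᵥ vecC x) * gauss (A s) x)
    ((continuous_gaussAverage_integrand hA hl).comp continuous_swap) 0 1

theorem rapidlyDecreasing_gaussAverage (hA : Continuous A) (hpos : ∀ s, IsPosImag (A s))
    (hl : Continuous l) : RapidlyDecreasing (gaussAverage A l) := by
  obtain ⟨a, C, ha, -, h⟩ := norm_gaussAverage_integrand_le hA hpos hl
  refine rapidlyDecreasing_of_norm_le (C := C) ha fun x => ?_
  have := intervalIntegral.norm_integral_le_of_norm_le_const (a := (0 : ℝ)) (b := 1)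
    (f := fun s => (l s ⬝ᵥ vecC x) * gauss (A s) x)
    (C := C * ‖x‖ * Real.exp (-(a * ‖x‖ ^ 2))) fun s hs => h s ?_ x
  · simpa [gaussAverage] using this
  · rw [uIoc_of_le zero_le_one] at hs
    exact Ioc_subset_Icc_self hs

theorem gaussAverage_zero (A : ℝ → Matrix (Fin g) (Fin g) ℂ) (l : ℝ → Fin g → ℂ) :
    gaussAverage A l 0 = 0 := by
  have : vecC (0 : Fin g → ℝ) = 0 := by ext; simp [vecC]
  simp [gaussAverage, this]

theorem continuous_integral_gauss (hA : Continuous A) (hpos : ∀ s, IsPosImag (A s)) :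
    Continuous fun s => ∫ x, gauss (A s) x := by
  rw [continuous_iff_continuousAt]
  intro s₀
  obtain ⟨ε, hε, h⟩ := exists_uniform_lower_bound hA hpos
    (isCompact_Icc (a := s₀ - 1) (b := s₀ + 1))
  let F : (Fin g → ℝ) → ℝ := fun x => Real.exp (-(Real.pi * ε * ‖x‖ ^ 2))
  have hF : Integrable F := by
    have hR : RapidlyDecreasing fun x => (F x : ℂ) := by
      intro N
      obtain ⟨D, hD⟩ := pow_mul_exp_neg_sq_le (a := Real.pi * ε) (by positivity) N
      refine ⟨D, fun x => ?_⟩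
      rw [Complex.norm_real, Real.norm_of_nonneg (Real.exp_nonneg _)]
      exact hD _ (norm_nonneg x)
    have := (hR.integrable (Complex.continuous_ofReal.comp (by fun_prop))).re
    simpa using this
  refine continuousAt_of_dominated (bound := F)
    (.of_forall fun s => (continuous_gauss (A s)).aestronglyMeasurable) ?_ hF
    (.of_forall fun x => ?_)
  · filter_upwards [Icc_mem_nhds (show s₀ - 1 < s₀ by linarith) (show s₀ < s₀ + 1 by linarith)]
      with s hs
    refine .of_forall fun x => ?_
    rw [norm_gauss]
    simp only [F]
    rw [mul_assoc]
    exact Real.exp_le_exp.2 (neg_le_neg (mul_le_mul_of_nonneg_left (h s hs x) Real.pi_pos.le))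
  · exact ((continuous_gauss_uncurry hA).comp (continuous_id.prodMk continuous_const)).continuousAt

theorem continuous_matrix_inv (hA : Continuous A) (hdet : ∀ s, (A s).det ≠ 0) :
    Continuous fun s => (A s)⁻¹ := by
  simp only [Matrix.inv_def, Ring.inverse_eq_inv']
  exact (hA.matrix_det.inv₀ hdet).smul hA.matrix_adjugate

/-- The class of Gaussian averages is stable under the Fourier transform, which acts on each
Gaussian separately. -/
theorem fourierPi_gaussAverage (hA : Continuous A) (hpos : ∀ s, IsPosImag (A s))
    (hl : Continuous l) :
    fourierPi (gaussAverage A l) = gaussAverage (fun s => -(A s)⁻¹)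
      fun s => (∫ x, gauss (A s) x) • ((A s)⁻¹ *ᵥ l s) := by
  ext ξ
  obtain ⟨a, C, ha, hC0, h⟩ := norm_gaussAverage_integrand_le hA hpos hl
  let G : (Fin g → ℝ) → ℝ → ℂ := fun x s =>
    e (((-(ξ ⬝ᵥ x) : ℝ)) : ℂ) * ((l s ⬝ᵥ vecC x) * gauss (A s) x)
  have hGc : Continuous (Function.uncurry G) :=
    ((continuous_e_neg_dotProduct ξ).comp continuous_fst).mul
      ((continuous_gaussAverage_integrand hA hl).comp continuous_swap)
  let F : (Fin g → ℝ) → ℝ := fun x => C * ‖x‖ * Real.exp (-(a * ‖x‖ ^ 2))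
  have hF : Integrable F := by
    have hR : RapidlyDecreasing fun x => (F x : ℂ) :=
      rapidlyDecreasing_of_norm_le (C := C) ha fun x => by
        rw [Complex.norm_real, Real.norm_of_nonneg (by positivity)]
    have := (hR.integrable (Complex.continuous_ofReal.comp (by fun_prop))).re
    simpa using this
  have hint : Integrable (Function.uncurry G)
      ((volume : Measure (Fin g → ℝ)).prod (volume.restrict (Ioc (0 : ℝ) 1))) := by
    have hF2 : Integrable (fun y : (Fin g → ℝ) × ℝ => F y.1)
        ((volume : Measure (Fin g → ℝ)).prod (volume.restrict (Ioc (0 : ℝ) 1))) := hF.comp_fst _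
    refine hF2.mono' hGc.aestronglyMeasurable ?_
    have hae : ∀ᵐ y ∂((volume : Measure (Fin g → ℝ)).prod (volume.restrict (Ioc (0 : ℝ) 1))),
        y.2 ∈ Ioc (0 : ℝ) 1 :=
      Measure.quasiMeasurePreserving_snd.ae (ae_restrict_mem measurableSet_Ioc)
    filter_upwards [hae] with y hy
    simp only [Function.uncurry, G]
    rw [norm_mul, norm_e_ofReal, one_mul]
    exact h y.2 (Ioc_subset_Icc_self hy) y.1
  have h1 : fourierPi (gaussAverage A l) ξ = ∫ x, ∫ s in Ioc (0 : ℝ) 1, G x s := by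
    refine integral_congr_ae (.of_forall fun x => ?_)
    simp only [gaussAverage, G]
    rw [intervalIntegral.integral_of_le zero_le_one, integral_const_mul]
  rw [h1, integral_integral_swap hint, gaussAverage, intervalIntegral.integral_of_le zero_le_one]
  refine integral_congr_ae (.of_forall fun s => ?_)
  exact (hpos s).fourierPi_linear_mul_gauss (l s) ξ

end GaussAverage

/-! ### The cone of negative vectors of a form of signature `(g - 1, 1)` -/

section Cone

variable {g : ℕ}

/-- A form of signature `(g - 1, 1)` is `|T x|² - (φ·x)²` with `T` and `φ` having no common
kernel. -/
theorem HasSignature.exists_decomposition {M : Matrix (Fin g) (Fin g) ℝ}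
    (hM : HasSignature M (g - 1) 1) :
    ∃ (T : Matrix (Fin g) (Fin g) ℝ) (φ : Fin g → ℝ),
      M = Tᵀ * T - Matrix.vecMulVec φ φ ∧ ∀ x, T *ᵥ x = 0 → φ ⬝ᵥ x = 0 → x = 0 := by
  obtain ⟨hg, h, hp, hn⟩ := hM
  obtain ⟨U, hU1, hU2, hU⟩ := exists_orthogonal_diagonalization h
  set l := h.eigenvalues with hl
  obtain ⟨i₀, hi₀⟩ := Finset.card_eq_one.1 hn
  have hneg : l i₀ < 0 := by
    have : i₀ ∈ (Finset.univ.filter fun i => l i < 0) := by rw [hi₀]; simp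
    simpa using this
  have hpos : ∀ i, i ≠ i₀ → 0 < l i := by
    intro i hi
    have hsub : (Finset.univ.filter fun i => 0 < l i) ⊆ Finset.univ.erase i₀ := by
      intro j hj
      have hj' : 0 < l j := by simpa using hj
      refine Finset.mem_erase.2 ⟨?_, Finset.mem_univ _⟩
      rintro rfl
      linarith
    have heq := Finset.eq_of_subset_of_card_le hsub (by simp [hp])
    have : i ∈ (Finset.univ.filter fun i => 0 < l i) := by rw [heq]; simp [hi]
    simpa using this
  -- `m` and `k` carry the square roots of the positive and of the negative eigenvalues
  let m : Fin g → ℝ := fun i => if i = i₀ then 0 else Real.sqrt (l i)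
  let k : Fin g → ℝ := fun i => if i = i₀ then Real.sqrt (-l i) else 0
  have hmk : ∀ i, m i * m i - k i * k i = l i := by
    intro i
    by_cases hi : i = i₀
    · subst hi
      simp only [m, k, if_true]
      rw [Real.mul_self_sqrt (by linarith)]; ring
    · simp only [m, k, hi, if_false]
      rw [Real.mul_self_sqrt (hpos i hi).le]; ring
  have hkk : Matrix.vecMulVec k k = Matrix.diagonal fun i => k i * k i := by
    ext i j
    rw [Matrix.vecMulVec_apply, Matrix.diagonal_apply]
    by_cases hij : i = j
    · subst hij; simp
    · by_cases hi : i = i₀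
      · have hj : j ≠ i₀ := fun hj => hij (hi.trans hj.symm)
        simp [k, hj, hij]
      · simp [k, hi, hij]
  refine ⟨Matrix.diagonal m * Uᵀ, U *ᵥ k, ?_, fun x h1 h2 => ?_⟩
  · rw [Matrix.transpose_mul, Matrix.transpose_transpose, Matrix.diagonal_transpose,
      Matrix.mul_assoc, ← Matrix.mul_assoc (Matrix.diagonal m), Matrix.diagonal_mul_diagonal,
      ← Matrix.mul_vecMulVec, ← Matrix.vecMul_transpose U k, ← Matrix.vecMulVec_mul, hkk,
      ← Matrix.mul_assoc, ← Matrix.mul_assoc, ← Matrix.sub_mul, ← Matrix.mul_sub,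
      Matrix.diagonal_sub, funext hmk]
    exact hU
  · have h3 : Uᵀ *ᵥ x = 0 := by
      ext i
      by_cases hi : i = i₀
      · rw [dotProduct_comm, Matrix.dotProduct_mulVec, ← Matrix.mulVec_transpose] at h2
        simp only [dotProduct, k] at h2
        rw [Finset.sum_eq_single i₀ (fun j _ hj => by simp [hj]) (by simp)] at h2
        simp only [if_true] at h2
        rw [hi]
        exact (mul_eq_zero.1 h2).resolve_right (Real.sqrt_pos.2 (by linarith)).ne'
      · have h4 := congrFun h1 i
        rw [← Matrix.mulVec_mulVec, Matrix.mulVec_diagonal] at h4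
        simp only [m, hi, if_false] at h4
        exact (mul_eq_zero.1 h4).resolve_left (Real.sqrt_pos.2 (hpos i hi)).ne'
    have h5 := congrArg (fun v => U *ᵥ v) h3
    simpa only [Matrix.mulVec_mulVec, hU2, Matrix.one_mulVec, Matrix.mulVec_zero] using h5

theorem HasSignature.transpose_eq {M : Matrix (Fin g) (Fin g) ℝ} {j k : ℕ}
    (hM : HasSignature M j k) : Mᵀ = M := by
  obtain ⟨-, h, -⟩ := hM
  rwa [Matrix.IsHermitian, Matrix.conjTranspose_eq_transpose_of_trivial] at h

theorem bilinear_decomposition {T : Matrix (Fin g) (Fin g) ℝ} {φ : Fin g → ℝ} (x z : Fin g → ℂ) :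
    x ⬝ᵥ (toC (Tᵀ * T - Matrix.vecMulVec φ φ) *ᵥ z) =
      (toC T *ᵥ x) ⬝ᵥ (toC T *ᵥ z) - (vecC φ ⬝ᵥ x) * (vecC φ ⬝ᵥ z) := by
  have h1 : toC (Tᵀ * T - Matrix.vecMulVec φ φ) =
      (toC T)ᵀ * toC T - Matrix.vecMulVec (vecC φ) (vecC φ) := by
    rw [← toC_transpose, ← toC_mul]
    ext i j
    simp [toC, vecC, Matrix.vecMulVec_apply]
  rw [h1, Matrix.sub_mulVec, dotProduct_sub, ← Matrix.mulVec_mulVec, Matrix.dotProduct_mulVec,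
    Matrix.vecMul_transpose, Matrix.vecMulVec_mulVec]
  congr 1
  simp only [op_smul_eq_smul, dotProduct_smul, smul_eq_mul]
  rw [mul_comm, dotProduct_comm x]

theorem bilinear_decomposition_real {T : Matrix (Fin g) (Fin g) ℝ} {φ : Fin g → ℝ}
    (x z : Fin g → ℝ) :
    x ⬝ᵥ ((Tᵀ * T - Matrix.vecMulVec φ φ) *ᵥ z) =
      (T *ᵥ x) ⬝ᵥ (T *ᵥ z) - (φ ⬝ᵥ x) * (φ ⬝ᵥ z) := by
  rw [Matrix.sub_mulVec, dotProduct_sub, ← Matrix.mulVec_mulVec, Matrix.dotProduct_mulVec,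
    Matrix.vecMul_transpose, Matrix.vecMulVec_mulVec]
  congr 1
  simp only [op_smul_eq_smul, dotProduct_smul, smul_eq_mul]
  rw [mul_comm, dotProduct_comm x]

theorem mem_negCone_iff {T : Matrix (Fin g) (Fin g) ℝ} {φ : Fin g → ℝ} (z : Fin g → ℂ) :
    z ∈ negCone (Tᵀ * T - Matrix.vecMulVec φ φ) ↔
      ∑ i, ‖(toC T *ᵥ z) i‖ ^ 2 < ‖vecC φ ⬝ᵥ z‖ ^ 2 := by
  have h1 : toC T *ᵥ star z = star (toC T *ᵥ z) := by
    ext i; simp [Matrix.mulVec, dotProduct, toC]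
  have h2 : vecC φ ⬝ᵥ star z = star (vecC φ ⬝ᵥ z) := by
    simp [dotProduct, vecC]
  have h3 : (star (toC T *ᵥ z) ⬝ᵥ (toC T *ᵥ z)).re = ∑ i, ‖(toC T *ᵥ z) i‖ ^ 2 := by
    rw [dotProduct, Complex.re_sum]
    refine Finset.sum_congr rfl fun i _ => ?_
    rw [Pi.star_apply, Complex.star_def, Complex.conj_mul', ← Complex.ofReal_pow,
      Complex.ofReal_re]
  have h4 : (star (vecC φ ⬝ᵥ z) * (vecC φ ⬝ᵥ z)).re = ‖vecC φ ⬝ᵥ z‖ ^ 2 := by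
    rw [Complex.star_def, Complex.conj_mul', ← Complex.ofReal_pow, Complex.ofReal_re]
  change (star z ⬝ᵥ (toC (Tᵀ * T - Matrix.vecMulVec φ φ) *ᵥ z)).re < 0 ↔ _
  rw [bilinear_decomposition, h1, h2, Complex.sub_re, h3, h4, sub_neg]

theorem smul_mem_negCone {M : Matrix (Fin g) (Fin g) ℝ} {z : Fin g → ℂ} (hz : z ∈ negCone M)
    {a : ℂ} (ha : a ≠ 0) : a • z ∈ negCone M := by
  change (star (a • z) ⬝ᵥ (toC M *ᵥ (a • z))).re < 0
  have hz' : (star z ⬝ᵥ (toC M *ᵥ z)).re < 0 := hz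
  rw [star_smul, Matrix.mulVec_smul, dotProduct_smul, smul_dotProduct, smul_eq_mul, smul_eq_mul,
    ← mul_assoc, Complex.star_def, Complex.mul_conj', ← Complex.ofReal_pow, Complex.re_ofReal_mul]
  exact mul_neg_of_pos_of_neg (by positivity) hz'

/-- By the triangle inequality `|cᵀ M c|` is at least `-c̄ᵀ M c`. -/
theorem HasSignature.quadratic_ne_zero {M : Matrix (Fin g) (Fin g) ℝ}
    (hM : HasSignature M (g - 1) 1) {c : Fin g → ℂ} (hc : c ∈ negCone M) :
    c ⬝ᵥ (toC M *ᵥ c) ≠ 0 := by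
  obtain ⟨T, φ, rfl, -⟩ := hM.exists_decomposition
  rw [mem_negCone_iff] at hc
  rw [bilinear_decomposition]
  intro h0
  have h1 : ‖(toC T *ᵥ c) ⬝ᵥ (toC T *ᵥ c)‖ ≤ ∑ i, ‖(toC T *ᵥ c) i‖ ^ 2 := by
    refine (norm_sum_le _ _).trans (le_of_eq (Finset.sum_congr rfl fun i _ => ?_))
    rw [norm_mul, sq]
  rw [sub_eq_zero.1 h0, norm_mul, ← sq] at h1
  linarith

/-- Real vectors orthogonal to a negative real vector are positive. -/
theorem HasSignature.pos_of_orthogonal {M : Matrix (Fin g) (Fin g) ℝ}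
    (hM : HasSignature M (g - 1) 1) {a z : Fin g → ℝ} (ha : a ⬝ᵥ (M *ᵥ a) < 0)
    (haz : a ⬝ᵥ (M *ᵥ z) = 0) (hz : z ≠ 0) : 0 < z ⬝ᵥ (M *ᵥ z) := by
  obtain ⟨T, φ, rfl, hker⟩ := hM.exists_decomposition
  rw [bilinear_decomposition_real] at ha haz ⊢
  have hcs : ((T *ᵥ a) ⬝ᵥ (T *ᵥ z)) ^ 2 ≤
      ((T *ᵥ a) ⬝ᵥ (T *ᵥ a)) * ((T *ᵥ z) ⬝ᵥ (T *ᵥ z)) := by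
    have := Finset.sum_mul_sq_le_sq_mul_sq Finset.univ (T *ᵥ a) (T *ᵥ z)
    simpa only [dotProduct, ← sq] using this
  have hnn : ∀ y : Fin g → ℝ, 0 ≤ y ⬝ᵥ y := fun y =>
    Finset.sum_nonneg fun i _ => mul_self_nonneg _
  set P := (T *ᵥ a) ⬝ᵥ (T *ᵥ a)
  set Q := (T *ᵥ z) ⬝ᵥ (T *ᵥ z) with hQ
  have hP : 0 ≤ P := hnn _
  have hQ0 : 0 ≤ Q := hnn _
  rw [sub_eq_zero.1 haz] at hcs
  by_cases hφ : φ ⬝ᵥ z = 0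
  · rw [hφ, mul_zero, sub_zero]
    refine lt_of_le_of_ne hQ0 fun h0 => hz (hker z ?_ hφ)
    exact dotProduct_self_eq_zero.1 h0.symm
  · have hφ2 : 0 < (φ ⬝ᵥ z) ^ 2 := by positivity
    by_contra hle
    have hle' : Q ≤ (φ ⬝ᵥ z) ^ 2 := by nlinarith
    have : P * Q ≤ P * (φ ⬝ᵥ z) ^ 2 := mul_le_mul_of_nonneg_left hle' hP
    nlinarith

theorem HasSignature.nonneg_of_orthogonal {M : Matrix (Fin g) (Fin g) ℝ}
    (hM : HasSignature M (g - 1) 1) {a z : Fin g → ℝ} (ha : a ⬝ᵥ (M *ᵥ a) < 0)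
    (haz : a ⬝ᵥ (M *ᵥ z) = 0) : 0 ≤ z ⬝ᵥ (M *ᵥ z) := by
  by_cases hz : z = 0
  · simp [hz]
  · exact (hM.pos_of_orthogonal ha haz hz).le

/-- After rescaling, `cᵀ M c` becomes a negative real number. -/
theorem exists_scale_quadratic_neg {M : Matrix (Fin g) (Fin g) ℝ} {c : Fin g → ℂ}
    (hc : c ⬝ᵥ (toC M *ᵥ c) ≠ 0) : ∃ μ : ℂ, μ ≠ 0 ∧
      (μ • c) ⬝ᵥ (toC M *ᵥ (μ • c)) = ((-1 : ℝ) : ℂ) := by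
  obtain ⟨μ, hμ⟩ := IsAlgClosed.exists_pow_nat_eq (-(c ⬝ᵥ (toC M *ᵥ c))⁻¹) (n := 2) (by norm_num)
  refine ⟨μ, fun h0 => ?_, ?_⟩
  · rw [h0] at hμ
    simp at hμ
    exact hc hμ
  · rw [Matrix.mulVec_smul, dotProduct_smul, smul_dotProduct, smul_eq_mul, smul_eq_mul, ← mul_assoc,
      ← sq, hμ, neg_mul, inv_mul_cancel₀ hc]
    simp

/-- The form `xᵀ M x - 2 Re ((cᵀ M x)² / (cᵀ M c))` is positive definite. When `cᵀ M c = -1` the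
real and imaginary parts `a`, `b` of `c` are orthogonal and `a` is negative; splitting `x` along
`a` and using Cauchy–Schwarz for `b` on the orthogonal complement of `a` gives the bound. -/
theorem HasSignature.sub_re_pos {M : Matrix (Fin g) (Fin g) ℝ} (hM : HasSignature M (g - 1) 1)
    {c : Fin g → ℂ} (hc : c ∈ negCone M) {x : Fin g → ℝ} (hx : x ≠ 0) :
    0 < x ⬝ᵥ (M *ᵥ x) -
      2 * ((c ⬝ᵥ (toC M *ᵥ vecC x)) ^ 2 / (c ⬝ᵥ (toC M *ᵥ c))).re := by
  obtain ⟨μ, hμ, hμc⟩ := exists_scale_quadratic_neg (hM.quadratic_ne_zero hc)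
  have hscale : (c ⬝ᵥ (toC M *ᵥ vecC x)) ^ 2 / (c ⬝ᵥ (toC M *ᵥ c)) =
      ((μ • c) ⬝ᵥ (toC M *ᵥ vecC x)) ^ 2 / ((μ • c) ⬝ᵥ (toC M *ᵥ (μ • c))) := by
    rw [Matrix.mulVec_smul, dotProduct_smul, smul_dotProduct, smul_dotProduct, smul_eq_mul,
      smul_eq_mul, smul_eq_mul]
    have := hM.quadratic_ne_zero hc
    field_simp
  rw [hscale]
  have hd := smul_mem_negCone hc hμ
  set d := μ • c with hd'
  clear_value d
  rw [hμc]
  set a : Fin g → ℝ := fun i => (d i).re with ha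
  set b : Fin g → ℝ := fun i => (d i).im with hb
  have hsym := hM.transpose_eq
  have hdab : d = vecC a + Complex.I • vecC b := by
    ext i
    simp only [Pi.add_apply, Pi.smul_apply, smul_eq_mul, vecC, ha, hb]
    rw [mul_comm]; exact (Complex.re_add_im _).symm
  have hreal : ∀ y z : Fin g → ℝ, vecC y ⬝ᵥ (toC M *ᵥ vecC z) = ((y ⬝ᵥ (M *ᵥ z) : ℝ) : ℂ) := by
    intro y z
    rw [toC_mulVec]; simp [dotProduct, vecC]
  have hstar : star d = vecC a - Complex.I • vecC b := by
    rw [hdab]; ext i; simp [vecC, sub_eq_add_neg]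
  have hba := dotProduct_mulVec_comm hsym b a
  have hquad : d ⬝ᵥ (toC M *ᵥ d) = ((a ⬝ᵥ (M *ᵥ a) - b ⬝ᵥ (M *ᵥ b) : ℝ) : ℂ) +
      ((2 * (a ⬝ᵥ (M *ᵥ b)) : ℝ) : ℂ) * Complex.I := by
    rw [hdab]
    simp only [Matrix.mulVec_add, Matrix.mulVec_smul, dotProduct_add, add_dotProduct,
      dotProduct_smul, smul_dotProduct, hreal, smul_eq_mul, hba]
    push_cast
    linear_combination ((b ⬝ᵥ (M *ᵥ b) : ℝ) : ℂ) * Complex.I_mul_I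
  have hherm : (star d ⬝ᵥ (toC M *ᵥ d)) = ((a ⬝ᵥ (M *ᵥ a) + b ⬝ᵥ (M *ᵥ b) : ℝ) : ℂ) := by
    rw [hstar]
    conv_lhs => rw [hdab]
    simp only [Matrix.mulVec_add, Matrix.mulVec_smul, dotProduct_add, sub_dotProduct,
      dotProduct_smul, smul_dotProduct, hreal, smul_eq_mul, hba]
    push_cast
    linear_combination (-((b ⬝ᵥ (M *ᵥ b) : ℝ) : ℂ)) * Complex.I_mul_I
  rw [hquad] at hμc
  have h1 : a ⬝ᵥ (M *ᵥ a) - b ⬝ᵥ (M *ᵥ b) = -1 := by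
    have := congrArg Complex.re hμc
    simpa using this
  have h2 : a ⬝ᵥ (M *ᵥ b) = 0 := by
    have := congrArg Complex.im hμc
    simpa using this
  have h3 : a ⬝ᵥ (M *ᵥ a) + b ⬝ᵥ (M *ᵥ b) < 0 := by
    have : (star d ⬝ᵥ (toC M *ᵥ d)).re < 0 := hd
    rwa [hherm, Complex.ofReal_re] at this
  have hre : ((d ⬝ᵥ (toC M *ᵥ vecC x)) ^ 2 / ((-1 : ℝ) : ℂ)).re =
      (b ⬝ᵥ (M *ᵥ x)) ^ 2 - (a ⬝ᵥ (M *ᵥ x)) ^ 2 := by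
    rw [hdab, add_dotProduct, smul_dotProduct, hreal, hreal, smul_eq_mul, ← Complex.ofReal_re
      ((b ⬝ᵥ (M *ᵥ x)) ^ 2 - (a ⬝ᵥ (M *ᵥ x)) ^ 2)]
    have : (((a ⬝ᵥ (M *ᵥ x) : ℝ) : ℂ) + Complex.I * ((b ⬝ᵥ (M *ᵥ x) : ℝ) : ℂ)) ^ 2 /
        ((-1 : ℝ) : ℂ) =
        (((b ⬝ᵥ (M *ᵥ x)) ^ 2 - (a ⬝ᵥ (M *ᵥ x)) ^ 2 : ℝ) : ℂ) +
          ((-2 * (a ⬝ᵥ (M *ᵥ x)) * (b ⬝ᵥ (M *ᵥ x)) : ℝ) : ℂ) * Complex.I := by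
      push_cast
      rw [div_neg, div_one]
      linear_combination (-(((b ⬝ᵥ (M *ᵥ x) : ℝ) : ℂ)) ^ 2) * Complex.I_mul_I
    rw [this]
    simp
  rw [hre]
  have haneg : a ⬝ᵥ (M *ᵥ a) < 0 := by linarith
  have hbnn := hM.nonneg_of_orthogonal haneg h2
  have hax := dotProduct_mulVec_comm hsym a x
  set A := -(a ⬝ᵥ (M *ᵥ a)) with hA
  set D := b ⬝ᵥ (M *ᵥ b) with hD
  have hA0 : 0 < A := by linarith
  have hDA : A + D = 1 := by linarith
  have hAD : D < A := by linarith
  have haa : a ⬝ᵥ (M *ᵥ a) = -A := by rw [hA, neg_neg]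
  set α := a ⬝ᵥ (M *ᵥ x) with hα
  set δ := b ⬝ᵥ (M *ᵥ x) with hδ
  -- the component of `x` orthogonal to `a`
  set z := x + (α / A) • a with hz
  have haz : a ⬝ᵥ (M *ᵥ z) = 0 := by
    rw [hz, Matrix.mulVec_add, Matrix.mulVec_smul, dotProduct_add, dotProduct_smul, smul_eq_mul,
      haa, ← hα]
    field_simp; ring
  have hzz : z ⬝ᵥ (M *ᵥ z) = x ⬝ᵥ (M *ᵥ x) + α ^ 2 / A := by
    rw [hz, Matrix.mulVec_add, Matrix.mulVec_smul, dotProduct_add, add_dotProduct, add_dotProduct,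
      dotProduct_smul, dotProduct_smul, smul_dotProduct, smul_dotProduct, smul_eq_mul, smul_eq_mul,
      smul_eq_mul, haa, ← hax, ← hα]
    linear_combination (-(α ^ 2 * A⁻¹)) * mul_inv_cancel₀ hA0.ne'
  have hbz : b ⬝ᵥ (M *ᵥ z) = δ := by
    rw [hz, Matrix.mulVec_add, Matrix.mulVec_smul, dotProduct_add, dotProduct_smul, hba, h2,
      smul_zero, add_zero]
  have hzb : z ⬝ᵥ (M *ᵥ b) = δ := by rw [dotProduct_mulVec_comm hsym, hbz]
  have hznn := hM.nonneg_of_orthogonal haneg haz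
  set Z := z ⬝ᵥ (M *ᵥ z) with hZ
  have hcs : δ ^ 2 ≤ D * Z := by
    by_cases hb0 : b = 0
    · have : δ = 0 := by rw [← hbz, hb0, zero_dotProduct]
      rw [this, zero_pow two_ne_zero]
      exact mul_nonneg hbnn hznn
    · have hDpos : 0 < D := hM.pos_of_orthogonal haneg h2 hb0
      have hw : a ⬝ᵥ (M *ᵥ (D • z - δ • b)) = 0 := by
        rw [Matrix.mulVec_sub, Matrix.mulVec_smul, Matrix.mulVec_smul, dotProduct_sub,
          dotProduct_smul, dotProduct_smul, haz, h2, smul_zero, smul_zero, sub_zero]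
      have := hM.nonneg_of_orthogonal haneg hw
      have hexp : (D • z - δ • b) ⬝ᵥ (M *ᵥ (D • z - δ • b)) = D * (D * Z - δ ^ 2) := by
        rw [Matrix.mulVec_sub, Matrix.mulVec_smul, Matrix.mulVec_smul]
        simp only [dotProduct_sub, sub_dotProduct, dotProduct_smul, smul_dotProduct, smul_eq_mul,
          hbz, hzb, ← hD, ← hZ]
        ring
      rw [hexp] at this
      have := nonneg_of_mul_nonneg_right this hDpos
      linarith
  have hxx : x ⬝ᵥ (M *ᵥ x) = Z - α ^ 2 / A := by rw [hzz]; ring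
  have hpos : 0 < Z + α ^ 2 / A := by
    by_cases hz0 : z = 0
    · have hα0 : α ≠ 0 := by
        intro h0
        rw [hz0, h0, zero_div, zero_smul, add_zero] at hz
        exact hx hz.symm
      have : 0 < α ^ 2 / A := by positivity
      linarith
    · have := hM.pos_of_orthogonal haneg haz hz0
      have : 0 ≤ α ^ 2 / A := by positivity
      linarith
  -- the first summand is positive as `D < A`, the second is nonnegative by Cauchy–Schwarz, and
  -- the identity holds because `A + D = 1`
  have hfin : x ⬝ᵥ (M *ᵥ x) - 2 * (δ ^ 2 - α ^ 2) =
      (A - D) * (Z + α ^ 2 / A) + 2 * (D * Z - δ ^ 2) := by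
    have hα2 : α ^ 2 = A * (α ^ 2 / A) := by field_simp
    rw [hxx]
    have : D = 1 - A := by linarith
    rw [this]
    linear_combination 2 * hα2
  rw [hfin]
  have := mul_pos (sub_pos.2 hAD) hpos
  linarith

/-- Any two negative vectors are joined, after rescaling the second, by a `C¹` path of negative
vectors. The path is a segment in the convex slice where `φ·z` is constant, reparametrized by
`s ↦ (1 - cos πs)/2` so that it is defined for all real `s`. -/
theorem HasSignature.exists_path {M : Matrix (Fin g) (Fin g) ℝ} (hM : HasSignature M (g - 1) 1)
    {c₁ c₂ : Fin g → ℂ} (h₁ : c₁ ∈ negCone M) (h₂ : c₂ ∈ negCone M) :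
    ∃ (a : ℂ) (c c' : ℝ → Fin g → ℂ), a ≠ 0 ∧ (∀ s, c s ∈ negCone M) ∧
      (∀ s, HasDerivAt c (c' s) s) ∧ Continuous c' ∧ c 0 = c₁ ∧ c 1 = a • c₂ := by
  obtain ⟨T, φ, rfl, -⟩ := hM.exists_decomposition
  have hφ : ∀ c ∈ negCone (Tᵀ * T - Matrix.vecMulVec φ φ), vecC φ ⬝ᵥ c ≠ 0 := by
    intro c hc h0
    rw [mem_negCone_iff, h0] at hc
    have : 0 ≤ ∑ i, ‖(toC T *ᵥ c) i‖ ^ 2 := Finset.sum_nonneg fun i _ => sq_nonneg _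
    simp at hc
    linarith
  set a : ℂ := (vecC φ ⬝ᵥ c₁) / (vecC φ ⬝ᵥ c₂) with ha
  have ha0 : a ≠ 0 := div_ne_zero (hφ _ h₁) (hφ _ h₂)
  let σ : ℝ → ℝ := fun s => (1 - Real.cos (Real.pi * s)) / 2
  have hσd : ∀ s, HasDerivAt σ (Real.pi * Real.sin (Real.pi * s) / 2) s := by
    intro s
    have h := ((((hasDerivAt_id s).const_mul Real.pi).cos).const_sub 1).div_const 2
    refine h.congr_deriv ?_
    simp; ring
  refine ⟨a, fun s => c₁ + (σ s : ℂ) • (a • c₂ - c₁),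
    fun s => ((Real.pi * Real.sin (Real.pi * s) / 2 : ℝ) : ℂ) • (a • c₂ - c₁), ha0, fun s => ?_,
    fun s => ?_, ?_, ?_, ?_⟩
  · have hs0 : 0 ≤ σ s := by simp only [σ]; linarith [Real.cos_le_one (Real.pi * s)]
    have hs1 : 0 ≤ 1 - σ s := by simp only [σ]; linarith [Real.neg_one_le_cos (Real.pi * s)]
    have h₂' := smul_mem_negCone h₂ ha0
    have hac : vecC φ ⬝ᵥ (a • c₂) = vecC φ ⬝ᵥ c₁ := by
      rw [dotProduct_smul, smul_eq_mul, ha, div_mul_cancel₀ _ (hφ _ h₂)]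
    rw [mem_negCone_iff] at h₁ h₂' ⊢
    rw [hac] at h₂'
    have hval : vecC φ ⬝ᵥ (c₁ + (σ s : ℂ) • (a • c₂ - c₁)) = vecC φ ⬝ᵥ c₁ := by
      rw [dotProduct_add, dotProduct_smul, dotProduct_sub, hac, sub_self, smul_zero, add_zero]
    rw [hval]
    set u := toC T *ᵥ c₁ with hu
    set v := toC T *ᵥ (a • c₂) with hv
    have hT : toC T *ᵥ (c₁ + (σ s : ℂ) • (a • c₂ - c₁)) = u + (σ s : ℂ) • (v - u) := by
      rw [Matrix.mulVec_add, Matrix.mulVec_smul, Matrix.mulVec_sub]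
    rw [hT]
    have hi : ∀ i, ‖(u + (σ s : ℂ) • (v - u)) i‖ ^ 2 ≤
        (1 - σ s) * ‖u i‖ ^ 2 + σ s * ‖v i‖ ^ 2 := by
      intro i
      have h1 : (u + (σ s : ℂ) • (v - u)) i = ((1 - σ s : ℝ) : ℂ) * u i + (σ s : ℂ) * v i := by
        simp only [Pi.add_apply, Pi.smul_apply, Pi.sub_apply, smul_eq_mul]
        push_cast; ring
      have h2 : ‖(u + (σ s : ℂ) • (v - u)) i‖ ≤ (1 - σ s) * ‖u i‖ + σ s * ‖v i‖ := by
        rw [h1]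
        refine (norm_add_le _ _).trans (le_of_eq ?_)
        rw [norm_mul, norm_mul, Complex.norm_real, Complex.norm_real, Real.norm_of_nonneg hs0,
          Real.norm_of_nonneg hs1]
      have h3 : ‖(u + (σ s : ℂ) • (v - u)) i‖ ^ 2 ≤ ((1 - σ s) * ‖u i‖ + σ s * ‖v i‖) ^ 2 := by
        gcongr
      have h4 : 0 ≤ (1 - σ s) * σ s * (‖u i‖ - ‖v i‖) ^ 2 := by positivity
      nlinarith
    calc ∑ i, ‖(u + (σ s : ℂ) • (v - u)) i‖ ^ 2
        ≤ ∑ i, ((1 - σ s) * ‖u i‖ ^ 2 + σ s * ‖v i‖ ^ 2) := Finset.sum_le_sum fun i _ => hi i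
      _ = (1 - σ s) * ∑ i, ‖u i‖ ^ 2 + σ s * ∑ i, ‖v i‖ ^ 2 := by
        rw [Finset.sum_add_distrib, Finset.mul_sum, Finset.mul_sum]
      _ < _ := by
        rcases eq_or_lt_of_le hs0 with h0 | h0
        · rw [← h0]; linarith
        · have := mul_lt_mul_of_pos_left h₂' h0
          have := mul_le_mul_of_nonneg_left h₁.le hs1
          linarith
  · have h := ((hσd s).ofReal_comp.smul_const (a • c₂ - c₁)).const_add c₁
    exact h
  · fun_prop
  · simp [σ]
  · simp [σ]

theorem IsSqrtBranch.ne_zero {M : Matrix (Fin g) (Fin g) ℝ} {ρ : (Fin g → ℂ) → ℂ}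
    (hρ : IsSqrtBranch M ρ) {c : Fin g → ℂ} (hc : c ∈ negCone M)
    (hc0 : c ⬝ᵥ (toC M *ᵥ c) ≠ 0) : ρ c ≠ 0 := by
  intro h0
  have := hρ.2 c hc
  rw [h0, zero_pow two_ne_zero] at this
  exact hc0 (neg_eq_zero.1 this.symm)

/-- A branch of the square root is homogeneous of degree one, since `ℂ \ {0}` is connected. -/
theorem IsSqrtBranch.smul {M : Matrix (Fin g) (Fin g) ℝ} {ρ : (Fin g → ℂ) → ℂ}
    (hρ : IsSqrtBranch M ρ) {c : Fin g → ℂ} (hc : c ∈ negCone M)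
    (hc0 : c ⬝ᵥ (toC M *ᵥ c) ≠ 0) {a : ℂ} (ha : a ≠ 0) : ρ (a • c) = a * ρ c := by
  have hconn : IsPreconnected ({0}ᶜ : Set ℂ) :=
    (isConnected_compl_singleton_of_one_lt_rank
      (by simp [Complex.rank_real_complex]) 0).isPreconnected
  refine hconn.eq_of_sq_eq (f := fun a => ρ (a • c)) (g := fun a => a * ρ c) ?_ ?_ ?_ ?_
    (y := 1) (by simp) (by simp) ha
  · exact hρ.1.comp (by fun_prop) fun a ha => smul_mem_negCone hc ha
  · fun_prop
  · intro a ha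
    simp only [Pi.pow_apply]
    rw [hρ.2 _ (smul_mem_negCone hc ha), mul_pow, hρ.2 c hc, Matrix.mulVec_smul, dotProduct_smul,
      smul_dotProduct, smul_eq_mul, smul_eq_mul]
    ring
  · intro a ha
    exact mul_ne_zero ha (hρ.ne_zero hc hc0)

end Cone

/-! ### The incomplete Gaussian along a path in the negative cone -/

section Kernel

variable {g : ℕ}

theorem hasDerivAt_incGauss (α : ℂ) :
    HasDerivAt incGauss (Complex.exp (-Real.pi * α ^ 2)) α := by
  -- `Φ` is a primitive of the entire integrand
  obtain ⟨Φ, hΦ⟩ := Differentiable.isExactOn_univ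
    (f := fun z : ℂ => Complex.exp (-Real.pi * z ^ 2)) (by fun_prop)
  have heq : incGauss = fun α => Φ α - Φ 0 := by
    ext α
    have hd : ∀ x ∈ uIcc (0 : ℝ) 1, HasDerivAt (fun x : ℝ => Φ (α * x))
        (α * Complex.exp (-Real.pi * (α * x) ^ 2)) x := by
      intro x _
      have ht : HasDerivAt (fun t : ℝ => α * (t : ℂ)) α x := by
        simpa using (Complex.ofRealCLM.hasDerivAt (x := x)).const_mul α
      have := (hΦ (α * x) (mem_univ _)).scomp x ht
      simpa [Function.comp_def] using this
    have h := intervalIntegral.integral_eq_sub_of_hasDerivAt hd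
      (Continuous.intervalIntegrable (by fun_prop) _ _)
    rw [intervalIntegral.integral_const_mul] at h
    simpa [incGauss] using h
  rw [heq]
  exact (hΦ α (mem_univ _)).sub_const _

/-- A continuous square root of a differentiable function is differentiable where it does not
vanish. -/
theorem hasDerivAt_of_sq_eq {r Q : ℝ → ℂ} {Q' : ℂ} {s : ℝ} (hr : ContinuousAt r s)
    (hsq : ∀ s, r s ^ 2 = Q s) (h0 : r s ≠ 0) (hQ : HasDerivAt Q Q' s) :
    HasDerivAt r (Q' / (2 * r s)) s := by
  rw [hasDerivAt_iff_tendsto_slope] at hQ ⊢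
  have h1 : Tendsto (fun y => r y + r s) (𝓝[≠] s) (𝓝 (2 * r s)) := by
    have := (hr.add continuousAt_const : ContinuousAt (fun y => r y + r s) s)
    have h := this.tendsto.mono_left (nhdsWithin_le_nhds (s := {s}ᶜ))
    rw [two_mul]
    exact h
  have h2 : 2 * r s ≠ 0 := mul_ne_zero two_ne_zero h0
  refine (hQ.div h1 h2).congr' ?_
  filter_upwards [h1.eventually_ne h2] with y hy
  rw [Pi.div_apply, slope_def_module, slope_def_module, ← hsq, ← hsq, Complex.real_smul,
    Complex.real_smul]
  field_simp
  ring

theorem imMat_transpose {Ω : Matrix (Fin g) (Fin g) ℂ} (hΩ : Ωᵀ = Ω) :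
    (toC (imMat Ω))ᵀ = toC (imMat Ω) := by
  conv_rhs => rw [← hΩ]
  rfl

theorem omegaC_mulVec (Ω : Matrix (Fin g) (Fin g) ℂ) (c x : Fin g → ℂ) :
    omegaC Ω c *ᵥ x = Ω *ᵥ x -
      (2 * Complex.I / (c ⬝ᵥ (toC (imMat Ω) *ᵥ c)) * (c ⬝ᵥ (toC (imMat Ω) *ᵥ x))) •
        (toC (imMat Ω) *ᵥ c) := by
  rw [omegaC, Matrix.sub_mulVec, Matrix.smul_mulVec, ← Matrix.mulVec_mulVec,
    ← Matrix.mulVec_mulVec, Matrix.vecMulVec_mulVec, op_smul_eq_smul, Matrix.mulVec_smul, smul_smul]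

theorem omegaC_transpose {Ω : Matrix (Fin g) (Fin g) ℂ} (hΩ : Ωᵀ = Ω) (c : Fin g → ℂ) :
    (omegaC Ω c)ᵀ = omegaC Ω c := by
  rw [omegaC, Matrix.transpose_sub, Matrix.transpose_smul, Matrix.transpose_mul,
    Matrix.transpose_mul, imMat_transpose hΩ, Matrix.transpose_vecMulVec, hΩ, Matrix.mul_assoc]

theorem omegaC_smul (Ω : Matrix (Fin g) (Fin g) ℂ) (c : Fin g → ℂ) {a : ℂ} (ha : a ≠ 0) :
    omegaC Ω (a • c) = omegaC Ω c := by
  rw [omegaC, omegaC, Matrix.mulVec_smul, dotProduct_smul, smul_dotProduct, Matrix.smul_vecMulVec,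
    Matrix.vecMulVec_smul, Matrix.mul_smul, Matrix.mul_smul, Matrix.smul_mul, Matrix.smul_mul,
    smul_smul, smul_smul, smul_eq_mul, smul_eq_mul]
  congr 2
  by_cases h : c ⬝ᵥ (toC (imMat Ω) *ᵥ c) = 0
  · simp [h]
  · field_simp

/-- The imaginary part of `Ω_c` is positive definite. -/
theorem isPosImag_omegaC {Ω : Matrix (Fin g) (Fin g) ℂ} (hΩ : Ω ∈ siegelHalfSpace g 1)
    {c : Fin g → ℂ} (hc : c ∈ negCone (imMat Ω)) : IsPosImag (omegaC Ω c) := by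
  refine ⟨omegaC_transpose hΩ.1 c, fun x hx => ?_⟩
  have h := HasSignature.sub_re_pos hΩ.2 hc hx
  rw [omegaC_mulVec, dotProduct_sub, dotProduct_smul, Complex.sub_im, im_quadratic,
    dotProduct_mulVec_comm (imMat_transpose hΩ.1) (vecC x) c, smul_eq_mul]
  convert h using 2
  set β := c ⬝ᵥ (toC (imMat Ω) *ᵥ vecC x)
  set γ := c ⬝ᵥ (toC (imMat Ω) *ᵥ c)
  have : 2 * Complex.I / γ * β * β = Complex.I * (((2 : ℝ) : ℂ) * (β ^ 2 / γ)) := by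
    push_cast; ring
  rw [this, Complex.I_mul_im, Complex.re_ofReal_mul]

theorem continuous_omegaC (Ω : Matrix (Fin g) (Fin g) ℂ) {c : ℝ → Fin g → ℂ} (hc : Continuous c)
    (h0 : ∀ s, c s ⬝ᵥ (toC (imMat Ω) *ᵥ c s) ≠ 0) : Continuous fun s => omegaC Ω (c s) := by
  unfold omegaC
  have h1 : Continuous fun s => c s ⬝ᵥ (toC (imMat Ω) *ᵥ c s) :=
    hc.dotProduct (continuous_const.matrix_mulVec hc)
  exact continuous_const.sub (((continuous_const.div h1 h0)).smul
    ((continuous_const.matrix_mul (hc.matrix_vecMulVec hc)).matrix_mul continuous_const))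

theorem continuous_gauss_param {A : ℝ → Matrix (Fin g) (Fin g) ℂ} (hA : Continuous A)
    (x : Fin g → ℝ) : Continuous fun s => gauss (A s) x :=
  continuous_e.comp (continuous_const.mul
    (continuous_const.dotProduct (hA.matrix_mulVec continuous_const)))

/-- The linear form appearing in the derivative of the incomplete Gaussian
`s ↦ E(c(s)ᵀ M x / (r(s) / √2))` along a path `c` with velocity `c'`, where
`r(s)² = -c(s)ᵀ M c(s)`. -/
def slopeForm (Ω : Matrix (Fin g) (Fin g) ℂ) (r : ℂ) (c c' : Fin g → ℂ) : Fin g → ℂ :=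
  (((Real.sqrt 2 : ℝ) : ℂ) / r ^ 3) • (toC (imMat Ω) *ᵥ
    ((c ⬝ᵥ (toC (imMat Ω) *ᵥ c')) • c + r ^ 2 • c'))

theorem hasDerivAt_dotProduct_const {c c' : ℝ → Fin g → ℂ} {s : ℝ} (hc : HasDerivAt c (c' s) s)
    (v : Fin g → ℂ) : HasDerivAt (fun s => c s ⬝ᵥ v) (c' s ⬝ᵥ v) s := by
  simp only [dotProduct]
  exact HasDerivAt.fun_sum fun i _ => (hasDerivAt_pi.1 hc i).mul_const _

theorem hasDerivAt_mulVec (B : Matrix (Fin g) (Fin g) ℂ) {c c' : ℝ → Fin g → ℂ} {s : ℝ}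
    (hc : HasDerivAt c (c' s) s) : HasDerivAt (fun s => B *ᵥ c s) (B *ᵥ c' s) s := by
  rw [hasDerivAt_pi]
  intro i
  have := hasDerivAt_dotProduct_const hc (B i)
  simp only [Matrix.mulVec, dotProduct_comm (B i)]
  exact this

theorem hasDerivAt_quadratic {M : Matrix (Fin g) (Fin g) ℂ} (hM : Mᵀ = M) {c c' : ℝ → Fin g → ℂ}
    {s : ℝ} (hc : HasDerivAt c (c' s) s) :
    HasDerivAt (fun s => c s ⬝ᵥ (M *ᵥ c s)) (2 * (c s ⬝ᵥ (M *ᵥ c' s))) s := by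
  have h1 := hasDerivAt_mulVec M hc
  have h2 : HasDerivAt (fun s => c s ⬝ᵥ (M *ᵥ c s))
      (∑ i, (c' s i * (M *ᵥ c s) i + c s i * (M *ᵥ c' s) i)) s := by
    simp only [dotProduct]
    exact HasDerivAt.fun_sum fun i _ => (hasDerivAt_pi.1 hc i).mul (hasDerivAt_pi.1 h1 i)
  refine h2.congr_deriv ?_
  rw [Finset.sum_add_distrib, two_mul]
  change c' s ⬝ᵥ (M *ᵥ c s) + c s ⬝ᵥ (M *ᵥ c' s) = _
  rw [dotProduct_mulVec_comm hM]

/-- The function on `ℝ^g` whose values at the lattice points give the terms of the theta series,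
for one vector `c`. -/
def thetaKernel (ρ : (Fin g → ℂ) → ℂ) (Ω : Matrix (Fin g) (Fin g) ℂ) (c : Fin g → ℂ)
    (x : Fin g → ℝ) : ℂ :=
  incGauss ((c ⬝ᵥ (toC (imMat Ω) *ᵥ vecC x)) / (ρ c / ((Real.sqrt 2 : ℝ) : ℂ))) * gauss Ω x

/-- The Gaussian of `Ω_c` is that of `Ω` times the derivative of the incomplete Gaussian at the
argument used in the kernel. -/
theorem gauss_omegaC {Ω : Matrix (Fin g) (Fin g) ℂ} (hΩ : Ωᵀ = Ω) {c : Fin g → ℂ} {r : ℂ}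
    (hr : r ^ 2 = -(c ⬝ᵥ (toC (imMat Ω) *ᵥ c))) (hr0 : r ≠ 0) (x : Fin g → ℝ) :
    gauss (omegaC Ω c) x = Complex.exp (-Real.pi *
      ((c ⬝ᵥ (toC (imMat Ω) *ᵥ vecC x)) / (r / ((Real.sqrt 2 : ℝ) : ℂ))) ^ 2) * gauss Ω x := by
  have h2 : ((Real.sqrt 2 : ℝ) : ℂ) ^ 2 = 2 := by
    rw [← Complex.ofReal_pow, Real.sq_sqrt (by norm_num)]; norm_num
  rw [gauss, gauss, e, e, ← Complex.exp_add, omegaC_mulVec, dotProduct_sub, dotProduct_smul,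
    dotProduct_mulVec_comm (imMat_transpose hΩ) (vecC x) c, smul_eq_mul,
    show c ⬝ᵥ (toC (imMat Ω) *ᵥ c) = -r ^ 2 by rw [hr, neg_neg], div_div_eq_mul_div, div_pow,
    mul_pow,
    h2]
  congr 1
  field_simp
  linear_combination (2 * (c ⬝ᵥ (toC (imMat Ω) *ᵥ vecC x)) ^ 2) * Complex.I_sq

theorem hasDerivAt_thetaKernel {Ω : Matrix (Fin g) (Fin g) ℂ} (hΩ : Ωᵀ = Ω)
    {ρ : (Fin g → ℂ) → ℂ} {c c' : ℝ → Fin g → ℂ} {s : ℝ} (hc : HasDerivAt c (c' s) s)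
    (hρc : ContinuousAt (fun s => ρ (c s)) s)
    (hρ : ∀ s, ρ (c s) ^ 2 = -(c s ⬝ᵥ (toC (imMat Ω) *ᵥ c s))) (hρ0 : ρ (c s) ≠ 0)
    (x : Fin g → ℝ) :
    HasDerivAt (fun s => thetaKernel ρ Ω (c s) x)
      ((slopeForm Ω (ρ (c s)) (c s) (c' s) ⬝ᵥ vecC x) * gauss (omegaC Ω (c s)) x) s := by
  have hM := imMat_transpose hΩ
  have hs2 : ((Real.sqrt 2 : ℝ) : ℂ) ≠ 0 := by
    exact_mod_cast (Real.sqrt_pos.2 (by norm_num : (0 : ℝ) < 2)).ne'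
  have hQ : HasDerivAt (fun s => -(c s ⬝ᵥ (toC (imMat Ω) *ᵥ c s)))
      (-(2 * (c s ⬝ᵥ (toC (imMat Ω) *ᵥ c' s)))) s := (hasDerivAt_quadratic hM hc).fun_neg
  have hr : HasDerivAt (fun s => ρ (c s))
      (-(2 * (c s ⬝ᵥ (toC (imMat Ω) *ᵥ c' s))) / (2 * ρ (c s))) s :=
    hasDerivAt_of_sq_eq hρc hρ hρ0 hQ
  have hnum : HasDerivAt (fun s => c s ⬝ᵥ (toC (imMat Ω) *ᵥ vecC x))
      (c' s ⬝ᵥ (toC (imMat Ω) *ᵥ vecC x)) s := hasDerivAt_dotProduct_const hc _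
  have harg := hnum.fun_div (hr.div_const ((Real.sqrt 2 : ℝ) : ℂ)) (div_ne_zero hρ0 hs2)
  have hE := (hasDerivAt_incGauss
    ((c s ⬝ᵥ (toC (imMat Ω) *ᵥ vecC x)) / (ρ (c s) / ((Real.sqrt 2 : ℝ) : ℂ)))).scomp s harg
  refine (hE.mul_const (gauss Ω x)).congr_deriv ?_
  have hlin : slopeForm Ω (ρ (c s)) (c s) (c' s) ⬝ᵥ vecC x =
      ((Real.sqrt 2 : ℝ) : ℂ) / ρ (c s) ^ 3 *
        ((c s ⬝ᵥ (toC (imMat Ω) *ᵥ c' s)) * (c s ⬝ᵥ (toC (imMat Ω) *ᵥ vecC x)) +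
          ρ (c s) ^ 2 * (c' s ⬝ᵥ (toC (imMat Ω) *ᵥ vecC x))) := by
    rw [slopeForm, smul_dotProduct, Matrix.mulVec_add, Matrix.mulVec_smul,
      Matrix.mulVec_smul, add_dotProduct, smul_dotProduct, smul_dotProduct,
      dotProduct_comm _ (vecC x), dotProduct_comm _ (vecC x), dotProduct_mulVec_comm hM (vecC x),
      dotProduct_mulVec_comm hM (vecC x), smul_eq_mul, smul_eq_mul, smul_eq_mul]
  rw [gauss_omegaC hΩ (hρ s) hρ0, hlin, smul_eq_mul]
  generalize c s ⬝ᵥ (toC (imMat Ω) *ᵥ c' s) = u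
  generalize c s ⬝ᵥ (toC (imMat Ω) *ᵥ vecC x) = v
  generalize c' s ⬝ᵥ (toC (imMat Ω) *ᵥ vecC x) = w
  generalize Complex.exp _ = E
  generalize gauss Ω x = G
  generalize ρ (c s) = r at hρ0 ⊢
  field_simp
  ring

theorem continuous_slopeForm (Ω : Matrix (Fin g) (Fin g) ℂ) {r : ℝ → ℂ} {c c' : ℝ → Fin g → ℂ}
    (hr : Continuous r) (hr0 : ∀ s, r s ≠ 0) (hc : Continuous c) (hc' : Continuous c') :
    Continuous fun s => slopeForm Ω (r s) (c s) (c' s) := by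
  have h1 : Continuous fun s => (c s ⬝ᵥ (toC (imMat Ω) *ᵥ c' s)) • c s + r s ^ 2 • c' s :=
    ((hc.dotProduct (continuous_const.matrix_mulVec hc')).smul hc).add ((hr.pow 2).smul hc')
  exact (continuous_const.div (hr.pow 3) fun s => pow_ne_zero _ (hr0 s)).smul
    (continuous_const.matrix_mulVec h1)

/-- Fundamental theorem of calculus along a path: the difference of the kernels at the end points
is an average of Gaussians with linear factors. -/
theorem thetaKernel_sub_eq_gaussAverage {Ω : Matrix (Fin g) (Fin g) ℂ} (hΩ : Ωᵀ = Ω)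
    {ρ : (Fin g → ℂ) → ℂ} {c c' : ℝ → Fin g → ℂ} (hc : ∀ s, HasDerivAt c (c' s) s)
    (hc' : Continuous c') (hρc : Continuous fun s => ρ (c s))
    (hρ : ∀ s, ρ (c s) ^ 2 = -(c s ⬝ᵥ (toC (imMat Ω) *ᵥ c s))) (hρ0 : ∀ s, ρ (c s) ≠ 0)
    (x : Fin g → ℝ) :
    thetaKernel ρ Ω (c 1) x - thetaKernel ρ Ω (c 0) x =
      gaussAverage (fun s => omegaC Ω (c s)) (fun s => slopeForm Ω (ρ (c s)) (c s) (c' s)) x := by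
  have hcc : Continuous c := continuous_iff_continuousAt.2 fun s => (hc s).continuousAt
  have hne : ∀ s, c s ⬝ᵥ (toC (imMat Ω) *ᵥ c s) ≠ 0 := fun s h => by
    have := hρ s
    rw [h, neg_zero] at this
    exact hρ0 s (pow_eq_zero_iff two_ne_zero |>.1 this)
  have h1 : Continuous fun s => slopeForm Ω (ρ (c s)) (c s) (c' s) ⬝ᵥ vecC x :=
    (continuous_slopeForm Ω hρc hρ0 hcc hc').dotProduct continuous_const
  have h2 : Continuous fun s => gauss (omegaC Ω (c s)) x :=
    continuous_gauss_param (continuous_omegaC Ω hcc hne) x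
  rw [gaussAverage, intervalIntegral.integral_eq_sub_of_hasDerivAt
    (fun s _ => hasDerivAt_thetaKernel hΩ (hc s) hρc.continuousAt hρ (hρ0 s) x)
    ((h1.mul h2).intervalIntegrable _ _)]

end Kernel

/-! ### Duality `Ω ↦ -Ω⁻¹`, `c ↦ Ω̄ c` -/

section Dual

variable {g : ℕ} {Ω : Matrix (Fin g) (Fin g) ℂ}

theorem conjMat_eq (Ω : Matrix (Fin g) (Fin g) ℂ) :
    conjMat Ω = Ω - (2 * Complex.I) • toC (imMat Ω) := by
  ext i j
  simp only [conjMat, toC, imMat, Matrix.sub_apply, Matrix.smul_apply, Matrix.map_apply,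
    smul_eq_mul]
  apply Complex.ext <;> simp
  ring

theorem conjMat_mul (A B : Matrix (Fin g) (Fin g) ℂ) : conjMat (A * B) = conjMat A * conjMat B :=
  Matrix.map_mul (f := starRingEnd ℂ)

theorem conjMat_one : conjMat (1 : Matrix (Fin g) (Fin g) ℂ) = 1 :=
  Matrix.map_one _ (by simp) (by simp)

theorem toC_imMat_neg_inv_mul_conjMat (hdet : Ω.det ≠ 0) :
    toC (imMat (-Ω⁻¹)) * conjMat Ω = Ω⁻¹ * toC (imMat Ω) := by
  have hu : IsUnit Ω.det := isUnit_iff_ne_zero.2 hdet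
  have h1 : (2 * Complex.I) • toC (imMat (-Ω⁻¹)) = conjMat Ω⁻¹ - Ω⁻¹ := by
    rw [conjMat_eq]
    ext i j
    simp [toC, imMat]
  have h2 : conjMat Ω⁻¹ * conjMat Ω = 1 := by
    rw [← conjMat_mul, Matrix.nonsing_inv_mul _ hu, conjMat_one]
  have h3 : (2 * Complex.I) • (toC (imMat (-Ω⁻¹)) * conjMat Ω) =
      (2 * Complex.I) • (Ω⁻¹ * toC (imMat Ω)) := by
    rw [← Matrix.smul_mul, h1, Matrix.sub_mul, h2, conjMat_eq, Matrix.mul_sub,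
      Matrix.nonsing_inv_mul _ hu, Matrix.mul_smul, sub_sub_cancel]
  exact smul_right_injective _ (mul_ne_zero two_ne_zero Complex.I_ne_zero) h3

theorem toC_imMat_neg_inv_mulVec (hdet : Ω.det ≠ 0) (w : Fin g → ℂ) :
    toC (imMat (-Ω⁻¹)) *ᵥ (conjMat Ω *ᵥ w) = Ω⁻¹ *ᵥ (toC (imMat Ω) *ᵥ w) := by
  rw [Matrix.mulVec_mulVec, toC_imMat_neg_inv_mul_conjMat hdet, Matrix.mulVec_mulVec]

theorem mulVec_dotProduct_inv_mulVec (hΩ : Ωᵀ = Ω) (hdet : Ω.det ≠ 0) (x y : Fin g → ℂ) :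
    (Ω *ᵥ x) ⬝ᵥ (Ω⁻¹ *ᵥ y) = x ⬝ᵥ y := by
  rw [dotProduct_comm, dotProduct_mulVec_comm hΩ, Matrix.mulVec_mulVec,
    Matrix.mul_nonsing_inv _ (isUnit_iff_ne_zero.2 hdet), Matrix.one_mulVec]

theorem conjMat_mulVec_dotProduct (hΩ : Ωᵀ = Ω) (hdet : Ω.det ≠ 0) (c y : Fin g → ℂ) :
    (conjMat Ω *ᵥ c) ⬝ᵥ (Ω⁻¹ *ᵥ y) =
      c ⬝ᵥ y - 2 * Complex.I * ((toC (imMat Ω) *ᵥ c) ⬝ᵥ (Ω⁻¹ *ᵥ y)) := by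
  rw [conjMat_eq, Matrix.sub_mulVec, Matrix.smul_mulVec, sub_dotProduct, smul_dotProduct,
    mulVec_dotProduct_inv_mulVec hΩ hdet, smul_eq_mul]

theorem conjMat_mulVec_mem_negCone (hΩ : Ωᵀ = Ω) (hdet : Ω.det ≠ 0) {c : Fin g → ℂ}
    (hc : c ∈ negCone (imMat Ω)) : conjMat Ω *ᵥ c ∈ negCone (imMat (-Ω⁻¹)) := by
  change (star (conjMat Ω *ᵥ c) ⬝ᵥ (toC (imMat (-Ω⁻¹)) *ᵥ (conjMat Ω *ᵥ c))).re < 0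
  have h1 : star (conjMat Ω *ᵥ c) = Ω *ᵥ star c := by
    ext i; simp [Matrix.mulVec, dotProduct, conjMat]
  rw [toC_imMat_neg_inv_mulVec hdet, h1, mulVec_dotProduct_inv_mulVec hΩ hdet]
  exact hc

theorem neg_inv_transpose (hΩ : Ωᵀ = Ω) : (-Ω⁻¹)ᵀ = -Ω⁻¹ := by
  rw [Matrix.transpose_neg, Matrix.transpose_nonsing_inv, hΩ]

/-- The form `M' = Im(-Ω⁻¹)` at the vectors `Ω̄ c` and `Ω̄ w`, in terms of `M = Im Ω`. -/
theorem dual_quadratic (hΩ : Ωᵀ = Ω) (hdet : Ω.det ≠ 0) (c w : Fin g → ℂ) :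
    (conjMat Ω *ᵥ c) ⬝ᵥ (toC (imMat (-Ω⁻¹)) *ᵥ (conjMat Ω *ᵥ w)) =
      c ⬝ᵥ (toC (imMat Ω) *ᵥ w) -
        2 * Complex.I * ((toC (imMat Ω) *ᵥ c) ⬝ᵥ (Ω⁻¹ *ᵥ (toC (imMat Ω) *ᵥ w))) := by
  rw [toC_imMat_neg_inv_mulVec hdet, conjMat_mulVec_dotProduct hΩ hdet]

theorem omegaC_mulVec_inv (hΩ : Ωᵀ = Ω) (hdet : Ω.det ≠ 0) (c y : Fin g → ℂ) :
    omegaC Ω c *ᵥ (Ω⁻¹ *ᵥ y) = y -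
      (2 * Complex.I / (c ⬝ᵥ (toC (imMat Ω) *ᵥ c)) *
        ((toC (imMat Ω) *ᵥ c) ⬝ᵥ (Ω⁻¹ *ᵥ y))) • (toC (imMat Ω) *ᵥ c) := by
  rw [omegaC_mulVec, Matrix.mulVec_mulVec y, Matrix.mul_nonsing_inv _ (isUnit_iff_ne_zero.2 hdet),
    Matrix.one_mulVec, dotProduct_mulVec_comm (imMat_transpose hΩ) c (Ω⁻¹ *ᵥ y),
    dotProduct_comm (Ω⁻¹ *ᵥ y)]

/-- If `M'` vanished at `Ω̄ c`, the vector `Ω⁻¹ M c` would lie in the kernel of `Ω_c`. -/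
theorem dual_quadratic_ne_zero (hΩ : Ωᵀ = Ω) (hdet : Ω.det ≠ 0) {c : Fin g → ℂ}
    (hA : (omegaC Ω c).det ≠ 0) (hγ : c ⬝ᵥ (toC (imMat Ω) *ᵥ c) ≠ 0) :
    (conjMat Ω *ᵥ c) ⬝ᵥ (toC (imMat (-Ω⁻¹)) *ᵥ (conjMat Ω *ᵥ c)) ≠ 0 := by
  rw [dual_quadratic hΩ hdet]
  set u := toC (imMat Ω) *ᵥ c with hu
  intro h0
  have h1 : omegaC Ω c *ᵥ (Ω⁻¹ *ᵥ u) = 0 := by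
    rw [omegaC_mulVec_inv hΩ hdet, ← hu]
    have : 2 * Complex.I / (c ⬝ᵥ u) * (u ⬝ᵥ (Ω⁻¹ *ᵥ u)) = 1 := by
      rw [div_mul_eq_mul_div, div_eq_one_iff_eq hγ]
      exact (sub_eq_zero.1 h0).symm
    rw [this, one_smul, sub_self]
  have h2 := Matrix.eq_zero_of_mulVec_eq_zero hA h1
  have h3 := Matrix.eq_zero_of_mulVec_eq_zero (Matrix.isUnit_nonsing_inv_det _
    (isUnit_iff_ne_zero.2 hdet)).ne_zero h2
  exact hγ (by rw [h3, dotProduct_zero])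

/-- Passing to `-Ω⁻¹` and `Ω̄ c` commutes with completing `Ω` to `Ω_c`. -/
theorem neg_omegaC_inv (hΩ : Ωᵀ = Ω) (hdet : Ω.det ≠ 0) {c : Fin g → ℂ}
    (hA : (omegaC Ω c).det ≠ 0) (hγ : c ⬝ᵥ (toC (imMat Ω) *ᵥ c) ≠ 0) :
    -(omegaC Ω c)⁻¹ = omegaC (-Ω⁻¹) (conjMat Ω *ᵥ c) := by
  have hγ' := dual_quadratic_ne_zero hΩ hdet hA hγ
  have hmul : omegaC Ω c * -omegaC (-Ω⁻¹) (conjMat Ω *ᵥ c) = 1 := by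
    refine Matrix.mulVec_injective (funext fun y => ?_)
    rw [Matrix.one_mulVec, ← Matrix.mulVec_mulVec, Matrix.neg_mulVec, Matrix.mulVec_neg,
      omegaC_mulVec (-Ω⁻¹), dotProduct_mulVec_comm (imMat_transpose (neg_inv_transpose hΩ)) _ y]
    rw [dual_quadratic hΩ hdet] at hγ' ⊢
    rw [toC_imMat_neg_inv_mulVec hdet, Matrix.neg_mulVec, Matrix.mulVec_sub, Matrix.mulVec_neg,
      Matrix.mulVec_smul, omegaC_mulVec_inv hΩ hdet, omegaC_mulVec_inv hΩ hdet]
    have hOinv : (Ω⁻¹)ᵀ = Ω⁻¹ := by rw [Matrix.transpose_nonsing_inv, hΩ]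
    set u := toC (imMat Ω) *ᵥ c with hu
    rw [dotProduct_mulVec_comm hOinv y u]
    set γ := c ⬝ᵥ u
    set θ := u ⬝ᵥ (Ω⁻¹ *ᵥ u)
    set τ := u ⬝ᵥ (Ω⁻¹ *ᵥ y)
    ext i
    simp only [Pi.neg_apply, Pi.sub_apply, Pi.smul_apply, smul_eq_mul]
    field_simp
    ring
  rw [Matrix.inv_eq_right_inv hmul, neg_neg]

/-- The matrix determinant lemma for the rank one modification `Ω_c` of `Ω`. -/
theorem det_omegaC (hΩ : Ωᵀ = Ω) (hdet : Ω.det ≠ 0) {c : Fin g → ℂ}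
    (hγ : c ⬝ᵥ (toC (imMat Ω) *ᵥ c) ≠ 0) :
    (omegaC Ω c).det * (c ⬝ᵥ (toC (imMat Ω) *ᵥ c)) =
      Ω.det * ((conjMat Ω *ᵥ c) ⬝ᵥ (toC (imMat (-Ω⁻¹)) *ᵥ (conjMat Ω *ᵥ c))) := by
  rw [dual_quadratic hΩ hdet]
  set u := toC (imMat Ω) *ᵥ c with hu
  have h1 : omegaC Ω c = Ω + Matrix.vecMulVec (-(2 * Complex.I / (c ⬝ᵥ u)) • u) u := by
    rw [omegaC, ← hu, Matrix.mul_vecMulVec, Matrix.vecMulVec_mul, ← hu,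
      ← Matrix.mulVec_transpose, imMat_transpose hΩ, ← hu, Matrix.smul_vecMulVec, neg_smul,
      sub_eq_add_neg]
  rw [h1, Matrix.vecMulVec_eq Unit, Matrix.det_add_replicateCol_mul_replicateRow
    (isUnit_iff_ne_zero.2 hdet), Matrix.det_unique (n := Unit), Matrix.add_apply,
    Matrix.one_apply_eq,
    ← Matrix.replicateRow_vecMul, Matrix.replicateRow_mul_replicateCol_apply,
    ← Matrix.dotProduct_mulVec, Matrix.mulVec_smul, dotProduct_smul, smul_eq_mul]
  field_simp
  ring

/-- `Ω_c⁻¹` carries the linear form of the derivative to the one for the dual data, up to the ratio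
of the square roots. -/
theorem omegaC_inv_mulVec_slopeForm (hΩ : Ωᵀ = Ω) (hdet : Ω.det ≠ 0) {c : Fin g → ℂ}
    (c' : Fin g → ℂ) (hA : (omegaC Ω c).det ≠ 0) {r r' : ℂ} (hr0 : r ≠ 0) (hr0' : r' ≠ 0)
    (hr : r ^ 2 = -(c ⬝ᵥ (toC (imMat Ω) *ᵥ c)))
    (hr' : r' ^ 2 = -((conjMat Ω *ᵥ c) ⬝ᵥ (toC (imMat (-Ω⁻¹)) *ᵥ (conjMat Ω *ᵥ c)))) :
    (omegaC Ω c)⁻¹ *ᵥ slopeForm Ω r c c' =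
      (r' / r) • slopeForm (-Ω⁻¹) r' (conjMat Ω *ᵥ c) (conjMat Ω *ᵥ c') := by
  -- both sides are combinations of `M c` and `M c'`, and `r² = -cᵀ M c` relates the coefficients
  have key : slopeForm Ω r c c' = omegaC Ω c *ᵥ
      ((r' / r) • slopeForm (-Ω⁻¹) r' (conjMat Ω *ᵥ c) (conjMat Ω *ᵥ c')) := by
    rw [slopeForm, slopeForm, Matrix.mulVec_add, Matrix.mulVec_add, Matrix.mulVec_smul,
      Matrix.mulVec_smul, Matrix.mulVec_smul, Matrix.mulVec_smul, Matrix.mulVec_smul,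
      Matrix.mulVec_smul, toC_imMat_neg_inv_mulVec hdet, toC_imMat_neg_inv_mulVec hdet,
      conjMat_mulVec_dotProduct hΩ hdet, Matrix.mulVec_add, Matrix.mulVec_smul, Matrix.mulVec_smul,
      omegaC_mulVec_inv hΩ hdet, omegaC_mulVec_inv hΩ hdet]
    rw [dual_quadratic hΩ hdet] at hr'
    set u := toC (imMat Ω) *ᵥ c with hu
    set v := toC (imMat Ω) *ᵥ c' with hv
    have hγ : c ⬝ᵥ u = -r ^ 2 := by rw [hr, neg_neg]
    rw [hγ] at hr' ⊢
    set θ := u ⬝ᵥ (Ω⁻¹ *ᵥ u)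
    set η := u ⬝ᵥ (Ω⁻¹ *ᵥ v)
    set κ := c ⬝ᵥ v
    ext i
    simp only [Pi.add_apply, Pi.sub_apply, Pi.smul_apply, smul_eq_mul]
    have hθ : 2 * Complex.I * θ = r' ^ 2 - r ^ 2 := by linear_combination -hr'
    field_simp
    linear_combination (-(u i * (κ - 2 * Complex.I * η))) * hθ
  rw [key, Matrix.mulVec_mulVec, Matrix.nonsing_inv_mul _ (isUnit_iff_ne_zero.2 hA),
    Matrix.one_mulVec]

end Dual

/-! ### The square root of `det(-iΩ)` and the Fourier transform of the theta kernel -/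

section Fourier

variable {g : ℕ} {Ω : Matrix (Fin g) (Fin g) ℂ} {ρ ρ' : (Fin g → ℂ) → ℂ}

theorem thetaKernel_smul (hρ : IsSqrtBranch (imMat Ω) ρ) {c : Fin g → ℂ}
    (hc : c ∈ negCone (imMat Ω)) (hc0 : c ⬝ᵥ (toC (imMat Ω) *ᵥ c) ≠ 0) {a : ℂ} (ha : a ≠ 0)
    (x : Fin g → ℝ) : thetaKernel ρ Ω (a • c) x = thetaKernel ρ Ω c x := by
  rw [thetaKernel, thetaKernel, hρ.smul hc hc0 ha, smul_dotProduct, smul_eq_mul,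
    mul_div_assoc a (ρ c), mul_div_mul_left _ _ ha]

theorem dual_ne_zero (hΩ : Ω ∈ siegelHalfSpace g 1) (hdet : Ω.det ≠ 0) {c : Fin g → ℂ}
    (hc : c ∈ negCone (imMat Ω)) :
    (conjMat Ω *ᵥ c) ⬝ᵥ (toC (imMat (-Ω⁻¹)) *ᵥ (conjMat Ω *ᵥ c)) ≠ 0 :=
  dual_quadratic_ne_zero hΩ.1 hdet (isPosImag_omegaC hΩ hc).det_ne_zero
    (HasSignature.quadratic_ne_zero hΩ.2 hc)

theorem sqrtDet_sq (hΩ : Ω ∈ siegelHalfSpace g 1) (hdet : Ω.det ≠ 0)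
    (hρ : IsSqrtBranch (imMat Ω) ρ) (hρ' : IsSqrtBranch (imMat (-Ω⁻¹)) ρ') {c : Fin g → ℂ}
    (hc : c ∈ negCone (imMat Ω)) : sqrtDet ρ ρ' c Ω ^ 2 = (-Complex.I • Ω).det := by
  have hA := isPosImag_omegaC hΩ hc
  have hγ := HasSignature.quadratic_ne_zero hΩ.2 hc
  have hγ' := dual_ne_zero hΩ hdet hc
  have h1 := hA.det_mul_integral_gauss_sq
  have h2 := det_omegaC hΩ.1 hdet hγ
  rw [sqrtDet, div_pow, mul_pow, hρ.2 c hc, hρ'.2 _ (conjMat_mulVec_mem_negCone hΩ.1 hdet hc),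
    sqrtDetDefinite_eq, inv_pow]
  rw [Matrix.det_smul] at h1 ⊢
  have hI := hA.integral_gauss_ne_zero
  set γ := c ⬝ᵥ (toC (imMat Ω) *ᵥ c)
  set γ' := (conjMat Ω *ᵥ c) ⬝ᵥ (toC (imMat (-Ω⁻¹)) *ᵥ (conjMat Ω *ᵥ c))
  set J := ∫ x, gauss (omegaC Ω c) x
  field_simp
  linear_combination (-γ) * h1 + (-Complex.I) ^ Fintype.card (Fin g) * J ^ 2 * h2

theorem sqrtDet_smul (hΩ : Ω ∈ siegelHalfSpace g 1) (hdet : Ω.det ≠ 0)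
    (hρ : IsSqrtBranch (imMat Ω) ρ) (hρ' : IsSqrtBranch (imMat (-Ω⁻¹)) ρ') {c : Fin g → ℂ}
    (hc : c ∈ negCone (imMat Ω)) {a : ℂ} (ha : a ≠ 0) :
    sqrtDet ρ ρ' (a • c) Ω = sqrtDet ρ ρ' c Ω := by
  rw [sqrtDet, sqrtDet, omegaC_smul Ω c ha, hρ.smul hc (HasSignature.quadratic_ne_zero hΩ.2 hc) ha,
    Matrix.mulVec_smul, hρ'.smul (conjMat_mulVec_mem_negCone hΩ.1 hdet hc)
      (dual_ne_zero hΩ hdet hc) ha, mul_assoc, mul_div_mul_left _ _ ha]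

theorem continuous_mulVec_comp (B : Matrix (Fin g) (Fin g) ℂ) {c : ℝ → Fin g → ℂ}
    (hc : Continuous c) : Continuous fun s => B *ᵥ c s :=
  continuous_const.matrix_mulVec hc

/-- The square root of `det(-iΩ)` is constant along paths: it is continuous and its square is
constant and nonzero. -/
theorem sqrtDet_path_const (hΩ : Ω ∈ siegelHalfSpace g 1) (hdet : Ω.det ≠ 0)
    (hρ : IsSqrtBranch (imMat Ω) ρ) (hρ' : IsSqrtBranch (imMat (-Ω⁻¹)) ρ') {c : ℝ → Fin g → ℂ}
    (hcc : Continuous c) (hc : ∀ s, c s ∈ negCone (imMat Ω)) (s t : ℝ) :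
    sqrtDet ρ ρ' (c s) Ω = sqrtDet ρ ρ' (c t) Ω := by
  have hdet' : (-Complex.I • Ω).det ≠ 0 := by
    rw [Matrix.det_smul]
    exact mul_ne_zero (pow_ne_zero _ (neg_ne_zero.2 Complex.I_ne_zero)) hdet
  have hcont : Continuous fun s => sqrtDet ρ ρ' (c s) Ω := by
    have h1 : Continuous fun s => ρ (c s) := hρ.1.comp_continuous hcc hc
    have h2 : Continuous fun s => ρ' (conjMat Ω *ᵥ c s) :=
      hρ'.1.comp_continuous (continuous_mulVec_comp _ hcc) fun s =>
        conjMat_mulVec_mem_negCone hΩ.1 hdet (hc s)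
    have h3 : Continuous fun s => sqrtDetDefinite (omegaC Ω (c s)) := by
      simp only [sqrtDetDefinite_eq]
      exact (continuous_integral_gauss (continuous_omegaC Ω hcc fun s =>
        HasSignature.quadratic_ne_zero hΩ.2 (hc s)) fun s => isPosImag_omegaC hΩ (hc s)).inv₀
          fun s => (isPosImag_omegaC hΩ (hc s)).integral_gauss_ne_zero
    exact (h1.mul h3).div h2 fun s => hρ'.ne_zero (conjMat_mulVec_mem_negCone hΩ.1 hdet (hc s))
      (dual_ne_zero hΩ hdet (hc s))
  have hsq : ∀ s, sqrtDet ρ ρ' (c s) Ω ^ 2 = (-Complex.I • Ω).det := fun s =>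
    sqrtDet_sq hΩ hdet hρ hρ' (hc s)
  refine isPreconnected_univ.eq_of_sq_eq (f := fun s => sqrtDet ρ ρ' (c s) Ω)
    (g := fun _ => sqrtDet ρ ρ' (c t) Ω) hcont.continuousOn continuousOn_const ?_ ?_
    (mem_univ t) rfl (mem_univ s)
  · intro y _
    simp only [Pi.pow_apply, hsq]
  · intro y _ h0
    have := hsq t
    rw [h0, zero_pow two_ne_zero] at this
    exact hdet' this.symm

theorem sqrtDet_eq (hΩ : Ω ∈ siegelHalfSpace g 1) (hdet : Ω.det ≠ 0)
    (hρ : IsSqrtBranch (imMat Ω) ρ) (hρ' : IsSqrtBranch (imMat (-Ω⁻¹)) ρ') {c d : Fin g → ℂ}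
    (hc : c ∈ negCone (imMat Ω)) (hd : d ∈ negCone (imMat Ω)) :
    sqrtDet ρ ρ' c Ω = sqrtDet ρ ρ' d Ω := by
  obtain ⟨a, γ, γ', ha, hγ, hγd, -, h0, h1⟩ := HasSignature.exists_path hΩ.2 hc hd
  have hcc : Continuous γ := continuous_iff_continuousAt.2 fun s => (hγd s).continuousAt
  have := sqrtDet_path_const hΩ hdet hρ hρ' hcc hγ 0 1
  rwa [h0, h1, sqrtDet_smul hΩ hdet hρ hρ' hd ha] at this

/-- The difference of the theta kernels at `c₁` and `c₂` is a Gaussian average; when `Ω` is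
invertible, its Fourier transform is the corresponding difference for the dual data. -/
theorem exists_gaussAverage_eq (hΩ : Ω ∈ siegelHalfSpace g 1) (hρ : IsSqrtBranch (imMat Ω) ρ)
    {c₁ c₂ : Fin g → ℂ} (hc₁ : c₁ ∈ negCone (imMat Ω)) (hc₂ : c₂ ∈ negCone (imMat Ω)) :
    ∃ (A : ℝ → Matrix (Fin g) (Fin g) ℂ) (l : ℝ → Fin g → ℂ), Continuous A ∧
      (∀ s, IsPosImag (A s)) ∧ Continuous l ∧
      (fun x => thetaKernel ρ Ω c₂ x - thetaKernel ρ Ω c₁ x) = gaussAverage A l ∧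
      (Ω.det ≠ 0 → ∀ ρ' : (Fin g → ℂ) → ℂ, IsSqrtBranch (imMat (-Ω⁻¹)) ρ' →
        ∀ c ∈ negCone (imMat Ω), ∀ ξ, fourierPi (gaussAverage A l) ξ =
          (sqrtDet ρ ρ' c Ω)⁻¹ * (thetaKernel ρ' (-Ω⁻¹) (conjMat Ω *ᵥ c₂) ξ -
            thetaKernel ρ' (-Ω⁻¹) (conjMat Ω *ᵥ c₁) ξ)) := by
  obtain ⟨a, c, c', ha, hc, hcd, hc', h0, h1⟩ := HasSignature.exists_path hΩ.2 hc₁ hc₂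
  have hcc : Continuous c := continuous_iff_continuousAt.2 fun s => (hcd s).continuousAt
  have hγ : ∀ s, c s ⬝ᵥ (toC (imMat Ω) *ᵥ c s) ≠ 0 := fun s =>
    HasSignature.quadratic_ne_zero hΩ.2 (hc s)
  have hρc : Continuous fun s => ρ (c s) := hρ.1.comp_continuous hcc hc
  have hρ0 : ∀ s, ρ (c s) ≠ 0 := fun s => hρ.ne_zero (hc s) (hγ s)
  have hA := continuous_omegaC Ω hcc hγ
  have hpos : ∀ s, IsPosImag (omegaC Ω (c s)) := fun s => isPosImag_omegaC hΩ (hc s)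
  have hl := continuous_slopeForm Ω hρc hρ0 hcc hc'
  refine ⟨fun s => omegaC Ω (c s), fun s => slopeForm Ω (ρ (c s)) (c s) (c' s), hA, hpos, hl,
    ?_, ?_⟩
  · ext x
    rw [← thetaKernel_sub_eq_gaussAverage hΩ.1 hcd hc' hρc (fun s => hρ.2 _ (hc s)) hρ0, h0, h1,
      thetaKernel_smul hρ hc₂ (HasSignature.quadratic_ne_zero hΩ.2 hc₂) ha]
  · intro hdet ρ' hρ' d hd ξ
    have hc'' : ∀ s, conjMat Ω *ᵥ c s ∈ negCone (imMat (-Ω⁻¹)) := fun s =>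
      conjMat_mulVec_mem_negCone hΩ.1 hdet (hc s)
    have hcd' : ∀ s, HasDerivAt (fun s => conjMat Ω *ᵥ c s) (conjMat Ω *ᵥ c' s) s := fun s =>
      hasDerivAt_mulVec (conjMat Ω) (hcd s)
    have hρc' : Continuous fun s => ρ' (conjMat Ω *ᵥ c s) :=
      hρ'.1.comp_continuous (continuous_mulVec_comp _ hcc) hc''
    have hρ0' : ∀ s, ρ' (conjMat Ω *ᵥ c s) ≠ 0 := fun s =>
      hρ'.ne_zero (hc'' s) (dual_ne_zero hΩ hdet (hc s))
    have hK := thetaKernel_sub_eq_gaussAverage (neg_inv_transpose hΩ.1) hcd'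
      (continuous_mulVec_comp _ hc') hρc' (fun s => hρ'.2 _ (hc'' s)) hρ0' ξ
    rw [h0, h1, Matrix.mulVec_smul, thetaKernel_smul hρ'
      (conjMat_mulVec_mem_negCone hΩ.1 hdet hc₂) (dual_ne_zero hΩ hdet hc₂) ha] at hK
    rw [fourierPi_gaussAverage hA hpos hl, hK, gaussAverage, gaussAverage,
      ← intervalIntegral.integral_const_mul]
    refine intervalIntegral.integral_congr fun s _ => ?_
    have hAdet := (hpos s).det_ne_zero
    have hS : sqrtDet ρ ρ' d Ω = sqrtDet ρ ρ' (c s) Ω := sqrtDet_eq hΩ hdet hρ hρ' hd (hc s)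
    rw [neg_omegaC_inv hΩ.1 hdet hAdet (hγ s), omegaC_inv_mulVec_slopeForm hΩ.1 hdet _ hAdet
      (hρ0 s) (hρ0' s) (hρ.2 _ (hc s)) (hρ'.2 _ (hc'' s)), smul_smul, smul_dotProduct, smul_eq_mul,
      mul_assoc, hS]
    congr 1
    rw [sqrtDet, sqrtDetDefinite_eq, inv_div, mul_comm (ρ (c s)), ← div_div, div_inv_eq_mul]
    ring

end Fourier

/-! ### The theta series along the ray `tΩ` -/

section Ray

variable {g : ℕ} {Ω : Matrix (Fin g) (Fin g) ℂ}

/-- With the exponential prefactor of the theta null included, the `n`-th term of the series for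
`tΩ` depends on `t`, `n` and `q` through `√t (n + q)`, apart from a character. -/
theorem thetaTerm_eq (hΩ : Ωᵀ = Ω) (ρ : (Fin g → ℂ) → ℂ) (c₁ c₂ : Fin g → ℂ) (p q : Fin g → ℝ)
    {t : ℝ} (ht : 0 < t) (n : Fin g → ℤ) :
    e (1 / 2 * (vecC q ⬝ᵥ (((t : ℂ) • Ω) *ᵥ vecC q)) + ((p ⬝ᵥ q : ℝ) : ℂ)) *
      thetaTerm (scaleBranch t ρ) c₁ c₂ (charPoint p q ((t : ℂ) • Ω)) ((t : ℂ) • Ω) n =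
    (thetaKernel ρ Ω c₂ (Real.sqrt t • ((fun i => (n i : ℝ)) + q)) -
      thetaKernel ρ Ω c₁ (Real.sqrt t • ((fun i => (n i : ℝ)) + q))) *
        e (((p ⬝ᵥ ((fun i => (n i : ℝ)) + q) : ℝ)) : ℂ) := by
  set ν : Fin g → ℝ := fun i => (n i : ℝ) with hν
  have hνC : (fun j => (n j : ℂ)) = vecC ν := by ext j; simp [hν, vecC]
  have hadd : vecC (ν + q) = vecC ν + vecC q := by ext j; simp [vecC]
  have hsq : ((Real.sqrt t : ℝ) : ℂ) ^ 2 = t := by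
    rw [← Complex.ofReal_pow, Real.sq_sqrt ht.le]
  have hs0 : ((Real.sqrt t : ℝ) : ℂ) ≠ 0 := by exact_mod_cast (Real.sqrt_pos.2 ht).ne'
  have hsmul : vecC (Real.sqrt t • (ν + q)) = ((Real.sqrt t : ℝ) : ℂ) • vecC (ν + q) := by
    ext j; simp [vecC]
  have hy : (fun j => ((((((t : ℂ) • Ω) *ᵥ vecC ν + charPoint p q ((t : ℂ) • Ω)) j).im : ℝ) : ℂ)) =
      (t : ℂ) • (toC (imMat Ω) *ᵥ vecC (ν + q)) := by
    have h1 : ((t : ℂ) • Ω) *ᵥ vecC ν + charPoint p q ((t : ℂ) • Ω) =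
        vecC p + (t : ℂ) • (Ω *ᵥ vecC (ν + q)) := by
      rw [charPoint, hadd, Matrix.mulVec_add, Matrix.smul_mulVec, Matrix.smul_mulVec, smul_add]
      abel
    rw [h1, toC_mulVec]
    ext j
    simp [vecC, Matrix.mulVec, dotProduct, imMat, Complex.im_sum]
  have harg : ∀ c : Fin g → ℂ, (c ⬝ᵥ ((t : ℂ) • (toC (imMat Ω) *ᵥ vecC (ν + q)))) /
      (scaleBranch t ρ c / ((Real.sqrt 2 : ℝ) : ℂ)) =
      (c ⬝ᵥ (toC (imMat Ω) *ᵥ vecC (Real.sqrt t • (ν + q)))) / (ρ c / ((Real.sqrt 2 : ℝ) : ℂ)) := by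
    intro c
    rw [scaleBranch, hsmul, Matrix.mulVec_smul, dotProduct_smul, dotProduct_smul, smul_eq_mul,
      smul_eq_mul, ← hsq, sq, mul_assoc, mul_div_assoc ((Real.sqrt t : ℝ) : ℂ) (ρ c),
      mul_div_mul_left _ _ hs0]
  have hexp : e (1 / 2 * (vecC q ⬝ᵥ (((t : ℂ) • Ω) *ᵥ vecC q)) + ((p ⬝ᵥ q : ℝ) : ℂ)) *
      e (1 / 2 * (vecC ν ⬝ᵥ (((t : ℂ) • Ω) *ᵥ vecC ν)) + vecC ν ⬝ᵥ charPoint p q ((t : ℂ) • Ω)) =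
      gauss Ω (Real.sqrt t • (ν + q)) * e (((p ⬝ᵥ (ν + q) : ℝ)) : ℂ) := by
    rw [gauss, ← e_add, ← e_add, hsmul, hadd, charPoint]
    congr 1
    have hp : ∀ y : Fin g → ℝ, ((p ⬝ᵥ y : ℝ) : ℂ) = vecC p ⬝ᵥ vecC y := fun y => by
      simp [dotProduct, vecC]
    have hqν := dotProduct_mulVec_comm hΩ (vecC q) (vecC ν)
    change _ + (_ + vecC ν ⬝ᵥ (vecC p + ((t : ℂ) • Ω) *ᵥ vecC q)) = _
    rw [hp, hp, hadd]
    simp only [Matrix.smul_mulVec, Matrix.mulVec_smul, Matrix.mulVec_add, dotProduct_add,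
      add_dotProduct, dotProduct_smul, smul_dotProduct, smul_eq_mul, hqν,
      dotProduct_comm (vecC ν) (vecC p)]
    linear_combination (-(1 / 2 * (vecC ν ⬝ᵥ (Ω *ᵥ vecC ν) + 2 * (vecC ν ⬝ᵥ (Ω *ᵥ vecC q)) +
      vecC q ⬝ᵥ (Ω *ᵥ vecC q)))) * hsq
  simp only [thetaTerm, hνC, hy, harg, thetaKernel]
  linear_combination (incGauss ((c₂ ⬝ᵥ (toC (imMat Ω) *ᵥ vecC (Real.sqrt t • (ν + q)))) /
    (ρ c₂ / ((Real.sqrt 2 : ℝ) : ℂ))) - incGauss ((c₁ ⬝ᵥ (toC (imMat Ω) *ᵥ vecC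
      (Real.sqrt t • (ν + q)))) / (ρ c₁ / ((Real.sqrt 2 : ℝ) : ℂ)))) * hexp

theorem thetaRay_eq (hΩ : Ωᵀ = Ω) (ρ : (Fin g → ℂ) → ℂ) (c₁ c₂ : Fin g → ℂ) (p q : Fin g → ℝ)
    {t : ℝ} (ht : 0 < t) :
    thetaRay ρ c₁ c₂ p q Ω t =
      latticeTheta (fun x => thetaKernel ρ Ω c₂ x - thetaKernel ρ Ω c₁ x) p q t := by
  rw [thetaRay, thetaNull, indefTheta, latticeTheta, ← tsum_mul_left]
  exact tsum_congr fun n => thetaTerm_eq hΩ ρ c₁ c₂ p q ht n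

theorem incGauss_neg (α : ℂ) : incGauss (-α) = -incGauss α := by
  simp [incGauss]

theorem thetaKernel_neg (ρ : (Fin g → ℂ) → ℂ) (Ω : Matrix (Fin g) (Fin g) ℂ) (c : Fin g → ℂ)
    (x : Fin g → ℝ) : thetaKernel ρ Ω c (-x) = -thetaKernel ρ Ω c x := by
  have : vecC (-x) = -vecC x := by ext; simp [vecC]
  rw [thetaKernel, thetaKernel, gauss, gauss, this, Matrix.mulVec_neg, dotProduct_neg, neg_div,
    incGauss_neg, Matrix.mulVec_neg, neg_dotProduct_neg, neg_mul]

theorem mellin_congr {f h : ℝ → ℂ} (hfh : ∀ t, 0 < t → f t = h t) (s : ℂ) :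
    mellin f s = mellin h s :=
  setIntegral_congr_fun measurableSet_Ioi fun t ht => by simp only [hfh t ht]

end Ray

end IndefZeta

end

theorem theorem1p1 {g : ℕ} (Ω : Matrix (Fin g) (Fin g) ℂ) (hΩ : Ω ∈ siegelHalfSpace g 1)
    (p q : Fin g → ℝ) (c₁ c₂ : Fin g → ℂ)
    (hc₁ : c₁ ∈ negCone (imMat Ω)) (hc₂ : c₂ ∈ negCone (imMat Ω))
    (ρ : (Fin g → ℂ) → ℂ) (hρ : IsSqrtBranch (imMat Ω) ρ) :
    (∀ t : ℝ, 0 < t → Summable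
      (thetaTerm (scaleBranch t ρ) c₁ c₂ (charPoint p q ((t : ℂ) • Ω)) ((t : ℂ) • Ω))) ∧
    (∀ s : ℂ, MellinConvergent (thetaRay ρ c₁ c₂ p q Ω) s) ∧
    Differentiable ℂ (zetaHat ρ c₁ c₂ p q Ω) ∧
    (Ω.det ≠ 0 → ∀ ρ' : (Fin g → ℂ) → ℂ, IsSqrtBranch (imMat (-Ω⁻¹)) ρ' →
      ∀ c ∈ negCone (imMat Ω), ∀ s : ℂ,
        zetaHat ρ c₁ c₂ p q Ω ((g : ℂ) / 2 - s) =
          -(e ((p ⬝ᵥ q : ℝ) : ℂ) / sqrtDet ρ ρ' c Ω) *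
            zetaHat ρ' (conjMat Ω *ᵥ c₁) (conjMat Ω *ᵥ c₂) (-q) p (-Ω⁻¹) s) := by
  obtain ⟨A, l, hA, hpos, hl, hF, hfour⟩ := exists_gaussAverage_eq hΩ hρ hc₁ hc₂
  have hA' : Continuous fun s => -(A s)⁻¹ :=
    (continuous_matrix_inv hA fun s => (hpos s).det_ne_zero).neg
  have hl' : Continuous fun s => (∫ x, gauss (A s) x) • ((A s)⁻¹ *ᵥ l s) :=
    (continuous_integral_gauss hA hpos).smul
      ((continuous_matrix_inv hA fun s => (hpos s).det_ne_zero).matrix_mulVec hl)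
  have hfc := continuous_gaussAverage hA hl
  have hfd := rapidlyDecreasing_gaussAverage hA hpos hl
  have hf0 := gaussAverage_zero A l
  have hFd : RapidlyDecreasing (fourierPi (gaussAverage A l)) := by
    rw [fourierPi_gaussAverage hA hpos hl]
    exact rapidlyDecreasing_gaussAverage hA' (fun s => (hpos s).neg_inv) hl'
  have hF0 : fourierPi (gaussAverage A l) 0 = 0 := by
    rw [fourierPi_gaussAverage hA hpos hl]
    exact gaussAverage_zero _ _
  have hray : ∀ t, 0 < t → thetaRay ρ c₁ c₂ p q Ω t = latticeTheta (gaussAverage A l) p q t := by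
    intro t ht
    rw [thetaRay_eq hΩ.1 ρ c₁ c₂ p q ht, hF]
  have hzeta : zetaHat ρ c₁ c₂ p q Ω = mellin (latticeTheta (gaussAverage A l) p q) :=
    funext fun s => mellin_congr hray s
  refine ⟨fun t ht => ?_, fun s => ?_, fun s => ?_, fun hdet ρ' hρ' c hc s => ?_⟩
  · have h1 := summable_latticeTheta hfd hf0 p q t
    rw [← hF] at h1
    have h2 := h1.congr fun n => (thetaTerm_eq hΩ.1 ρ c₁ c₂ p q ht n).symm
    exact (summable_mul_left_iff (Complex.exp_ne_zero _)).1 h2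
  · exact (mellin_latticeTheta hfc hfd hf0 hFd hF0 p q s).1.congr_fun
      (fun t ht => by simp only [hray t ht]) measurableSet_Ioi
  · rw [hzeta]
    exact (mellin_latticeTheta hfc hfd hf0 hFd hF0 p q s).2
  · have hκ := hfour hdet ρ' hρ' c hc
    set κ := (sqrtDet ρ ρ' c Ω)⁻¹ with hκdef
    set F' : (Fin g → ℝ) → ℂ := fun ξ => thetaKernel ρ' (-Ω⁻¹) (conjMat Ω *ᵥ c₂) ξ -
            thetaKernel ρ' (-Ω⁻¹) (conjMat Ω *ᵥ c₁) ξ with hF'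
    -- oddness of the dual kernel turns the characteristics `(q, -p)` into `(-q, p)`
    have hodd : ∀ x, F' (-x) = -F' x := fun x => by
      simp only [hF', thetaKernel_neg]; ring
    have hinv : ∀ t, 0 < t → latticeTheta (gaussAverage A l) p q t =
        ((t : ℂ) ^ (-(g : ℂ) / 2)) • (-(κ * e ((p ⬝ᵥ q : ℝ) : ℂ)) •
          thetaRay ρ' (conjMat Ω *ᵥ c₁) (conjMat Ω *ᵥ c₂) (-q) p (-Ω⁻¹) t⁻¹) := by
      intro t ht
      have h1 : latticeTheta (fourierPi (gaussAverage A l)) q (-p) t⁻¹ =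
          κ * latticeTheta F' q (-p) t⁻¹ := by
        rw [latticeTheta, latticeTheta, ← tsum_mul_left]
        exact tsum_congr fun n => by rw [hκ, mul_assoc]
      have h2 : latticeTheta F' (-q) p t⁻¹ = -latticeTheta F' q (-p) t⁻¹ := by
        have := latticeTheta_neg hodd q (-p) t⁻¹
        rwa [neg_neg] at this
      have h3 : (((Real.sqrt t ^ Fintype.card (Fin g))⁻¹ : ℝ) : ℂ) = (t : ℂ) ^ (-(g : ℂ) / 2) := by
        rw [Fintype.card_fin, Real.sqrt_eq_rpow, ← Real.rpow_natCast, ← Real.rpow_mul ht.le,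
          ← Real.rpow_neg ht.le, Complex.ofReal_cpow ht.le]
        congr 1
        push_cast; ring
      rw [thetaRay_eq (neg_inv_transpose hΩ.1) ρ' _ _ _ _ (inv_pos.2 ht), h2,
        latticeTheta_eq_fourierPi hfc hfd hFd hF0 p q ht, h1, h3, smul_eq_mul, smul_eq_mul]
      ring
    rw [hzeta, mellin_congr hinv, mellin_cpow_smul, mellin_const_smul,
      mellin_comp_inv (fun t => thetaRay ρ' (conjMat Ω *ᵥ c₁) (conjMat Ω *ᵥ c₂) (-q) p (-Ω⁻¹) t),
      zetaHat, smul_eq_mul]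
    congr 2
    · rw [hκdef, div_eq_mul_inv, mul_comm]
    · ring
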